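/- **Conventions.** Let $\varphi:[0,\infty)\to[0,\infty)$ be a modulus of continuity (nondecreasing, $\varphi(0)=0$, $\varphi(r)>0$ for $r>0$, $\varphi(r)\to0$ as $r\to0^+$) such that * (A1) for some $0<\theta<\tfrac12$, $\int_0^r \varphi(s)^\theta\,\frac{ds}{s}\to 0$ as $r\to0$; * (A2) there is $C>0$ such that for every $0<\delta<1$, $\sup_{0<r<C\delta}\frac{\varphi(\delta^{-1}r)}{\varphi(r)}\varphi(\delta)<\infty$; * (A3) near $r=0$ the function $\varphi(r)(-\log r)$ belongs to $C^{\tilde\varphi}$, where $\tilde\varphi(r)=\int_0^r\frac{\varphi(s)}{s}\,ds$. $C^{\varphi}(\mathbb R)$ is the space of bounded $g$ with $|g(x)-g(y)|\le C\varphi(|x-y|)$ for some constant $C$; $C^{1,\varphi}(\mathbb R)$ is the space of bounded differentiable $g$ with $g'\in C^\varphi(\mathbb R)$; for vector-valued functions these are understood componentwise. $P.V.\int_{\mathbb R}g(y)\,dy$ with singular point $x$ means $\lim_{\varepsilon\to0^+,\,R\to\infty}\int_{\varepsilon<|x-y|<R}g(y)\,dy$, and $\mathcal H[g](x)=\frac1\pi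 P.V.\int_{\mathbb R}\frac{g(y)}{x-y}\,dy$. $\mathcal H_1$ is the Hilbert transform in the first of two variables. For $f=(f_1,\dots,f_l):\mathbb R\to\mathbb R^l$ put $\mathcal Q[f_k](x,y)=\frac{f_k(x)-f_k(y)}{x-y}$, $\Pi\mathcal Q[f]^{n_1,\dots,n_l}=\prod_{k=1}^l\mathcal Q[f_k]^{n_k}$ for integers $n_1,\dots,n_l\ge0$, and $$\mathcal T_0^{n_1,\dots,n_l}[f](x)=P.V.\int_{\mathbb R}\frac{1}{x-y}\,\Pi\mathcal Q[f]^{n_1,\dots,n_l}(x,y)\,dy,$$ $$\mathcal T_j^{n_1,\dots,n_l}[f](x)=P.V.\int_{\mathbb R}\frac{f_j'(y)}{x-y}\,\Pi\mathcal Q[f]^{n_1,\dots,n_l}(x,y)\,dy\qquad(1\le j\le l).$$ **Lemma.** Suppose that $f$ has compact support and that $f,\mathcal H[f]\in C^{1,\varphi}(\mathbb R;\mathbb R^l)$. Then for all $j\in\{0,1,\dots,l\}$ and all $n_1,\dots,n_l\ge0$ the principal values defining $\mathcal T_j^{n_1,\dots,n_l}[f]$ and $\mathcal H[\mathcal T_j^{n_1,\dots,n_l}[f]]$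 exist at every point, and $\mathcal H[\mathcal T_j^{n_1,\dots,n_l}[f]]\in C^\varphi(\mathbb R)$. Moreover, let $n_1,\dots,n_l\ge1$ and $n=\sum_{k=1}^l n_k$. Then $$\mathcal H[\mathcal T_0^{n_1,\dots,n_l}[f]]=\sum_{k=1}^l\frac{n_k}{n}\,\mathcal H[\mathcal T_k^{n_1,\dots,n_k-1,\dots,n_l}[f]],$$ and for every $j\in\{1,\dots,l\}$ $$\mathcal H[\mathcal T_j^{n_1,\dots,n_l}[f]]=-\sum_{k=1}^l\frac{n_k}{n}\,\mathcal H[f_j'\,\mathcal T_k^{n_1,\dots,n_k-1,\dots,n_l}[f]]+2f_j'\sum_{k=1}^l\frac{n_k}{n}\,\mathcal H[\mathcal T_k^{n_1,\dots,n_k-1,\dots,n_l}[f]]+\mathcal H[f_j']\,\mathcal T_0^{n_1,\dots,n_l}[f]+J_{\mathrm{rem}},$$ where $$J_{\mathrm{rem}}(x)=P.V.\int_{\mathbb R}\frac{f_j'(x)-f_j'(z)}{x-z}\,\bigl(\mathcal N(x,x)-\mathcal N(x,z)\bigr)\,dz,\qquad \mathcal N(x,z)=\mathcal H_1[\Pi\mathcal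 Q[f]^{n_1,\dots,n_l}](x,z),$$ and all principal values occurring in these formulas exist at every point. -/

import Mathlib

open Filter Topology MeasureTheory

namespace CriticalHilbert

/-! ### Moduli of continuity and the spaces `C^φ`, `C^{1,φ}` -/

/-- A modulus of continuity: only the values of `φ` on `[0, ∞)` matter. -/
structure IsModulus (φ : ℝ → ℝ) : Prop where
  zero : φ 0 = 0
  pos : ∀ r, 0 < r → 0 < φ r
  mono : MonotoneOn φ (Set.Ici 0)
  tendsto_zero : Tendsto φ (𝓝[>] 0) (𝓝 0)

/-- The induced modulus `φ̃(r) = ∫₀ʳ φ(s)/s ds`. -/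
noncomputable def inducedModulus (φ : ℝ → ℝ) (r : ℝ) : ℝ :=
  ∫ s in (0 : ℝ)..r, φ s / s

/-- The standing structural assumptions on the modulus of continuity. -/
structure IsAdmissibleModulus (φ : ℝ → ℝ) : Prop extends IsModulus φ where
  /-- For some `0 < θ < 1/2`, `∫₀ʳ φ(s)^θ / s ds → 0` as `r → 0`. -/
  dini : ∃ θ : ℝ, 0 < θ ∧ θ < 1 / 2 ∧
    Tendsto (fun r : ℝ => ∫⁻ s in Set.Ioc 0 r, ENNReal.ofReal (φ s ^ θ / s)) (𝓝[>] 0) (𝓝 0)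
  /-- For some `C > 0`, `sup_{0 < r < Cδ} φ(r/δ) φ(δ) / φ(r) < ∞` for every `0 < δ < 1`. -/
  scaling : ∃ C : ℝ, 0 < C ∧ ∀ δ : ℝ, 0 < δ → δ < 1 →
    BddAbove ((fun r : ℝ => φ (δ⁻¹ * r) / φ r * φ δ) '' Set.Ioo 0 (C * δ))
  /-- Near the origin, `r ↦ φ(r) (-log r)` has modulus of continuity `φ̃`. -/
  log_mul : ∃ r₀ C : ℝ, 0 < r₀ ∧ ∀ r ∈ Set.Ioc 0 r₀, ∀ s ∈ Set.Ioc 0 r₀,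
    |φ r * (-Real.log r) - φ s * (-Real.log s)| ≤ C * inducedModulus φ |r - s|

/-- `g ∈ C^φ(ℝ)`: `g` is bounded and `|g x - g y| ≤ C φ(|x - y|)`. -/
def MemC (φ : ℝ → ℝ) (g : ℝ → ℝ) : Prop :=
  (∃ B : ℝ, ∀ x, |g x| ≤ B) ∧ ∃ C : ℝ, ∀ x y, |g x - g y| ≤ C * φ |x - y|

/-- `g ∈ C^{1,φ}(ℝ)`: `g` is bounded and differentiable, and `g' ∈ C^φ(ℝ)`. -/
def MemC1 (φ : ℝ → ℝ) (g : ℝ → ℝ) : Prop :=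
  Differentiable ℝ g ∧ (∃ B : ℝ, ∀ x, |g x| ≤ B) ∧ MemC φ (deriv g)

/-! ### Principal values and the Hilbert transform -/

/-- The truncated line `{y : ε < |x - y| < R}`. -/
def annulus (x ε R : ℝ) : Set ℝ := {y | ε < |x - y| ∧ |x - y| < R}

/-- The principal value of `∫ g(y) dy` at `x` and at infinity exists and equals `L`: `g` is
integrable on every `{ε < |x - y| < R}` and `∫_{ε < |x - y| < R} g(y) dy → L` as `ε → 0⁺` and
`R → ∞` jointly. -/
def HasPV (g : ℝ → ℝ) (x L : ℝ) : Prop :=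
  (∀ ε R : ℝ, 0 < ε → IntegrableOn g (annulus x ε R)) ∧
  Tendsto (fun p : ℝ × ℝ => ∫ y in annulus x p.1 p.2, g y) (𝓝[>] 0 ×ˢ atTop) (𝓝 L)

/-- The principal value of `∫ g(y) dy` at `x` exists. -/
def PVExists (g : ℝ → ℝ) (x : ℝ) : Prop := ∃ L, HasPV g x L

/-- The number `P.V. ∫ g(y) dy`, singular point `x` (meaningful when `PVExists g x`). -/
noncomputable def pv (g : ℝ → ℝ) (x : ℝ) : ℝ :=
  limUnder (𝓝[>] (0 : ℝ) ×ˢ (atTop : Filter ℝ))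
    (fun p : ℝ × ℝ => ∫ y in annulus x p.1 p.2, g y)

/-- The Hilbert transform `H[g](x) = (1/π) P.V. ∫ g(y)/(x - y) dy`. -/
noncomputable def hilbert (g : ℝ → ℝ) (x : ℝ) : ℝ :=
  1 / Real.pi * pv (fun y => g y / (x - y)) x

/-- The principal value defining `H[g](x)` exists at every point `x`. -/
def HilbertExists (g : ℝ → ℝ) : Prop := ∀ x, PVExists (fun y => g y / (x - y)) x

/-! ### The operators `T_j^{n₁,…,n_l}`

A map `f : ℝ → ℝ^l` is given by its components `f k`, and `(n₁,…,n_l)` is `n : Fin l → ℕ`. -/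

/-- The difference quotient `Q[g](x, y) = (g x - g y)/(x - y)`. It occurs below only under
integrals in which the diagonal `x = y` is a null set. -/
noncomputable def diffQuot (g : ℝ → ℝ) (x y : ℝ) : ℝ := (g x - g y) / (x - y)

/-- `ΠQ[f]^{n₁,…,n_l}(x, y) = ∏ₖ Q[fₖ](x, y)^{nₖ}`. -/
noncomputable def prodQuot {l : ℕ} (f : Fin l → ℝ → ℝ) (n : Fin l → ℕ) (x y : ℝ) : ℝ :=
  ∏ k, diffQuot (f k) x y ^ n k

/-- The integrand of `T_0^{n₁,…,n_l}[f](x)`. -/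
noncomputable def integrand0 {l : ℕ} (f : Fin l → ℝ → ℝ) (n : Fin l → ℕ) (x y : ℝ) : ℝ :=
  1 / (x - y) * prodQuot f n x y

/-- The integrand of `T_j^{n₁,…,n_l}[f](x)`, `j ∈ {1,…,l}`. -/
noncomputable def integrand {l : ℕ} (f : Fin l → ℝ → ℝ) (j : Fin l) (n : Fin l → ℕ)
    (x y : ℝ) : ℝ :=
  deriv (f j) y / (x - y) * prodQuot f n x y

/-- `T_0^{n₁,…,n_l}[f](x) = P.V. ∫ 1/(x - y) ΠQ[f]^{n₁,…,n_l}(x, y) dy`. -/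
noncomputable def opT0 {l : ℕ} (f : Fin l → ℝ → ℝ) (n : Fin l → ℕ) (x : ℝ) : ℝ :=
  pv (integrand0 f n x) x

/-- `T_j^{n₁,…,n_l}[f](x) = P.V. ∫ f_j'(y)/(x - y) ΠQ[f]^{n₁,…,n_l}(x, y) dy`. -/
noncomputable def opT {l : ℕ} (f : Fin l → ℝ → ℝ) (j : Fin l) (n : Fin l → ℕ) (x : ℝ) : ℝ :=
  pv (integrand f j n x) x

/-- The multi-index `(n₁, …, nₖ - 1, …, n_l)`. -/
def lower {l : ℕ} (n : Fin l → ℕ) (k : Fin l) : Fin l → ℕ :=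
  Function.update n k (n k - 1)

/-- `N(x, z) = H₁[ΠQ[f]^{n₁,…,n_l}](x, z)`, the Hilbert transform in the first argument. -/
noncomputable def kerN {l : ℕ} (f : Fin l → ℝ → ℝ) (n : Fin l → ℕ) (x z : ℝ) : ℝ :=
  hilbert (fun y => prodQuot f n y z) x

/-- The integrand of the remainder term,
`(f_j'(x) - f_j'(z))/(x - z) (N(x, x) - N(x, z))`. -/
noncomputable def integrandRem {l : ℕ} (f : Fin l → ℝ → ℝ) (j : Fin l) (n : Fin l → ℕ)
    (x z : ℝ) : ℝ :=
  (deriv (f j) x - deriv (f j) z) / (x - z) * (kerN f n x x - kerN f n x z)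

/-- `J_rem(x) = P.V. ∫ (f_j'(x) - f_j'(z))/(x - z) (N(x, x) - N(x, z)) dz`. -/
noncomputable def Jrem {l : ℕ} (f : Fin l → ℝ → ℝ) (j : Fin l) (n : Fin l → ℕ) (x : ℝ) : ℝ :=
  pv (integrandRem f j n x) x

end CriticalHilbert

open CriticalHilbert

namespace CriticalHilbert

/-! ### Principal values -/

/-! Let F(x, y) be the product of difference quotients, extended to the diagonal by derivatives
(`dqProd`). It is symmetric, has modulus φ in each variable, and gains a factor |x-y|/|x-z| away
from the diagonal. For n ≠ 0 it also decays like 1/|x-z| and vanishes when both arguments leave the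
support of f (`exists_symKernel_dqProd`).

The formula for j = 0 is integration by parts. The y-derivative of F(x, y) is |n| times the
integrand of T_0 minus Σ n_k times the integrands of the lowered T_k, and the principal value of a
derivative vanishes (`CurveData.sum_mul_opT0`). The identity holds already before a Hilbert
transform is applied.

The formula for j ≥ 1 is a Poincaré–Bertrand computation. Fix x and put g = f_j' - f_j'(x). The
symmetrised operator S(y) = P.V.∫ F(y,z)(g(y)+g(z))/(y-z) dz equals T_j + f_j' T_0 - 2 f_j'(x) T_0.
Replace 1/t by the conjugate Poisson kernel t/(t²+ε²) in both integrals, exchange y and z in the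
part with g(y), and apply the resolvent identity `ck_mul_ck_sub`. Once the inner parameter has gone
to 0, the regularised transform of S is a difference of two double integrals of g(z)F(y,z): one with
two conjugate Poisson kernels, the other with two Poisson kernels (`SymKernel.integral_ck_eq`). As ε
→ 0 the first tends to P.V.∫ g(z) πN(x,z)/(x-z) dz. The second tends to 0 because g(x) = 0.
Splitting N(x,z) = N(x,x) - (N(x,x)-N(x,z)) and using πN(x,x) = T_0(x) produces H[f_j'] T_0 + J_rem
(`CurveData.hilbert_opT`).

Regularity rests on one estimate, `BilData.diff_le`, for bilinear integrals P.V.∫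
(g(x)-g(z))(b(x)-M(x,z))/(x-z) dz. The first factor is O(φ) and the second only O(φ̃), and near the
diagonal their product integrates to φ̃(d)², which is O(φ(d)) since θ < 1/2 in (A1). Assumption (A3)
gives φ̃(√d) = O(φ̃(d)), so that scales between d and √d cost nothing, and beyond √d powers of d
win. The estimate is used with M = F (regularity of T_j), with M a function of z alone (Hilbert
transform of a product), and with M = πN (the remainder).

Induction on |n| then closes. T_0 is a combination of lowered T_k, and T_j is expressed through T_0
and a bilinear term. At n = 0 one has T_j = πH[f_j'] and H² = -1. The hypothesis on H[f] enters
through H[f]' = H[f'] (`hasDerivAt_hilbert`). -/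

abbrev pvFilter : Filter (ℝ × ℝ) := 𝓝[>] (0 : ℝ) ×ˢ (atTop : Filter ℝ)

/-- The closed neighbourhood `{y : |x - y| ≤ r}`. -/
def near (x r : ℝ) : Set ℝ := {y | |x - y| ≤ r}

/-- The exterior region `{y : r < |x - y|}`. -/
def far (x r : ℝ) : Set ℝ := {y | r < |x - y|}

theorem measurableSet_annulus (x ε R : ℝ) : MeasurableSet (annulus x ε R) := by
  have h : Measurable fun y : ℝ => |x - y| := by fun_prop
  exact (measurableSet_lt measurable_const h).inter (measurableSet_lt h measurable_const)

theorem measurableSet_near (x r : ℝ) : MeasurableSet (near x r) :=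
  measurableSet_le (by fun_prop) measurable_const

theorem measurableSet_far (x r : ℝ) : MeasurableSet (far x r) :=
  measurableSet_lt measurable_const (by fun_prop)

theorem compl_near (x r : ℝ) : (near x r)ᶜ = far x r := by
  ext y; simp [near, far]

theorem near_eq_Icc (x r : ℝ) : near x r = Set.Icc (x - r) (x + r) := by
  ext y
  simp only [near, Set.mem_ofPred_eq, Set.mem_Icc, abs_le]
  constructor <;> rintro ⟨h1, h2⟩ <;> constructor <;> linarith

theorem near_subset_near {x r s : ℝ} (h : r ≤ s) : near x r ⊆ near x s :=
  fun _ hy => le_trans hy h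

theorem annulus_subset_near (x ε R : ℝ) : annulus x ε R ⊆ near x R := fun _ hy => hy.2.le

theorem volume_near_lt_top (x r : ℝ) : volume (near x r) < ⊤ := by
  rw [near_eq_Icc]; simp

theorem volume_annulus_lt_top (x ε R : ℝ) : volume (annulus x ε R) < ⊤ :=
  (measure_mono (annulus_subset_near x ε R)).trans_lt (volume_near_lt_top x R)

theorem eventually_pvFilter_mem (x y : ℝ) (h : y ≠ x) :
    ∀ᶠ p : ℝ × ℝ in pvFilter, y ∈ annulus x p.1 p.2 := by
  have hp : 0 < |x - y| := abs_pos.mpr (sub_ne_zero.mpr h.symm)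
  have h1 : ∀ᶠ ε in 𝓝[>] (0 : ℝ), ε < |x - y| :=
    mem_nhdsWithin_of_mem_nhds (Iio_mem_nhds hp)
  exact (h1.prod_mk (eventually_gt_atTop |x - y|)).mono fun p hp => hp

theorem eventually_pvFilter_pos :
    ∀ᶠ p : ℝ × ℝ in pvFilter, 0 < p.1 :=
  (eventually_mem_nhdsWithin (a := (0 : ℝ)) (s := Set.Ioi 0)).prod_inl _

theorem HasPV.unique {g : ℝ → ℝ} {x L L' : ℝ} (h : HasPV g x L) (h' : HasPV g x L') : L = L' :=
  tendsto_nhds_unique h.2 h'.2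

theorem HasPV.pv_eq {g : ℝ → ℝ} {x L : ℝ} (h : HasPV g x L) : pv g x = L := h.2.limUnder_eq

theorem PVExists.hasPV {g : ℝ → ℝ} {x : ℝ} (h : PVExists g x) : HasPV g x (pv g x) := by
  obtain ⟨L, hL⟩ := h
  rwa [hL.pv_eq]

theorem HasPV.congr_ae {g g' : ℝ → ℝ} {x L : ℝ} (h : HasPV g x L) (hg : g =ᵐ[volume] g') :
    HasPV g' x L := by
  refine ⟨fun ε R hε => (h.1 ε R hε).congr_fun_ae (ae_restrict_of_ae hg), ?_⟩
  refine h.2.congr fun p => ?_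
  exact integral_congr_ae (ae_restrict_of_ae hg)

theorem ae_eq_of_ne {g g' : ℝ → ℝ} (x : ℝ) (h : ∀ y, y ≠ x → g y = g' y) :
    g =ᵐ[volume] g' := by
  filter_upwards [compl_mem_ae_iff.mpr (measure_singleton (μ := volume) x)] with y hy
  exact h y hy

/-- The exceptional point z is independent of the centre x: in the partial transform of a kernel the
singularity sits at x, while the diagonal value of the kernel sits at z. -/
theorem HasPV.congr_ne {g g' : ℝ → ℝ} {x L : ℝ} (h : HasPV g x L) (z : ℝ)
    (hg : ∀ y, y ≠ z → g y = g' y) : HasPV g' x L :=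
  h.congr_ae (ae_eq_of_ne z hg)

theorem HasPV.add {g g' : ℝ → ℝ} {x L L' : ℝ} (h : HasPV g x L) (h' : HasPV g' x L') :
    HasPV (fun y => g y + g' y) x (L + L') := by
  refine ⟨fun ε R hε => (h.1 ε R hε).add (h'.1 ε R hε), (h.2.add h'.2).congr' ?_⟩
  filter_upwards [eventually_pvFilter_pos] with p hp
  exact (integral_add (h.1 _ _ hp) (h'.1 _ _ hp)).symm

theorem HasPV.const_mul {g : ℝ → ℝ} {x L : ℝ} (h : HasPV g x L) (c : ℝ) :
    HasPV (fun y => c * g y) x (c * L) := by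
  refine ⟨fun ε R hε => (h.1 ε R hε).const_mul c, (h.2.const_mul c).congr fun p => ?_⟩
  exact (integral_const_mul _ _).symm

theorem HasPV.sub {g g' : ℝ → ℝ} {x L L' : ℝ} (h : HasPV g x L) (h' : HasPV g' x L') :
    HasPV (fun y => g y - g' y) x (L - L') := by
  have := h.add (h'.const_mul (-1))
  simpa [sub_eq_add_neg] using this

theorem hasPV_zero (x : ℝ) : HasPV (fun _ => 0) x 0 :=
  ⟨fun _ _ _ => integrableOn_zero, by simp⟩

theorem HasPV.sum {ι : Type*} (s : Finset ι) {g : ι → ℝ → ℝ} {x : ℝ} {L : ι → ℝ}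
    (h : ∀ i ∈ s, HasPV (g i) x (L i)) : HasPV (fun y => ∑ i ∈ s, g i y) x (∑ i ∈ s, L i) := by
  classical
  induction s using Finset.induction_on with
  | empty => simpa using hasPV_zero x
  | insert a s ha ih =>
    simp only [Finset.sum_insert ha]
    exact (h a (Finset.mem_insert_self _ _)).add
      (ih fun i hi => h i (Finset.mem_insert_of_mem hi))

theorem hasPV_of_integrable {g : ℝ → ℝ} (hg : Integrable g) (x : ℝ) :
    HasPV g x (∫ y, g y) := by
  refine ⟨fun ε R _ => hg.integrableOn, ?_⟩
  have h : Tendsto (fun p : ℝ × ℝ => ∫ y, (annulus x p.1 p.2).indicator g y) pvFilter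
      (𝓝 (∫ y, g y)) := by
    refine tendsto_integral_filter_of_dominated_convergence (fun y => ‖g y‖) ?_ ?_ hg.norm ?_
    · exact Eventually.of_forall fun p =>
        hg.aestronglyMeasurable.indicator (measurableSet_annulus _ _ _)
    · exact Eventually.of_forall fun p => Eventually.of_forall fun y =>
        norm_indicator_le_norm_self _ _
    · filter_upwards [compl_mem_ae_iff.mpr (measure_singleton (μ := volume) x)] with y hy
      refine tendsto_const_nhds.congr' ?_
      filter_upwards [eventually_pvFilter_mem x y hy] with p hp
      rw [Set.indicator_of_mem hp]
  refine h.congr fun p => ?_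
  rw [integral_indicator (measurableSet_annulus _ _ _)]

/-- A function that is odd about `x` has principal value zero. -/
theorem hasPV_odd {o : ℝ → ℝ} {x : ℝ} (hint : ∀ ε R : ℝ, 0 < ε → IntegrableOn o (annulus x ε R))
    (hodd : ∀ y, o (2 * x - y) = -o y) : HasPV o x 0 := by
  refine ⟨hint, ?_⟩
  have : ∀ p : ℝ × ℝ, ∫ y in annulus x p.1 p.2, o y = 0 := by
    intro p
    have h1 : ∫ y in annulus x p.1 p.2, o y
        = ∫ y, (annulus x p.1 p.2).indicator o y :=
      (integral_indicator (measurableSet_annulus _ _ _)).symm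
    have h2 : ∫ y, (annulus x p.1 p.2).indicator o (2 * x - y)
        = ∫ y, (annulus x p.1 p.2).indicator o y :=
      integral_sub_left_eq_self (fun y => (annulus x p.1 p.2).indicator o y) volume (2 * x)
    have h3 : ∀ y, (annulus x p.1 p.2).indicator o (2 * x - y)
        = -(annulus x p.1 p.2).indicator o y := by
      intro y
      have hm : (2 * x - y ∈ annulus x p.1 p.2) ↔ y ∈ annulus x p.1 p.2 := by
        have : |x - (2 * x - y)| = |x - y| := by rw [← abs_neg]; congr 1; ring
        simp only [annulus, Set.mem_ofPred_eq, this]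
      by_cases hy : y ∈ annulus x p.1 p.2
      · rw [Set.indicator_of_mem hy, Set.indicator_of_mem (hm.mpr hy), hodd]
      · rw [Set.indicator_of_notMem hy, Set.indicator_of_notMem (fun h => hy (hm.mp h)), neg_zero]
    simp only [h3, integral_neg] at h2
    rw [h1]; linarith
  simp only [this]
  exact tendsto_const_nhds

/-! ### Bounds for lower integrals -/

/-- `∫⁻_S p ≤ c` for a real-valued integrand. -/
def LB (S : Set ℝ) (p : ℝ → ℝ) (c : ℝ) : Prop :=
  ∫⁻ z in S, ENNReal.ofReal (p z) ≤ ENNReal.ofReal c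

theorem LB.mono_fun {S : Set ℝ} {p q : ℝ → ℝ} {c : ℝ} (h : LB S q c) (hS : MeasurableSet S)
    (hpq : ∀ z ∈ S, p z ≤ q z) : LB S p c :=
  (setLIntegral_mono' hS fun z hz => ENNReal.ofReal_le_ofReal (hpq z hz)).trans h

/-- The centre is a null set and may be ignored, which is needed because kernel bounds are available
only off the diagonal. -/
theorem LB.mono_fun_ae {S : Set ℝ} {p q : ℝ → ℝ} {c : ℝ} (h : LB S q c) (hS : MeasurableSet S)
    (x : ℝ) (hpq : ∀ z ∈ S, z ≠ x → p z ≤ q z) : LB S p c := by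
  refine le_trans (setLIntegral_mono_ae' hS ?_) h
  filter_upwards [compl_mem_ae_iff.mpr (measure_singleton (μ := volume) x)] with y hy hyS
  exact ENNReal.ofReal_le_ofReal (hpq y hyS hy)

theorem LB.mono_set {S T : Set ℝ} {p : ℝ → ℝ} {c : ℝ} (h : LB T p c) (hST : S ⊆ T) : LB S p c :=
  (lintegral_mono_set hST).trans h

theorem LB.mono_const {S : Set ℝ} {p : ℝ → ℝ} {c c' : ℝ} (h : LB S p c) (hc : c ≤ c') :
    LB S p c' :=
  h.trans (ENNReal.ofReal_le_ofReal hc)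

theorem LB.const_mul {S : Set ℝ} {p : ℝ → ℝ} {c a : ℝ} (h : LB S p c) (ha : 0 ≤ a) :
    LB S (fun z => a * p z) (a * c) := by
  unfold LB
  simp only [ENNReal.ofReal_mul ha]
  rw [lintegral_const_mul' _ _ ENNReal.ofReal_ne_top]
  exact mul_le_mul_right h _

theorem LB.add {S : Set ℝ} {p q : ℝ → ℝ} {c c' : ℝ} (h : LB S p c) (h' : LB S q c')
    (hp : Measurable p) (hc : 0 ≤ c) (hc' : 0 ≤ c') : LB S (fun z => p z + q z) (c + c') := by
  unfold LB
  calc ∫⁻ z in S, ENNReal.ofReal (p z + q z)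
      ≤ ∫⁻ z in S, (ENNReal.ofReal (p z) + ENNReal.ofReal (q z)) :=
        lintegral_mono fun z => ENNReal.ofReal_add_le
    _ = (∫⁻ z in S, ENNReal.ofReal (p z)) + ∫⁻ z in S, ENNReal.ofReal (q z) :=
        lintegral_add_left hp.ennreal_ofReal _
    _ ≤ ENNReal.ofReal c + ENNReal.ofReal c' := add_le_add h h'
    _ = ENNReal.ofReal (c + c') := (ENNReal.ofReal_add hc hc').symm

theorem LB.union {S T : Set ℝ} {p : ℝ → ℝ} {c c' : ℝ} (h : LB S p c) (h' : LB T p c')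
    (hc : 0 ≤ c) (hc' : 0 ≤ c') : LB (S ∪ T) p (c + c') := by
  unfold LB
  rw [ENNReal.ofReal_add hc hc']
  exact (lintegral_union_le _ _ _).trans (add_le_add h h')

theorem LB.univ_of {x r : ℝ} {p : ℝ → ℝ} {c c' : ℝ} (h : LB (near x r) p c)
    (h' : LB (far x r) p c') (hc : 0 ≤ c) (hc' : 0 ≤ c') : LB Set.univ p (c + c') := by
  have := h.union h' hc hc'
  rwa [← compl_near, Set.union_compl_self] at this

theorem LB.integrableOn {S : Set ℝ} {u : ℝ → ℝ} {c : ℝ} (h : LB S (fun z => |u z|) c)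
    (hu : AEStronglyMeasurable u (volume.restrict S)) : IntegrableOn u S := by
  refine ⟨hu, ?_⟩
  rw [hasFiniteIntegral_iff_norm]
  exact lt_of_le_of_lt h ENNReal.ofReal_lt_top

theorem LB.abs_integral_le {S : Set ℝ} {u : ℝ → ℝ} {c : ℝ} (h : LB S (fun z => |u z|) c)
    (hc : 0 ≤ c) : |∫ z in S, u z| ≤ c := by
  have h1 : ‖∫ z in S, u z‖ₑ ≤ ENNReal.ofReal c := by
    refine (enorm_integral_le_lintegral_enorm _).trans ?_
    refine le_trans (le_of_eq ?_) h
    refine lintegral_congr fun z => ?_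
    rw [Real.enorm_eq_ofReal_abs]
  rw [Real.enorm_eq_ofReal_abs] at h1
  exact (ENNReal.ofReal_le_ofReal_iff hc).mp h1

theorem LB.integrable {u : ℝ → ℝ} {c : ℝ} (h : LB Set.univ (fun z => |u z|) c)
    (hu : AEStronglyMeasurable u volume) : Integrable u := by
  rw [← integrableOn_univ]
  exact LB.integrableOn h (by simpa using hu)

theorem lb_of_integrableOn {S : Set ℝ} {u : ℝ → ℝ} (h : IntegrableOn u S) (hu : ∀ z, 0 ≤ u z) :
    LB S u (∫ z in S, u z) := by
  unfold LB
  rw [ofReal_integral_eq_lintegral_ofReal h (Eventually.of_forall hu)]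

/-! ### Principal values of integrands that are odd up to an integrable error -/

/-- An integrable perturbation of an odd function has a principal value bounded by the size of the
perturbation. -/
theorem hasPV_of_odd_add {u o : ℝ → ℝ} {x c : ℝ} (hu : AEStronglyMeasurable u volume)
    (ho : HasPV o x 0) (hom : AEStronglyMeasurable o volume)
    (h : LB Set.univ (fun y => |u y - o y|) c) (hc : 0 ≤ c) :
    ∃ L, HasPV u x L ∧ |L| ≤ c := by
  have hi : Integrable fun y => u y - o y := LB.integrable h (hu.sub hom)
  refine ⟨∫ y, (u y - o y), ?_, ?_⟩
  · have := (hasPV_of_integrable hi x).add ho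
    simpa using this
  · have := LB.abs_integral_le h hc
    simpa using this

/-- The odd function about `x` equal to `c₁ / (x - y)` for `|x - y| ≤ ρ` and to `c₂ / (x - y)`
beyond. -/
noncomputable def oddStep (x ρ c₁ c₂ y : ℝ) : ℝ := (if |x - y| ≤ ρ then c₁ else c₂) / (x - y)

theorem measurable_oddStep (x ρ c₁ c₂ : ℝ) : Measurable (oddStep x ρ c₁ c₂) := by
  unfold oddStep
  refine Measurable.div ?_ (by fun_prop)
  exact Measurable.ite (measurableSet_near x ρ) measurable_const measurable_const

theorem hasPV_oddStep (x ρ c₁ c₂ : ℝ) : HasPV (oddStep x ρ c₁ c₂) x 0 := by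
  refine hasPV_odd (fun ε R hε => ?_) fun y => ?_
  · refine Measure.integrableOn_of_bounded (M := (|c₁| + |c₂|) / ε)
      (volume_annulus_lt_top x ε R).ne (measurable_oddStep x ρ c₁ c₂).aestronglyMeasurable ?_
    refine (ae_restrict_iff' (measurableSet_annulus _ _ _)).mpr (Eventually.of_forall fun y hy => ?_)
    unfold oddStep
    rw [Real.norm_eq_abs, abs_div]
    have h1 : |(if |x - y| ≤ ρ then c₁ else c₂)| ≤ |c₁| + |c₂| := by
      split_ifs
      · linarith [abs_nonneg c₂]
      · linarith [abs_nonneg c₁]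
    exact div_le_div₀ (by positivity) h1 hε hy.1.le
  · unfold oddStep
    have h1 : x - (2 * x - y) = -(x - y) := by ring
    rw [h1, abs_neg, div_neg]

theorem hasPV_const_div (x c : ℝ) : HasPV (fun y => c / (x - y)) x 0 :=
  (hasPV_oddStep x 0 c c).congr_ae (Eventually.of_forall fun y => by simp [oddStep])

theorem aestronglyMeasurable_div_sub {p : ℝ → ℝ} (hp : AEStronglyMeasurable p volume) (x : ℝ) :
    AEStronglyMeasurable (fun y => p y / (x - y)) volume := by
  simp only [div_eq_mul_inv]
  exact hp.mul (by fun_prop : Measurable fun y : ℝ => (x - y)⁻¹).aestronglyMeasurable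

/-- Existence and size of `P.V. ∫ p(y)/(x - y) dy`. -/
theorem exists_hasPV_div {p : ℝ → ℝ} (hp : AEStronglyMeasurable p volume) {x ρ c₁ c₂ a b : ℝ}
    (ha : LB (near x ρ) (fun y => |p y - c₁| / |x - y|) a)
    (hb : LB (far x ρ) (fun y => |p y - c₂| / |x - y|) b) (ha0 : 0 ≤ a) (hb0 : 0 ≤ b) :
    ∃ L, HasPV (fun y => p y / (x - y)) x L ∧ |L| ≤ a + b := by
  refine hasPV_of_odd_add (aestronglyMeasurable_div_sub hp x) (hasPV_oddStep x ρ c₁ c₂)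
    (measurable_oddStep _ _ _ _).aestronglyMeasurable
    (LB.univ_of (x := x) (r := ρ) ?_ ?_ ha0 hb0) (by positivity)
  · refine ha.mono_fun (measurableSet_near _ _) fun y hy => ?_
    have : |x - y| ≤ ρ := hy
    rw [oddStep, if_pos this, ← sub_div, abs_div]
  · refine hb.mono_fun (measurableSet_far _ _) fun y hy => ?_
    have : ¬ |x - y| ≤ ρ := not_le.mpr hy
    rw [oddStep, if_neg this, ← sub_div, abs_div]

/-- Upper bound for a principal value. -/
theorem HasPV.abs_le {p : ℝ → ℝ} {x L : ℝ} (hL : HasPV (fun y => p y / (x - y)) x L)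
    (hp : AEStronglyMeasurable p volume) {ρ c₁ c₂ a b : ℝ}
    (ha : LB (near x ρ) (fun y => |p y - c₁| / |x - y|) a)
    (hb : LB (far x ρ) (fun y => |p y - c₂| / |x - y|) b) (ha0 : 0 ≤ a) (hb0 : 0 ≤ b) :
    |L| ≤ a + b := by
  obtain ⟨L', hL', hb'⟩ := exists_hasPV_div hp ha hb ha0 hb0
  rwa [hL.unique hL']

/-- If the integrand is integrable away from `x`, the principal value is the limit of the one-sided
truncations. -/
theorem HasPV.tendsto_setIntegral_far {u : ℝ → ℝ} {x L : ℝ} (h : HasPV u x L)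
    (hint : ∀ ε, 0 < ε → IntegrableOn u (far x ε)) :
    Tendsto (fun ε => ∫ y in far x ε, u y) (𝓝[>] 0) (𝓝 L) := by
  have h1 : ∀ ε, 0 < ε → Tendsto (fun R => ∫ y in annulus x ε R, u y) atTop
      (𝓝 (∫ y in far x ε, u y)) := by
    intro ε hε
    have hU : (⋃ R : ℝ, annulus x ε R) = far x ε := by
      ext y
      simp only [Set.mem_iUnion, annulus, far, Set.mem_ofPred_eq]
      exact ⟨fun ⟨R, h⟩ => h.1, fun h => ⟨|x - y| + 1, h, by linarith⟩⟩
    rw [← hU]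
    refine tendsto_setIntegral_of_monotone (fun R => measurableSet_annulus _ _ _) ?_ ?_
    · intro R R' hR y hy
      exact ⟨hy.1, hy.2.trans_le hR⟩
    · rw [hU]; exact hint ε hε
  rw [Metric.tendsto_nhds]
  intro η hη
  have h2 := (Metric.tendsto_nhds.mp h.2) (η / 2) (by positivity)
  obtain ⟨pa, hpa, pb, hpb, hab⟩ := eventually_prod_iff.mp h2
  filter_upwards [hpa, eventually_mem_nhdsWithin] with ε hε hε0
  -- The limit is joint in ε and R, so for a fixed small ε the outer radius may be taken as large as
  -- the one-sided truncation requires.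
  have h3 := ((Metric.tendsto_nhds.mp (h1 ε hε0)) (η / 2) (by positivity)).and hpb
  obtain ⟨R, hR1, hR2⟩ := h3.exists
  have h4 := hab hε hR2
  calc dist (∫ y in far x ε, u y) L
      ≤ dist (∫ y in far x ε, u y) (∫ y in annulus x ε R, u y)
        + dist (∫ y in annulus x ε R, u y) L := dist_triangle _ _ _
    _ < η / 2 + η / 2 := add_lt_add (by rw [dist_comm]; exact hR1) h4
    _ = η := by ring

end CriticalHilbert

namespace CriticalHilbert

/-! ### Moving the centre of a principal value -/

theorem setIntegral_sub_setIntegral {u : ℝ → ℝ} {s t : Set ℝ} (hs : MeasurableSet s)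
    (ht : MeasurableSet t) (his : IntegrableOn u s) (hit : IntegrableOn u t) :
    (∫ y in s, u y) - ∫ y in t, u y = (∫ y in s \ t, u y) - ∫ y in t \ s, u y := by
  have h1 := integral_inter_add_sdiff ht his
  have h2 := integral_inter_add_sdiff hs hit
  rw [Set.inter_comm] at h2
  linarith

theorem lt_subset_near (x R : ℝ) : {y | |x - y| < R} ⊆ near x R := fun _ hy =>
  le_of_lt (Set.mem_ofPred_eq ▸ hy)

/-- Here u is locally integrable, so small balls about either centre contribute nothing. At infinity
the balls of radius R about x and x' differ by a set of bounded measure on which u = O(1/R). -/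
theorem HasPV.recentre {u : ℝ → ℝ} {x x' ρ B L : ℝ} (h : HasPV u x' L) (hρ : 0 < ρ)
    (hu : AEStronglyMeasurable u volume) (hint : IntegrableOn u (near x ρ))
    (hB : ∀ z, ρ < |x - z| → |u z| ≤ B / |x - z|) : HasPV u x L := by
  set d := |x - x'| with hd_def
  have hd0 : 0 ≤ d := abs_nonneg _
  have hB0 : 0 ≤ B := by
    have h1 := hB (x - (ρ + 1)) (by rw [sub_sub_cancel]; rw [abs_of_pos] <;> linarith)
    rw [sub_sub_cancel, abs_of_pos (by linarith : (0 : ℝ) < ρ + 1)] at h1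
    have := (abs_nonneg _).trans h1
    by_contra hneg
    exact absurd this (not_le.mpr (div_neg_of_neg_of_pos (not_le.mp hneg) (by linarith)))
  have hI : ∀ R, IntegrableOn u (near x R) := by
    intro R
    have h1 : IntegrableOn u (far x ρ ∩ near x R) := by
      refine Measure.integrableOn_of_bounded (M := B / ρ)
        ((measure_mono Set.inter_subset_right).trans_lt (volume_near_lt_top x R)).ne hu ?_
      refine (ae_restrict_iff' ((measurableSet_far _ _).inter (measurableSet_near _ _))).mpr
        (Eventually.of_forall fun y hy => ?_)
      exact (hB y hy.1).trans (div_le_div_of_nonneg_left hB0 hρ (le_of_lt hy.1))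
    refine (hint.union h1).mono_set fun y hy => ?_
    by_cases hy' : |x - y| ≤ ρ
    · exact Or.inl hy'
    · exact Or.inr ⟨not_le.mp hy', hy⟩
  have hsub : ∀ z w, |x - z| ≤ |w - z| + |x - w| := fun z w => by
    calc |x - z| = |(w - z) + (x - w)| := by congr 1; ring
      _ ≤ _ := abs_add_le _ _
  have hI' : ∀ R, IntegrableOn u (near x' R) := fun R =>
    (hI (R + d)).mono_set fun y hy => by
      have h1 := hsub y x'
      have h2 : |x' - y| ≤ R := hy
      show |x - y| ≤ R + d
      linarith
  have hball : ∀ w R, MeasurableSet {y : ℝ | |w - y| < R} := fun w R =>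
    measurableSet_lt (by fun_prop) measurable_const
  have key : ∀ w, (∀ R, IntegrableOn u (near w R)) → ∀ ε R, ε < R →
      ∫ y in annulus w ε R, u y = (∫ y in {y | |w - y| < R}, u y) - ∫ y in near w ε, u y := by
    intro w hw ε R hεR
    have : annulus w ε R = {y | |w - y| < R} \ near w ε := by
      ext y; simp only [annulus, near, Set.mem_ofPred_eq, Set.mem_sdiff, not_le]; tauto
    rw [this]
    refine setIntegral_sdiff (measurableSet_near _ _) ((hw R).mono_set (lt_subset_near w R)) ?_
    intro y hy
    exact lt_of_le_of_lt hy hεR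
  have hsmall : ∀ w, (∀ R, IntegrableOn u (near w R)) →
      Tendsto (fun ε => ∫ y in near w ε, u y) (𝓝[>] 0) (𝓝 0) := by
    intro w hw
    have h1 : Integrable ((near w 1).indicator u) :=
      (integrable_indicator_iff (measurableSet_near _ _)).mpr (hw 1)
    have h2 : Tendsto (volume ∘ fun ε => near w ε) (𝓝[>] (0 : ℝ)) (𝓝 0) := by
      have h3 : (volume ∘ fun ε => near w ε) = fun ε => ENNReal.ofReal (2 * ε) := by
        ext ε; simp only [Function.comp, near_eq_Icc, Real.volume_Icc]; congr 1; ring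
      rw [h3]
      have h4 : Tendsto (fun ε : ℝ => ENNReal.ofReal (2 * ε)) (𝓝 0) (𝓝 (ENNReal.ofReal (2 * 0))) :=
        (ENNReal.continuous_ofReal.comp (continuous_const.mul continuous_id)).tendsto 0
      simpa using h4.mono_left nhdsWithin_le_nhds
    have h3 := h1.tendsto_setIntegral_nhds_zero h2
    refine h3.congr' ?_
    have h4 : ∀ᶠ ε in 𝓝[>] (0 : ℝ), ε < 1 := mem_nhdsWithin_of_mem_nhds (Iio_mem_nhds one_pos)
    filter_upwards [h4] with ε hε
    refine setIntegral_congr_fun (measurableSet_near _ _) fun y hy => ?_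
    exact Set.indicator_of_mem (near_subset_near hε.le hy) u
  have houter : Tendsto (fun R => (∫ y in {y | |x - y| < R}, u y) - ∫ y in {y | |x' - y| < R}, u y)
      atTop (𝓝 0) := by
    -- Each one-sided difference of the two balls lies in the shell R - d ≤ |x - y| ≤ R + d, of
    -- total length 4d, where |u| ≤ B/(R - d).
    have hbd : ∀ R, ρ + d < R →
        ‖(∫ y in {y | |x - y| < R}, u y) - ∫ y in {y | |x' - y| < R}, u y‖
          ≤ 2 * (B * (4 * d)) / (R - d) := by
      intro R hR
      have hm : ∀ S : Set ℝ, MeasurableSet S → S ⊆ {y | R - d ≤ |x - y| ∧ |x - y| ≤ R + d} →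
          ‖∫ y in S, u y‖ ≤ B / (R - d) * (4 * d) := by
        intro S hS hSs
        have hsS : S ⊆ Set.Icc (x - R - d) (x - R + d) ∪ Set.Icc (x + R - d) (x + R + d) := by
          intro y hy
          obtain ⟨h1, h2⟩ := hSs hy
          rcases le_total 0 (x - y) with h3 | h3
          · rw [abs_of_nonneg h3] at h1 h2
            left; constructor <;> linarith
          · rw [abs_of_nonpos h3] at h1 h2
            right; constructor <;> linarith
        have hvol : volume S ≤ ENNReal.ofReal (4 * d) := by
          refine (measure_mono hsS).trans ((measure_union_le _ _).trans ?_)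
          rw [Real.volume_Icc, Real.volume_Icc, ← ENNReal.ofReal_add (by linarith) (by linarith)]
          apply ENNReal.ofReal_le_ofReal; linarith
        have h1 := norm_setIntegral_le_of_norm_le_const (C := B / (R - d)) (f := u)
          (hvol.trans_lt ENNReal.ofReal_lt_top) (fun y hy => ?_)
        · refine h1.trans (mul_le_mul_of_nonneg_left ?_ (div_nonneg hB0 (by linarith)))
          rw [measureReal_def]
          exact ENNReal.toReal_le_of_le_ofReal (by positivity) hvol
        · have h2 := (hSs hy).1
          exact (hB y (by linarith)).trans (div_le_div_of_nonneg_left hB0 (by linarith) h2)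
      rw [setIntegral_sub_setIntegral (hball x R) (hball x' R)
        ((hI R).mono_set (lt_subset_near x R)) ((hI' R).mono_set (lt_subset_near x' R))]
      refine (norm_sub_le _ _).trans ?_
      have e1 := hm _ ((hball x R).diff (hball x' R)) ?_
      · have e2 := hm _ ((hball x' R).diff (hball x R)) ?_
        · calc _ ≤ B / (R - d) * (4 * d) + B / (R - d) * (4 * d) := add_le_add e1 e2
            _ = _ := by ring
        · rintro y ⟨h1, h2⟩
          have h1' : |x' - y| < R := h1
          have h2' : R ≤ |x - y| := not_lt.mp h2
          exact ⟨by linarith, by linarith [hsub y x']⟩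
      · rintro y ⟨h1, h2⟩
        have h1' : |x - y| < R := h1
        have h2' : R ≤ |x' - y| := not_lt.mp h2
        have h3 : |x' - y| ≤ |x - y| + d := by
          calc |x' - y| = |(x - y) - (x - x')| := by congr 1; ring
            _ ≤ _ := abs_sub _ _
        exact ⟨by linarith, by linarith⟩
    refine squeeze_zero_norm' ((eventually_gt_atTop (ρ + d)).mono hbd) ?_
    exact Tendsto.const_div_atTop (tendsto_atTop_add_const_right _ _ tendsto_id) _
  refine ⟨fun ε R _ => (hI R).mono_set (annulus_subset_near x ε R), ?_⟩
  have h1 : Tendsto (fun p : ℝ × ℝ => (∫ y in annulus x' p.1 p.2, u y)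
      + (((∫ y in {y | |x - y| < p.2}, u y) - ∫ y in {y | |x' - y| < p.2}, u y)
        - (∫ y in near x p.1, u y) + ∫ y in near x' p.1, u y)) pvFilter (𝓝 (L + (0 - 0 + 0))) :=
    h.2.add (((houter.comp tendsto_snd).sub ((hsmall x hI).comp tendsto_fst)).add
      ((hsmall x' hI').comp tendsto_fst))
  simp only [sub_zero, add_zero] at h1
  refine h1.congr' ?_
  have h4 : ∀ᶠ ε in 𝓝[>] (0 : ℝ), ε < 1 := mem_nhdsWithin_of_mem_nhds (Iio_mem_nhds one_pos)
  filter_upwards [h4.prod_mk (eventually_gt_atTop (1 : ℝ))] with p hp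
  rw [key x hI p.1 p.2 (hp.1.trans hp.2), key x' hI' p.1 p.2 (hp.1.trans hp.2)]
  ring

/-! ### Comparing principal values at two points -/

theorem inv_sub_inv_bound {a b d : ℝ} (hab : |a - b| ≤ d) (ha : 2 * d ≤ |a|) (ha0 : 0 < |a|) :
    |1 / a - 1 / b| ≤ 2 * d / |a| ^ 2 ∧ 1 / |b| ≤ 2 / |a| ∧ 0 < |b| := by
  have h1 : |a| ≤ |b| + d := by
    calc |a| = |b + (a - b)| := by congr 1; ring
      _ ≤ |b| + |a - b| := abs_add_le _ _
      _ ≤ _ := by linarith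
  have hb : |a| / 2 ≤ |b| := by linarith
  have hb0 : 0 < |b| := by linarith
  have hb1 : 1 / |b| ≤ 2 / |a| := by
    rw [div_le_div_iff₀ hb0 ha0]; linarith
  refine ⟨?_, hb1, hb0⟩
  have ha' : a ≠ 0 := abs_pos.mp ha0
  have hb' : b ≠ 0 := abs_pos.mp hb0
  have hd0 : 0 ≤ d := (abs_nonneg _).trans hab
  have : 1 / a - 1 / b = (b - a) * (1 / a) * (1 / b) := by field_simp
  rw [this, abs_mul, abs_mul, abs_div, abs_div, abs_one, abs_sub_comm b a]
  calc |a - b| * (1 / |a|) * (1 / |b|) ≤ d * (1 / |a|) * (2 / |a|) := by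
        gcongr
    _ = 2 * d / |a| ^ 2 := by field_simp

/-- Comparison of the principal values of `p(y)/(x - y)` and `p'(y)/(x' - y)`. -/
theorem pv_diff {p p' : ℝ → ℝ} {x x' ρ B J J' e₁ e₂ a₁ a₂ a₃ a₄ a₅ : ℝ}
    (hp : AEStronglyMeasurable p volume) (hp' : AEStronglyMeasurable p' volume)
    (hρ : 0 < ρ) (hρ1 : ρ ≤ 1) (hd : 2 * |x - x'| ≤ ρ) (hB : ∀ z, |p' z| ≤ B)
    (hJ : HasPV (fun y => p y / (x - y)) x J) (hJ' : HasPV (fun y => p' y / (x' - y)) x' J')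
    (h1 : LB (near x ρ) (fun y => |p y| / |x - y|) a₁)
    (h2 : LB (near x ρ) (fun y => |p' y| / |x' - y|) a₂)
    (h3 : LB (far x ρ) (fun y => |p y| / |x - y| ^ 2) a₃)
    (hinv : LB (far x ρ) (fun y => 1 / |x - y| ^ 2) (2 / ρ))
    (h4 : LB (far x ρ ∩ near x 1) (fun y => |p y - p' y - e₁| / |x - y|) a₄)
    (h5 : LB (far x 1) (fun y => |p y - p' y - e₂| / |x - y|) a₅)
    (ha₁ : 0 ≤ a₁) (ha₂ : 0 ≤ a₂) (ha₃ : 0 ≤ a₃) (ha₄ : 0 ≤ a₄) (ha₅ : 0 ≤ a₅) :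
    |J - J'| ≤ a₁ + a₂ + 2 * |x - x'| * a₃ + 2 * (a₄ + a₅)
      + 4 * |x - x'| / ρ * (|e₁| + |e₂|) := by
  set d := |x - x'| with hd_def
  have hd0 : 0 ≤ d := abs_nonneg _
  have hB0 : 0 ≤ B := (abs_nonneg _).trans (hB 0)
  have hm' : AEStronglyMeasurable (fun y => p' y / (x' - y)) volume :=
    aestronglyMeasurable_div_sub hp' x'
  have hm : AEStronglyMeasurable (fun y => p y / (x - y)) volume :=
    aestronglyMeasurable_div_sub hp x
  have hsub : ∀ z, |(x - z) - (x' - z)| ≤ d := fun z => by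
    rw [hd_def]; exact le_of_eq (by congr 1; ring)
  -- The bound a₂ makes this integrand absolutely integrable near x, so both principal values can be
  -- taken about the same centre and subtracted.
  have hrec : HasPV (fun y => p' y / (x' - y)) x J' := by
    refine hJ'.recentre hρ hm' ?_ (B := 2 * B) fun z hz => ?_
    · refine LB.integrableOn (c := a₂) ?_ hm'.restrict
      simpa only [abs_div] using h2
    · obtain ⟨-, k2, k3⟩ := inv_sub_inv_bound (hsub z) (by linarith) (hρ.trans hz)
      rw [abs_div]
      calc |p' z| / |x' - z| = |p' z| * (1 / |x' - z|) := by ring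
        _ ≤ B * (2 / |x - z|) := by gcongr; exact hB z
        _ = _ := by ring
  have hw := hJ.sub hrec
  -- This odd comparison function vanishes for |x - y| ≤ ρ, equals e₁/(x - y) up to distance 1, and
  -- equals e₂/(x - y) beyond.
  set o : ℝ → ℝ := fun y => oddStep x 1 e₁ e₂ y - oddStep x ρ e₁ 0 y + oddStep x ρ 0 0 y
    with ho_def
  have ho : HasPV o x 0 := by
    have := ((hasPV_oddStep x 1 e₁ e₂).sub (hasPV_oddStep x ρ e₁ 0)).add (hasPV_oddStep x ρ 0 0)
    simpa using this
  have hom : Measurable o :=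
    ((measurable_oddStep _ _ _ _).sub (measurable_oddStep _ _ _ _)).add
      (measurable_oddStep _ _ _ _)
  have hnear : LB (near x ρ) (fun y => |p y / (x - y) - p' y / (x' - y) - o y|) (a₁ + a₂) := by
    have hsum : LB (near x ρ) (fun y => |p y| / |x - y| + |p' y| / |x' - y|) (a₁ + a₂) := by
      unfold LB
      calc ∫⁻ y in near x ρ, ENNReal.ofReal (|p y| / |x - y| + |p' y| / |x' - y|)
          ≤ ∫⁻ y in near x ρ, (ENNReal.ofReal (|p y| / |x - y|)
              + ENNReal.ofReal (|p' y| / |x' - y|)) :=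
            lintegral_mono fun z => ENNReal.ofReal_add_le
        _ = (∫⁻ y in near x ρ, ENNReal.ofReal (|p y| / |x - y|))
              + ∫⁻ y in near x ρ, ENNReal.ofReal (|p' y| / |x' - y|) := by
            refine lintegral_add_left' ?_ _
            have : AEMeasurable (fun y => |p y| / |x - y|) (volume.restrict (near x ρ)) :=
              (hp.aemeasurable.restrict.norm).div (by fun_prop)
            exact this.ennreal_ofReal
        _ ≤ ENNReal.ofReal a₁ + ENNReal.ofReal a₂ := add_le_add h1 h2
        _ = _ := (ENNReal.ofReal_add ha₁ ha₂).symm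
    refine hsum.mono_fun (measurableSet_near _ _) fun y hy => ?_
    have hy1 : |x - y| ≤ ρ := hy
    have hoy : o y = 0 := by
      simp only [ho_def, oddStep, if_pos hy1, if_pos (hy1.trans hρ1)]; ring
    rw [hoy, sub_zero, ← abs_div, ← abs_div]
    exact abs_sub _ _
  have hmeas2 : Measurable fun y : ℝ => 1 / |x - y| ^ 2 := by fun_prop
  have hfar1 : ∀ y ∈ far x ρ, ∀ e, |p y / (x - y) - p' y / (x' - y) - e / (x - y)|
      ≤ 2 * d * (|p y| / |x - y| ^ 2) + (2 * d * |e|) * (1 / |x - y| ^ 2)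
        + 2 * (|p y - p' y - e| / |x - y|) := by
    intro y hy e
    have hy1 : ρ < |x - y| := hy
    obtain ⟨k1, k2, k3⟩ := inv_sub_inv_bound (hsub y) (by linarith) (hρ.trans hy1)
    -- The first summand carries the difference of the two kernels, of size d/|x-y|²; the second
    -- compares the numerators after removal of the constant e.
    have hid : p y / (x - y) - p' y / (x' - y) - e / (x - y)
        = (p y - e) * (1 / (x - y) - 1 / (x' - y)) + (p y - p' y - e) * (1 / (x' - y)) := by
      ring
    rw [hid]
    calc _ ≤ |(p y - e) * (1 / (x - y) - 1 / (x' - y))| + |(p y - p' y - e) * (1 / (x' - y))| :=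
          abs_add_le _ _
      _ ≤ (|p y| + |e|) * (2 * d / |x - y| ^ 2) + |p y - p' y - e| * (2 / |x - y|) := by
          rw [abs_mul, abs_mul]
          refine add_le_add (mul_le_mul (abs_sub _ _) k1 (abs_nonneg _) (by positivity)) ?_
          refine mul_le_mul_of_nonneg_left ?_ (abs_nonneg _)
          rw [abs_div, abs_one]; exact k2
      _ = _ := by ring
  have hmid : LB (far x ρ) (fun y => |p y / (x - y) - p' y / (x' - y) - o y|)
      (2 * d * a₃ + 2 * d * (|e₁| + |e₂|) * (2 / ρ) + 2 * (a₄ + a₅)) := by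
    have hsplit : LB (far x ρ)
        (fun y => |p y - p' y - (if |x - y| ≤ 1 then e₁ else e₂)| / |x - y|) (a₄ + a₅) := by
      have hU : far x ρ = (far x ρ ∩ near x 1) ∪ far x 1 := by
        ext y
        simp only [far, near, Set.mem_ofPred_eq, Set.mem_union, Set.mem_inter_iff]
        constructor
        · intro h
          rcases le_or_gt |x - y| 1 with h' | h'
          · exact Or.inl ⟨h, h'⟩
          · exact Or.inr h'
        · rintro (h | h)
          · exact h.1
          · exact hρ1.trans_lt h
      rw [hU]
      refine LB.union ?_ ?_ ha₄ ha₅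
      · refine h4.mono_fun ((measurableSet_far _ _).inter (measurableSet_near _ _)) fun y hy => ?_
        rw [if_pos (show |x - y| ≤ 1 from hy.2)]
      · refine h5.mono_fun (measurableSet_far _ _) fun y hy => ?_
        rw [if_neg (not_le.mpr (show 1 < |x - y| from hy))]
    have k3 : LB (far x ρ) (fun y => 2 * d * (|p y| / |x - y| ^ 2)) (2 * d * a₃) :=
      h3.const_mul (by positivity)
    have k1 : LB (far x ρ) (fun y => (2 * d * (|e₁| + |e₂|)) * (1 / |x - y| ^ 2))
        (2 * d * (|e₁| + |e₂|) * (2 / ρ)) := hinv.const_mul (by positivity)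
    have k2 := hsplit.const_mul (a := 2) (by norm_num)
    have hsum : LB (far x ρ) (fun y => (2 * d * (|e₁| + |e₂|)) * (1 / |x - y| ^ 2)
        + (2 * d * (|p y| / |x - y| ^ 2)
          + 2 * (|p y - p' y - (if |x - y| ≤ 1 then e₁ else e₂)| / |x - y|)))
        (2 * d * (|e₁| + |e₂|) * (2 / ρ) + (2 * d * a₃ + 2 * (a₄ + a₅))) := by
      refine LB.add k1 ?_ (hmeas2.const_mul _) (by positivity) (by positivity)
      unfold LB
      calc _ ≤ ∫⁻ y in far x ρ, (ENNReal.ofReal (2 * d * (|p y| / |x - y| ^ 2))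
            + ENNReal.ofReal (2 * (|p y - p' y - (if |x - y| ≤ 1 then e₁ else e₂)| / |x - y|))) :=
            lintegral_mono fun z => ENNReal.ofReal_add_le
        _ = (∫⁻ y in far x ρ, ENNReal.ofReal (2 * d * (|p y| / |x - y| ^ 2)))
              + ∫⁻ y in far x ρ, ENNReal.ofReal
                (2 * (|p y - p' y - (if |x - y| ≤ 1 then e₁ else e₂)| / |x - y|)) := by
            refine lintegral_add_left' ?_ _
            have : AEMeasurable (fun y => 2 * d * (|p y| / |x - y| ^ 2))
                (volume.restrict (far x ρ)) :=
              (((hp.aemeasurable.restrict.norm).div (by fun_prop))).const_mul _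
            exact this.ennreal_ofReal
        _ ≤ ENNReal.ofReal (2 * d * a₃) + ENNReal.ofReal (2 * (a₄ + a₅)) := add_le_add k3 k2
        _ = _ := (ENNReal.ofReal_add (by positivity) (by positivity)).symm
    refine (hsum.mono_const (le_of_eq (by ring))).mono_fun (measurableSet_far _ _) fun y hy => ?_
    have hy1 : ¬ |x - y| ≤ ρ := not_le.mpr hy
    have hoy : o y = (if |x - y| ≤ 1 then e₁ else e₂) / (x - y) := by
      simp only [ho_def, oddStep, if_neg hy1]; ring
    rw [hoy]
    refine (hfar1 y hy _).trans ?_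
    have he : |if |x - y| ≤ 1 then e₁ else e₂| ≤ |e₁| + |e₂| := by
      split_ifs
      · linarith [abs_nonneg e₂]
      · linarith [abs_nonneg e₁]
    have : (2 * d * |if |x - y| ≤ 1 then e₁ else e₂|) * (1 / |x - y| ^ 2)
        ≤ (2 * d * (|e₁| + |e₂|)) * (1 / |x - y| ^ 2) := by gcongr
    linarith
  have hall := LB.univ_of hnear hmid (by positivity) (by positivity)
  obtain ⟨L, hL, hLb⟩ := hasPV_of_odd_add (hm.sub hm') ho hom.aestronglyMeasurable hall
    (by positivity)
  have hLJ : J - J' = L := hw.unique hL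
  rw [hLJ]
  refine hLb.trans (le_of_eq ?_)
  ring

end CriticalHilbert

namespace CriticalHilbert

/-! ### Radial integrals -/

/-- Folding the line at x reduces every weight in |x - z| to a half-line integral. Lower integrals
make integrability hypotheses unnecessary. -/
theorem lintegral_radial (w : ℝ → ENNReal) (x : ℝ) :
    ∫⁻ z, w |x - z| = 2 * ∫⁻ s in Set.Ioi 0, w s := by
  have h1 : ∫⁻ z, w |x - z| = ∫⁻ z, w |z| :=
    lintegral_sub_left_eq_self (fun z => w |z|) x
  have h2 : ∫⁻ z in Set.Ioi (0 : ℝ), w |z| = ∫⁻ s in Set.Ioi 0, w s :=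
    setLIntegral_congr_fun measurableSet_Ioi fun s hs => by
      rw [abs_of_pos (Set.mem_Ioi.mp hs)]
  have h3 : ∫⁻ z in Set.Iic (0 : ℝ), w |z| = ∫⁻ s in Set.Ioi 0, w s := by
    rw [setLIntegral_congr (Iio_ae_eq_Iic (a := (0 : ℝ)) (μ := volume)).symm]
    have hneg : MeasurePreserving (fun z : ℝ => -z) volume volume :=
      Measure.measurePreserving_neg volume
    have h4 := hneg.setLIntegral_comp_emb (MeasurableEquiv.neg ℝ).measurableEmbedding
      (fun z => w |z|) (Set.Iio 0)
    have h5 : (fun z : ℝ => -z) '' Set.Iio 0 = Set.Ioi 0 := by simp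
    rw [h5] at h4
    simp only [abs_neg] at h4
    rw [← h2, ← h4]
  have h4 := lintegral_add_compl (μ := volume) (fun z : ℝ => w |z|) (measurableSet_Ioi (a := (0 : ℝ)))
  rw [Set.compl_Ioi, h2, h3] at h4
  rw [h1, ← h4, two_mul]

theorem lb_radial {T : Set ℝ} (hT : MeasurableSet T) {w : ℝ → ℝ} {c : ℝ} (x : ℝ)
    (h : LB (Set.Ioi 0 ∩ T) w c) :
    LB {z | |x - z| ∈ T} (fun z => w |x - z|) (2 * c) := by
  unfold LB at *
  have hm : MeasurableSet {z : ℝ | |x - z| ∈ T} :=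
    (by fun_prop : Measurable fun z : ℝ => |x - z|) hT
  rw [← lintegral_indicator hm]
  have h1 := lintegral_radial (T.indicator fun s => ENNReal.ofReal (w s)) x
  rw [setLIntegral_indicator hT, Set.inter_comm] at h1
  have h2 : ∀ z, ({z : ℝ | |x - z| ∈ T}.indicator fun z => ENNReal.ofReal (w |x - z|)) z
      = (T.indicator fun s => ENNReal.ofReal (w s)) |x - z| := fun z => by
    by_cases hz : |x - z| ∈ T
    · rw [Set.indicator_of_mem hz, Set.indicator_of_mem (show z ∈ {z : ℝ | |x - z| ∈ T} from hz)]
    · rw [Set.indicator_of_notMem hz,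
        Set.indicator_of_notMem (show z ∉ {z : ℝ | |x - z| ∈ T} from hz)]
  simp only [h2]
  rw [h1, ENNReal.ofReal_mul zero_le_two, ENNReal.ofReal_ofNat]
  exact mul_le_mul_right h _

theorem lb_near_radial {w : ℝ → ℝ} {c r : ℝ} (x : ℝ) (h : LB (Set.Ioc 0 r) w c) :
    LB (near x r) (fun z => w |x - z|) (2 * c) :=
  lb_radial (T := Set.Iic r) measurableSet_Iic x (by rwa [Set.Ioi_inter_Iic])

theorem lb_far_radial {w : ℝ → ℝ} {c r : ℝ} (x : ℝ) (h : LB (Set.Ioi r) w c) :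
    LB (far x r) (fun z => w |x - z|) (2 * c) :=
  lb_radial (T := Set.Ioi r) measurableSet_Ioi x (h.mono_set Set.inter_subset_right)

theorem lb_far_rpow (x : ℝ) {ρ a : ℝ} (hρ : 0 < ρ) (ha : 0 < a) :
    LB (far x ρ) (fun z => |x - z| ^ (-1 - a)) (2 * (ρ ^ (-a) / a)) := by
  refine lb_far_radial (w := fun s => s ^ (-1 - a)) x ?_
  have h1 := integral_Ioi_rpow_of_lt (a := -1 - a) (by linarith) hρ
  have h2 := integrableOn_Ioi_rpow_of_lt (a := -1 - a) (by linarith) hρ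
  unfold LB
  rw [← ofReal_integral_eq_lintegral_ofReal h2, h1]
  · apply ENNReal.ofReal_le_ofReal
    rw [show -1 - a + 1 = -a by ring, neg_div_neg_eq]
  · refine (ae_restrict_iff' measurableSet_Ioi).mpr (Eventually.of_forall fun s hs => ?_)
    exact Real.rpow_nonneg (hρ.le.trans (le_of_lt hs)) _

theorem lb_near_rpow (x : ℝ) {ρ a : ℝ} (hρ : 0 ≤ ρ) (ha : 0 < a) :
    LB (near x ρ) (fun z => |x - z| ^ (a - 1)) (2 * (ρ ^ a / a)) := by
  refine lb_near_radial (w := fun s => s ^ (a - 1)) x ?_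
  have h1 : ∫ s in (0 : ℝ)..ρ, s ^ (a - 1) = ρ ^ a / a := by
    rw [integral_rpow (Or.inl (by linarith)), sub_add_cancel, Real.zero_rpow ha.ne', sub_zero]
  have h2 : IntervalIntegrable (fun s : ℝ => s ^ (a - 1)) volume 0 ρ :=
    intervalIntegral.intervalIntegrable_rpow' (by linarith)
  rw [intervalIntegrable_iff_integrableOn_Ioc_of_le hρ] at h2
  rw [intervalIntegral.integral_of_le hρ] at h1
  unfold LB
  rw [← ofReal_integral_eq_lintegral_ofReal h2, h1]
  refine (ae_restrict_iff' measurableSet_Ioc).mpr (Eventually.of_forall fun s hs => ?_)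
  exact Real.rpow_nonneg hs.1.le _

theorem lb_far_inv_sq (x : ℝ) {ρ : ℝ} (hρ : 0 < ρ) :
    LB (far x ρ) (fun z => 1 / |x - z| ^ 2) (2 / ρ) := by
  have h := lb_far_rpow x hρ one_pos
  refine (h.mono_const (le_of_eq ?_)).mono_fun (measurableSet_far _ _) fun z hz => le_of_eq ?_
  · rw [Real.rpow_neg_one]; ring
  · have : (0 : ℝ) ≤ |x - z| := abs_nonneg _
    rw [show (-1 - 1 : ℝ) = -(2 : ℕ) by norm_num, Real.rpow_neg this, Real.rpow_natCast, one_div]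

theorem lb_far_sqrt (x : ℝ) {ρ d : ℝ} (hρ : 0 < ρ) (hd : 0 ≤ d) :
    LB (far x ρ) (fun z => √(d / |x - z|) / |x - z|) (4 * √(d / ρ)) := by
  have h := (lb_far_rpow x hρ (a := 1 / 2) (by norm_num)).const_mul (a := √d) (Real.sqrt_nonneg _)
  refine (h.mono_const (le_of_eq ?_)).mono_fun (measurableSet_far _ _) fun z hz => le_of_eq ?_
  · rw [Real.sqrt_div hd, Real.sqrt_eq_rpow ρ, Real.rpow_neg hρ.le]; ring
  · have hz0 : 0 < |x - z| := hρ.trans hz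
    rw [Real.sqrt_div hd, Real.sqrt_eq_rpow |x - z|, Real.rpow_sub hz0, Real.rpow_neg_one]
    ring

theorem lb_near_sqrt (x : ℝ) {ρ c : ℝ} (hρ : 0 ≤ ρ) :
    LB (near x ρ) (fun z => √(|x - z| / c) / |x - z|) (4 * √(ρ / c)) := by
  have h := (lb_near_rpow x hρ (a := 1 / 2) (by norm_num)).const_mul (a := (√c)⁻¹)
    (inv_nonneg.mpr (Real.sqrt_nonneg _))
  refine (h.mono_const (le_of_eq ?_)).mono_fun_ae (measurableSet_near _ _) x
    fun z hz hzx => le_of_eq ?_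
  · rw [Real.sqrt_div hρ, Real.sqrt_eq_rpow ρ]; ring
  · have hz0 : 0 < |x - z| := abs_pos.mpr (sub_ne_zero.mpr hzx.symm)
    rw [Real.sqrt_div hz0.le, Real.sqrt_eq_rpow |x - z|, Real.rpow_sub hz0, Real.rpow_one]
    ring

theorem lb_inv_one_add_sq (w : ℝ) :
    LB Set.univ (fun z => 1 / (1 + |w - z|) ^ 2) 4 := by
  have h1 : LB (near w 1) (fun z => 1 / (1 + |w - z|) ^ 2) 2 := by
    have h0 : LB (near w 1) (fun _ => (1 : ℝ)) 2 := by
      unfold LB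
      rw [near_eq_Icc, setLIntegral_const, Real.volume_Icc, ENNReal.ofReal_one, one_mul]
      apply ENNReal.ofReal_le_ofReal; linarith
    refine h0.mono_fun (measurableSet_near _ _) fun z _ => ?_
    rw [div_le_one (by positivity)]
    nlinarith [abs_nonneg (w - z)]
  have h2 : LB (far w 1) (fun z => 1 / (1 + |w - z|) ^ 2) 2 := by
    refine ((lb_far_inv_sq w one_pos).mono_const (by norm_num)).mono_fun
      (measurableSet_far _ _) fun z hz => ?_
    have : 1 < |w - z| := hz
    exact div_le_div_of_nonneg_left zero_le_one (by positivity)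
      (pow_le_pow_left₀ (by positivity) (by linarith) 2)
  exact (LB.univ_of h1 h2 (by norm_num) (by norm_num)).mono_const (by norm_num)

/-- By 2ab ≤ a² + b² both factors become square integrable. The bound must be uniform in w, since a
kernel F(·, w) decays away from w while the singularity is at x. -/
theorem lb_decay (x w : ℝ) :
    LB (far x 1) (fun z => 1 / (1 + |w - z|) / |x - z|) 3 := by
  have h1 := ((lb_inv_one_add_sq w).mono_set (Set.subset_univ (far x 1))).const_mul
    (a := 1 / 2) (by norm_num)
  have h2 := (lb_far_inv_sq x one_pos).const_mul (a := 1 / 2) (by norm_num)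
  have h3 := h1.add h2 (by fun_prop) (by norm_num) (by norm_num)
  refine (h3.mono_const (by norm_num)).mono_fun (measurableSet_far _ _) fun z hz => ?_
  have e1 : 1 / (1 + |w - z|) / |x - z| = (1 / (1 + |w - z|)) * (1 / |x - z|) := by ring
  have e2 : 1 / (1 + |w - z|) ^ 2 = (1 / (1 + |w - z|)) ^ 2 := by rw [one_div_pow]
  have e3 : 1 / |x - z| ^ 2 = (1 / |x - z|) ^ 2 := by rw [one_div_pow]
  simp only [e1, e2, e3]
  nlinarith [sq_nonneg (1 / (1 + |w - z|) - 1 / |x - z|)]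

theorem lb_of_abs_le {S : Set ℝ} (hS : MeasurableSet S) {p q : ℝ → ℝ} {c a : ℝ} (h : LB S q c)
    (ha : 0 ≤ a) (hpq : ∀ z ∈ S, p z ≤ a * q z) : LB S p (a * c) :=
  (h.const_mul ha).mono_fun hS hpq

/-! ### Quantitative properties of the modulus -/

/-- The properties of a bounded modulus `ω` and of `Ω(r) = ∫₀ʳ ω(s)/s ds` used below. -/
structure ModData (ω Ω : ℝ → ℝ) (K : ℝ) : Prop where
  one_le : 1 ≤ K
  mono : Monotone ω
  nonneg : ∀ s, 0 ≤ ω s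
  pos : ∀ s, 0 < s → 0 < ω s
  le : ∀ s, ω s ≤ K
  tendsto : Tendsto ω (𝓝[>] 0) (𝓝 0)
  zero : ω 0 = 0
  double : ∀ s, 0 ≤ s → ω (2 * s) ≤ K * ω s
  mono' : Monotone Ω
  nonneg' : ∀ s, 0 ≤ Ω s
  le' : ∀ s, Ω s ≤ K
  dini : ∀ r, r ≤ 1 → LB (Set.Ioc 0 r) (fun s => ω s / s) (Ω r)
  dini' : LB (Set.Ioc 0 1) (fun s => Ω s / s) K
  comp : ∀ d s, 0 < d → d ≤ 1 → d ≤ s → s ≤ √d → ω s ≤ K * Ω d ∧ Ω s ≤ K * Ω d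
  sq : ∀ d, 0 < d → d ≤ 1 → Ω d ^ 2 ≤ K * ω d
  pow : ∀ d, 0 < d → d ≤ 1 → √√d ≤ K * ω d

namespace ModData

variable {ω Ω : ℝ → ℝ} {K : ℝ}

theorem lb_near (h : ModData ω Ω K) (x : ℝ) {r : ℝ} (hr : r ≤ 1) :
    LB (near x r) (fun z => ω |x - z| / |x - z|) (2 * Ω r) :=
  lb_near_radial (w := fun s => ω s / s) x (h.dini r hr)

theorem lb_near' (h : ModData ω Ω K) (x : ℝ) :
    LB (near x 1) (fun z => Ω |x - z| / |x - z|) (2 * K) :=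
  lb_near_radial (w := fun s => Ω s / s) x h.dini'

theorem K_pos (h : ModData ω Ω K) : 0 < K := one_pos.trans_le h.one_le

end ModData

/-- Bounded functions with modulus of continuity `C ω`. -/
structure HasMod (ω : ℝ → ℝ) (C : ℝ) (g : ℝ → ℝ) : Prop where
  bdd : ∀ x, |g x| ≤ C
  diff : ∀ x y, |g x - g y| ≤ C * ω |x - y|

namespace HasMod

variable {ω Ω : ℝ → ℝ} {K C C' : ℝ} {g g' : ℝ → ℝ}

theorem nonneg (hg : HasMod ω C g) : 0 ≤ C := (abs_nonneg _).trans (hg.bdd 0)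

theorem mono (hg : HasMod ω C g) (h : ModData ω Ω K) (hC : C ≤ C') : HasMod ω C' g :=
  ⟨fun x => (hg.bdd x).trans hC, fun x y => (hg.diff x y).trans
    (mul_le_mul_of_nonneg_right hC (h.nonneg _))⟩

theorem add (hg : HasMod ω C g) (hg' : HasMod ω C' g') :
    HasMod ω (C + C') (fun x => g x + g' x) := by
  refine ⟨fun x => (abs_add_le _ _).trans (add_le_add (hg.bdd x) (hg'.bdd x)), fun x y => ?_⟩
  calc |g x + g' x - (g y + g' y)| = |(g x - g y) + (g' x - g' y)| := by congr 1; ring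
    _ ≤ |g x - g y| + |g' x - g' y| := abs_add_le _ _
    _ ≤ C * ω |x - y| + C' * ω |x - y| := add_le_add (hg.diff x y) (hg'.diff x y)
    _ = _ := by ring

theorem const_mul (hg : HasMod ω C g) (c : ℝ) : HasMod ω (|c| * C) (fun x => c * g x) := by
  refine ⟨fun x => ?_, fun x y => ?_⟩
  · rw [abs_mul]; exact mul_le_mul_of_nonneg_left (hg.bdd x) (abs_nonneg c)
  · rw [← mul_sub, abs_mul, mul_assoc]
    exact mul_le_mul_of_nonneg_left (hg.diff x y) (abs_nonneg c)

theorem mul (hg : HasMod ω C g) (hg' : HasMod ω C' g') :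
    HasMod ω (2 * C * C') (fun x => g x * g' x) := by
  have h0 := hg.nonneg
  have h0' := hg'.nonneg
  refine ⟨fun x => ?_, fun x y => ?_⟩
  · rw [abs_mul]
    have := mul_le_mul (hg.bdd x) (hg'.bdd x) (abs_nonneg _) h0
    nlinarith [mul_nonneg h0 h0']
  · calc |g x * g' x - g y * g' y| = |g x * (g' x - g' y) + (g x - g y) * g' y| := by
          congr 1; ring
      _ ≤ |g x| * |g' x - g' y| + |g x - g y| * |g' y| := by
          rw [← abs_mul, ← abs_mul]; exact abs_add_le _ _
      _ ≤ C * (C' * ω |x - y|) + C * ω |x - y| * C' := by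
          refine add_le_add (mul_le_mul (hg.bdd x) (hg'.diff x y) (abs_nonneg _) h0)
            (mul_le_mul (hg.diff x y) (hg'.bdd y) (abs_nonneg _)
              ((abs_nonneg _).trans (hg.diff x y)))
      _ = _ := by ring

theorem continuous (hg : HasMod ω C g) (h : ModData ω Ω K) : Continuous g := by
  rw [continuous_iff_continuousAt]
  intro x
  have h1 : Tendsto ω (𝓝[≥] 0) (𝓝 0) := by
    rw [← Set.Ioi_insert, nhdsWithin_insert]
    refine Tendsto.sup ?_ h.tendsto
    rw [tendsto_pure_left]
    intro s hs
    rw [h.zero]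
    exact mem_of_mem_nhds hs
  have h2 : Tendsto (fun y => |y - x|) (𝓝 x) (𝓝[≥] 0) := by
    refine tendsto_nhdsWithin_iff.mpr ⟨?_, Eventually.of_forall fun y =>
      Set.mem_Ici.mpr (abs_nonneg _)⟩
    have : Continuous fun y : ℝ => |y - x| := by fun_prop
    simpa using this.tendsto x
  have h3 := (h1.comp h2).const_mul C
  rw [mul_zero] at h3
  rw [ContinuousAt, tendsto_iff_dist_tendsto_zero]
  exact squeeze_zero (fun _ => dist_nonneg) (fun y => hg.diff y x) h3

end HasMod

end CriticalHilbert

namespace CriticalHilbert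

/-! ### Consequences of the structural assumptions on the modulus -/

/-- The modulus `φ` frozen outside `[0, 1]`. -/
noncomputable def clampMod (φ : ℝ → ℝ) (s : ℝ) : ℝ := φ (max 0 (min s 1))

/-- `∫₀ʳ φ(s)/s ds`, frozen outside `[0, 1]`. -/
noncomputable def clampInt (φ : ℝ → ℝ) (r : ℝ) : ℝ := ∫ s in Set.Ioc 0 (min r 1), clampMod φ s / s

section

variable {φ : ℝ → ℝ}

theorem clampMod_eq {s : ℝ} (h0 : 0 ≤ s) (h1 : s ≤ 1) : clampMod φ s = φ s := by
  rw [clampMod, min_eq_left h1, max_eq_right h0]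

theorem clampMod_mono (hφ : IsModulus φ) : Monotone (clampMod φ) := fun _ _ hst =>
  hφ.mono (Set.mem_Ici.mpr (le_max_left _ _)) (Set.mem_Ici.mpr (le_max_left _ _))
    (max_le_max le_rfl (min_le_min hst le_rfl))

theorem clampMod_pos (hφ : IsModulus φ) {s : ℝ} (hs : 0 < s) : 0 < clampMod φ s :=
  hφ.pos _ (lt_max_of_lt_right (lt_min hs one_pos))

theorem clampMod_zero (hφ : IsModulus φ) : clampMod φ 0 = 0 := by
  rw [clampMod_eq le_rfl zero_le_one, hφ.zero]

theorem clampMod_nonneg (hφ : IsModulus φ) (s : ℝ) : 0 ≤ clampMod φ s := by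
  rcases le_or_gt s 0 with h | h
  · rw [clampMod, max_eq_left ((min_le_left _ _).trans h), hφ.zero]
  · exact (clampMod_pos hφ h).le

theorem clampMod_le (hφ : IsModulus φ) (s : ℝ) : clampMod φ s ≤ clampMod φ 1 := by
  rcases le_or_gt s 1 with h | h
  · exact clampMod_mono hφ h
  · rw [clampMod, clampMod, min_eq_right h.le, min_self]

theorem setLIntegral_const_div {a b c : ℝ} (ha : 0 < a) (hab : a ≤ b) (hc : 0 ≤ c) :
    ∫⁻ t in Set.Ioc a b, ENNReal.ofReal (c / t) = ENNReal.ofReal (c * Real.log (b / a)) := by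
  have h1 : ∫ t in a..b, c / t = c * Real.log (b / a) := by
    simp only [div_eq_mul_inv c]
    rw [intervalIntegral.integral_const_mul, integral_inv_of_pos ha (ha.trans_le hab)]
  have h2 : IntervalIntegrable (fun t => c / t) volume a b := by
    refine ContinuousOn.intervalIntegrable ?_
    refine continuousOn_const.div continuousOn_id fun t ht => ?_
    rw [Set.uIcc_of_le hab] at ht
    exact (ha.trans_le ht.1).ne'
  rw [intervalIntegral.integral_of_le hab] at h1
  rw [intervalIntegrable_iff_integrableOn_Ioc_of_le hab] at h2
  rw [← ofReal_integral_eq_lintegral_ofReal h2, h1]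
  refine (ae_restrict_iff' measurableSet_Ioc).mpr (Eventually.of_forall fun s hs => ?_)
  exact div_nonneg hc (ha.le.trans hs.1.le)

/-- Since ∫ c/t dt over (a, b] is c log(b/a), a Dini bound turns into a pointwise bound with a
logarithm. -/
theorem LB.log_le {a b c I : ℝ} {S : Set ℝ} {p : ℝ → ℝ} (h : LB S p I) (hI : 0 ≤ I) (ha : 0 < a)
    (hab : a ≤ b) (hc : 0 ≤ c) (hS : Set.Ioc a b ⊆ S) (hp : ∀ t ∈ Set.Ioc a b, c / t ≤ p t) :
    c * Real.log (b / a) ≤ I := by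
  have h1 := (h.mono_set hS).mono_fun measurableSet_Ioc hp
  unfold LB at h1
  rwa [setLIntegral_const_div ha hab hc, ENNReal.ofReal_le_ofReal_iff hI] at h1

/-- Assumption (A1) gives finiteness on some (0, r]; on (r, 1] the frozen modulus is bounded and
ds/s has finite mass. -/
theorem IsAdmissibleModulus.exists_dini (hφ : IsAdmissibleModulus φ) :
    ∃ θ I : ℝ, 0 < θ ∧ θ < 1 / 2 ∧ 1 ≤ I ∧
      LB (Set.Ioc 0 1) (fun s => clampMod φ s ^ θ / s) I := by
  obtain ⟨θ, h0, h1, ht⟩ := hφ.dini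
  have hm := hφ.toIsModulus
  have h2 : ∀ᶠ r in 𝓝[>] (0 : ℝ), ∫⁻ s in Set.Ioc 0 r, ENNReal.ofReal (φ s ^ θ / s) < 1 :=
    ht.eventually (Iio_mem_nhds one_pos)
  have h4 : ∀ᶠ ε in 𝓝[>] (0 : ℝ), ε < 1 := mem_nhdsWithin_of_mem_nhds (Iio_mem_nhds one_pos)
  obtain ⟨r, ⟨hr1, hr2⟩, hr0⟩ := ((h2.and h4).and eventually_mem_nhdsWithin).exists
  have hr0 : 0 < r := hr0
  have e1 : LB (Set.Ioc 0 r) (fun s => clampMod φ s ^ θ / s) 1 := by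
    unfold LB
    rw [ENNReal.ofReal_one]
    refine le_trans (le_of_eq ?_) hr1.le
    refine setLIntegral_congr_fun measurableSet_Ioc fun s hs => ?_
    simp only
    rw [clampMod_eq hs.1.le (hs.2.trans hr2.le)]
  have hlog : 0 ≤ Real.log (1 / r) := Real.log_nonneg (by rw [le_div_iff₀ hr0]; linarith)
  have hc : 0 ≤ clampMod φ 1 ^ θ := Real.rpow_nonneg (clampMod_nonneg hm 1) _
  have e2 : LB (Set.Ioc r 1) (fun s => clampMod φ s ^ θ / s)
      (clampMod φ 1 ^ θ * Real.log (1 / r)) := by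
    have h3 : LB (Set.Ioc r 1) (fun s => clampMod φ 1 ^ θ / s)
        (clampMod φ 1 ^ θ * Real.log (1 / r)) := by
      unfold LB
      rw [setLIntegral_const_div hr0 hr2.le hc]
    refine h3.mono_fun measurableSet_Ioc fun s hs => ?_
    exact div_le_div_of_nonneg_right
      (Real.rpow_le_rpow (clampMod_nonneg hm s) (clampMod_le hm s) h0.le) (hr0.le.trans hs.1.le)
  refine ⟨θ, 1 + clampMod φ 1 ^ θ * Real.log (1 / r), h0, h1, ?_, ?_⟩
  · linarith [mul_nonneg hc hlog]
  · have := e1.union e2 zero_le_one (mul_nonneg hc hlog)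
    rwa [Set.Ioc_union_Ioc_eq_Ioc hr0.le hr2.le] at this

/-- Write ω = ω^(1-θ) ω^θ: by monotonicity the first factor comes out at the endpoint r and the
second is the Dini integrand. Hence Ω = O(ω^(1-θ)). -/
theorem lb_clampMod (hφ : IsModulus φ) {θ I r : ℝ} (hθ : 0 < θ) (hθ1 : θ < 1 / 2)
    (hI : LB (Set.Ioc 0 1) (fun s => clampMod φ s ^ θ / s) I) (hr : r ≤ 1) :
    LB (Set.Ioc 0 r) (fun s => clampMod φ s / s) (clampMod φ r ^ (1 - θ) * I) := by
  refine lb_of_abs_le measurableSet_Ioc (hI.mono_set (Set.Ioc_subset_Ioc_right hr))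
    (Real.rpow_nonneg (clampMod_nonneg hφ r) _) fun s hs => ?_
  have h1 : clampMod φ s = clampMod φ s ^ (1 - θ) * clampMod φ s ^ θ := by
    rw [← Real.rpow_add (clampMod_pos hφ hs.1)]; simp
  rw [← mul_div_assoc]
  refine div_le_div_of_nonneg_right ?_ hs.1.le
  conv_lhs => rw [h1]
  refine mul_le_mul_of_nonneg_right ?_ (Real.rpow_nonneg (clampMod_nonneg hφ s) _)
  exact Real.rpow_le_rpow (clampMod_nonneg hφ s) (clampMod_mono hφ hs.2) (by linarith)

theorem measurable_clampMod_div (hφ : IsModulus φ) : Measurable fun s => clampMod φ s / s :=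
  (clampMod_mono hφ).measurable.div measurable_id

theorem integrableOn_clampMod_div (hφ : IsAdmissibleModulus φ) {r : ℝ} (hr : r ≤ 1) :
    IntegrableOn (fun s => clampMod φ s / s) (Set.Ioc 0 r) := by
  obtain ⟨θ, I, h0, h1, -, hI⟩ := hφ.exists_dini
  have h2 := lb_clampMod hφ.toIsModulus h0 h1 hI hr
  refine LB.integrableOn (c := clampMod φ r ^ (1 - θ) * I) ?_
    (measurable_clampMod_div hφ.toIsModulus).aestronglyMeasurable
  refine h2.mono_fun measurableSet_Ioc fun s hs => ?_
  rw [abs_of_nonneg (div_nonneg (clampMod_nonneg hφ.toIsModulus s) hs.1.le)]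

theorem clampMod_div_nonneg (hφ : IsModulus φ) (r : ℝ) :
    0 ≤ᵐ[volume.restrict (Set.Ioc 0 r)] fun s => clampMod φ s / s :=
  (ae_restrict_iff' measurableSet_Ioc).mpr (Eventually.of_forall fun s hs =>
    div_nonneg (clampMod_nonneg hφ s) hs.1.le)

theorem lb_clampInt (hφ : IsAdmissibleModulus φ) {r : ℝ} (hr : r ≤ 1) :
    LB (Set.Ioc 0 r) (fun s => clampMod φ s / s) (clampInt φ r) := by
  unfold LB clampInt
  rw [min_eq_left hr, ofReal_integral_eq_lintegral_ofReal (integrableOn_clampMod_div hφ hr)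
    (clampMod_div_nonneg hφ.toIsModulus r)]

theorem clampInt_nonneg (hφ : IsModulus φ) (r : ℝ) : 0 ≤ clampInt φ r :=
  integral_nonneg_of_ae (clampMod_div_nonneg hφ _)

theorem clampInt_mono (hφ : IsAdmissibleModulus φ) : Monotone (clampInt φ) := fun _ _ hst =>
  setIntegral_mono_set (integrableOn_clampMod_div hφ (min_le_right _ _))
    (clampMod_div_nonneg hφ.toIsModulus _)
    (Set.Ioc_subset_Ioc_right (min_le_min hst le_rfl)).eventuallyLE

theorem clampInt_le_one (hφ : IsAdmissibleModulus φ) (r : ℝ) : clampInt φ r ≤ clampInt φ 1 := by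
  rcases le_or_gt r 1 with h | h
  · exact clampInt_mono hφ h
  · rw [clampInt, clampInt, min_eq_right h.le, min_self]

theorem clampInt_le (hφ : IsAdmissibleModulus φ) {θ I r : ℝ} (hθ : 0 < θ) (hθ1 : θ < 1 / 2)
    (hI0 : 1 ≤ I) (hI : LB (Set.Ioc 0 1) (fun s => clampMod φ s ^ θ / s) I) (hr : r ≤ 1) :
    clampInt φ r ≤ clampMod φ r ^ (1 - θ) * I := by
  have h1 := lb_clampMod hφ.toIsModulus hθ hθ1 hI hr
  unfold LB at h1
  rw [← ofReal_integral_eq_lintegral_ofReal (integrableOn_clampMod_div hφ hr)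
    (clampMod_div_nonneg hφ.toIsModulus r), ENNReal.ofReal_le_ofReal_iff
    (mul_nonneg (Real.rpow_nonneg (clampMod_nonneg hφ.toIsModulus r) _) (by linarith))] at h1
  rwa [clampInt, min_eq_left hr]

theorem clampInt_pos (hφ : IsAdmissibleModulus φ) {r : ℝ} (hr : 0 < r) (hr1 : r ≤ 1) :
    0 < clampInt φ r := by
  have hm := hφ.toIsModulus
  have h1 := (lb_clampInt hφ hr1).log_le (clampInt_nonneg hm r) (half_pos hr)
    (half_le_self hr.le) (clampMod_nonneg hm (r / 2)) (Set.Ioc_subset_Ioc_left (half_pos hr).le)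
    fun t ht => div_le_div_of_nonneg_right (clampMod_mono hm ht.1.le) ((half_pos hr).le.trans ht.1.le)
  refine lt_of_lt_of_le (mul_pos (clampMod_pos hm (half_pos hr)) (Real.log_pos ?_)) h1
  rw [div_div_cancel₀ hr.ne']
  norm_num

theorem inducedModulus_eq {r : ℝ} (hr : 0 ≤ r) (hr1 : r ≤ 1) :
    inducedModulus φ r = clampInt φ r := by
  rw [inducedModulus, intervalIntegral.integral_of_le hr, clampInt, min_eq_left hr1]
  refine setIntegral_congr_fun measurableSet_Ioc fun s hs => ?_
  rw [clampMod_eq hs.1.le (hs.2.trans hr1)]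

/-- The Dini integral over (s, 1] bounds ω(s)^θ |log s|; the remaining power ω(s)^(1-θ) tends to 0.
-/
theorem clampMod_mul_log_tendsto (hφ : IsAdmissibleModulus φ) :
    Tendsto (fun s => clampMod φ s * (-Real.log s)) (𝓝[>] 0) (𝓝 0) := by
  obtain ⟨θ, I, h0, h1, hI0, hI⟩ := hφ.exists_dini
  have hm := hφ.toIsModulus
  have hlim : Tendsto (fun s => clampMod φ s ^ (1 - θ) * I) (𝓝[>] 0) (𝓝 0) := by
    have h2 : Tendsto (clampMod φ) (𝓝[>] 0) (𝓝 0) := by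
      refine hm.tendsto_zero.congr' ?_
      have h4 : ∀ᶠ ε in 𝓝[>] (0 : ℝ), ε < 1 := mem_nhdsWithin_of_mem_nhds (Iio_mem_nhds one_pos)
      filter_upwards [h4, eventually_mem_nhdsWithin] with s hs hs0
      rw [clampMod_eq (le_of_lt hs0) hs.le]
    have h3 := (h2.rpow_const (p := 1 - θ) (Or.inr (by linarith))).mul_const I
    rwa [Real.zero_rpow (by linarith), zero_mul] at h3
  refine tendsto_of_tendsto_of_tendsto_of_le_of_le' tendsto_const_nhds hlim ?_ ?_
  all_goals
    have h4 : ∀ᶠ ε in 𝓝[>] (0 : ℝ), ε < 1 := mem_nhdsWithin_of_mem_nhds (Iio_mem_nhds one_pos)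
    filter_upwards [h4, eventually_mem_nhdsWithin] with s hs hs0
    have hs0 : 0 < s := hs0
  · exact mul_nonneg (clampMod_nonneg hm s) (neg_nonneg.mpr (Real.log_nonpos hs0.le hs.le))
  · have h2 := hI.log_le (by linarith) hs0 hs.le (Real.rpow_nonneg (clampMod_nonneg hm s) θ)
      (Set.Ioc_subset_Ioc_left hs0.le) fun t ht =>
        div_le_div_of_nonneg_right (Real.rpow_le_rpow (clampMod_nonneg hm s)
          (clampMod_mono hm ht.1.le) h0.le) (hs0.le.trans ht.1.le)
    rw [one_div, Real.log_inv] at h2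
    have h3 : clampMod φ s = clampMod φ s ^ (1 - θ) * clampMod φ s ^ θ := by
      rw [← Real.rpow_add (clampMod_pos hm hs0)]; simp
    calc clampMod φ s * (-Real.log s)
        = clampMod φ s ^ (1 - θ) * (clampMod φ s ^ θ * (-Real.log s)) := by
          rw [← mul_assoc, ← h3]
      _ ≤ _ := mul_le_mul_of_nonneg_left h2 (Real.rpow_nonneg (clampMod_nonneg hm s) _)

/-- Assumption (A3) compares the values of ω(t)|log t| at r and at s. Letting s → 0 removes the
second value and leaves a pointwise bound at r. -/
theorem exists_clampMod_mul_log_le (hφ : IsAdmissibleModulus φ) :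
    ∃ r₀ C : ℝ, 0 < r₀ ∧ r₀ < 1 ∧ 0 < C ∧ ∀ r, 0 < r → r ≤ r₀ →
      clampMod φ r * (-Real.log r) ≤ C * clampInt φ r := by
  obtain ⟨r₀, C, hr₀, hC⟩ := hφ.log_mul
  have hm := hφ.toIsModulus
  refine ⟨min r₀ (1 / 2), |C| + 1, lt_min hr₀ (by norm_num),
    (min_le_right _ _).trans_lt (by norm_num), by positivity, fun r hr hr' => ?_⟩
  have hr1 : r ≤ 1 / 2 := hr'.trans (min_le_right _ _)
  have hlim : Tendsto (fun s => (|C| + 1) * clampInt φ r + clampMod φ s * (-Real.log s)) (𝓝[>] 0)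
      (𝓝 ((|C| + 1) * clampInt φ r + 0)) := (clampMod_mul_log_tendsto hφ).const_add _
  rw [add_zero] at hlim
  refine ge_of_tendsto hlim ?_
  have h4 : ∀ᶠ ε in 𝓝[>] (0 : ℝ), ε < r := mem_nhdsWithin_of_mem_nhds (Iio_mem_nhds hr)
  filter_upwards [h4, eventually_mem_nhdsWithin] with s hs hs0
  have hs0 : 0 < s := hs0
  have h1 := hC r ⟨hr, hr'.trans (min_le_left _ _)⟩ s
    ⟨hs0, hs.le.trans (hr'.trans (min_le_left _ _))⟩
  rw [abs_of_pos (sub_pos.mpr hs), inducedModulus_eq (sub_pos.mpr hs).le (by linarith),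
    ← clampMod_eq (φ := φ) hr.le (by linarith), ← clampMod_eq (φ := φ) hs0.le (by linarith)] at h1
  have h2 := (le_abs_self _).trans h1
  have h3 : clampInt φ (r - s) ≤ clampInt φ r := clampInt_mono hφ (by linarith)
  have h5 : C * clampInt φ (r - s) ≤ (|C| + 1) * clampInt φ r := by
    calc C * clampInt φ (r - s) ≤ (|C| + 1) * clampInt φ (r - s) :=
          mul_le_mul_of_nonneg_right (by linarith [le_abs_self C]) (clampInt_nonneg hm _)
      _ ≤ _ := mul_le_mul_of_nonneg_left h3 (by positivity)
  linarith

/-- An absorption argument. For t between d and s = d^β one has ω(t) ≤ CΩ(s)/|log s|, so Ω(s) - Ω(d)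
≤ C(1/β - 1)Ω(s), which is at most Ω(s)/2 when β is close to 1. -/
theorem clampInt_rpow_le (hφ : IsAdmissibleModulus φ) {r₀ C β : ℝ} (hr1 : r₀ < 1) (hC0 : 0 < C)
    (hC : ∀ r, 0 < r → r ≤ r₀ → clampMod φ r * (-Real.log r) ≤ C * clampInt φ r)
    (hβ : 0 < β) (hβ1 : β ≤ 1) (hCβ : C * (1 / β - 1) ≤ 1 / 2) {d : ℝ} (hd : 0 < d)
    (hdr : d ^ β ≤ r₀) : clampInt φ (d ^ β) ≤ 2 * clampInt φ d := by
  have hm := hφ.toIsModulus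
  set s := d ^ β with hs
  have hs0 : 0 < s := Real.rpow_pos_of_pos hd _
  have hs1 : s < 1 := hdr.trans_lt hr1
  have hd1 : d < 1 := by
    by_contra h
    exact absurd (Real.one_le_rpow (not_lt.mp h) hβ.le) (not_le.mpr hs1)
  have hds : d ≤ s := by
    have := Real.rpow_le_rpow_of_exponent_ge hd hd1.le hβ1
    rwa [Real.rpow_one] at this
  have hL : 0 < -Real.log s := neg_pos.mpr (Real.log_neg hs0 hs1)
  have hlog : Real.log s = β * Real.log d := Real.log_rpow hd β
  have hsum : clampInt φ s = clampInt φ d + ∫ t in Set.Ioc d s, clampMod φ t / t := by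
    rw [clampInt, clampInt, min_eq_left hs1.le, min_eq_left hd1.le,
      ← Set.Ioc_union_Ioc_eq_Ioc hd.le hds]
    refine setIntegral_union (Set.Ioc_disjoint_Ioc_of_le le_rfl) measurableSet_Ioc
      (integrableOn_clampMod_div hφ hd1.le)
      ((integrableOn_clampMod_div hφ hs1.le).mono_set (Set.Ioc_subset_Ioc_left hd.le))
  set c := C * clampInt φ s / (-Real.log s) with hc
  have hc0 : 0 ≤ c := div_nonneg (mul_nonneg hC0.le (clampInt_nonneg hm s)) hL.le
  have hint : ∫ t in Set.Ioc d s, clampMod φ t / t ≤ c * Real.log (s / d) := by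
    have h1 : IntegrableOn (fun t => c / t) (Set.Ioc d s) := by
      rw [← intervalIntegrable_iff_integrableOn_Ioc_of_le hds]
      refine ContinuousOn.intervalIntegrable ?_
      refine continuousOn_const.div continuousOn_id fun t ht => ?_
      rw [Set.uIcc_of_le hds] at ht
      exact (hd.trans_le ht.1).ne'
    have h2 : ∫ t in Set.Ioc d s, c / t = c * Real.log (s / d) := by
      rw [← intervalIntegral.integral_of_le hds]
      simp only [div_eq_mul_inv c]
      rw [intervalIntegral.integral_const_mul, integral_inv_of_pos hd hs0]
    rw [← h2]
    refine setIntegral_mono_on ((integrableOn_clampMod_div hφ hs1.le).mono_set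
      (Set.Ioc_subset_Ioc_left hd.le)) h1 measurableSet_Ioc fun t ht => ?_
    have ht0 : 0 < t := hd.trans ht.1
    refine div_le_div_of_nonneg_right ?_ ht0.le
    rw [hc, le_div_iff₀ hL]
    calc clampMod φ t * (-Real.log s) ≤ clampMod φ t * (-Real.log t) :=
          mul_le_mul_of_nonneg_left (neg_le_neg (Real.log_le_log ht0 ht.2)) (clampMod_nonneg hm t)
      _ ≤ C * clampInt φ t := hC t ht0 (ht.2.trans hdr)
      _ ≤ C * clampInt φ s := mul_le_mul_of_nonneg_left (clampInt_mono hφ ht.2) hC0.le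
  have hval : c * Real.log (s / d) = C * (1 / β - 1) * clampInt φ s := by
    rw [hc, Real.log_div hs0.ne' hd.ne', hlog]
    have : Real.log d ≠ 0 := (Real.log_neg hd hd1).ne
    field_simp
    ring
  have h3 : C * (1 / β - 1) * clampInt φ s ≤ 1 / 2 * clampInt φ s :=
    mul_le_mul_of_nonneg_right hCβ (clampInt_nonneg hm s)
  linarith

/-- The comparison for exponents β close to 1 is iterated until β^m < 1/2. Values of d away from 0
are handled by boundedness and positivity of Ω. -/
theorem exists_clampInt_sqrt_le (hφ : IsAdmissibleModulus φ) :
    ∃ K : ℝ, 1 ≤ K ∧ ∀ d, 0 < d → d ≤ 1 → clampInt φ (√d) ≤ K * clampInt φ d := by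
  obtain ⟨r₀, C, hr0, hr1, hC0, hC⟩ := exists_clampMod_mul_log_le hφ
  have hm := hφ.toIsModulus
  -- With this exponent C(1/β - 1) is exactly 1/2.
  set β := 2 * C / (2 * C + 1) with hβ
  have hβ0 : 0 < β := by positivity
  have hβ1 : β < 1 := by rw [hβ, div_lt_one (by positivity)]; linarith
  have hCβ : C * (1 / β - 1) ≤ 1 / 2 := by
    rw [hβ]; field_simp; linarith
  obtain ⟨m, hmβ⟩ := exists_pow_lt_of_lt_one (by norm_num : (0 : ℝ) < 1 / 2) hβ1
  have hq0 : 0 < β ^ m := by positivity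
  -- For d ≤ d₁ even the last iterate d^(β^m) stays below r₀, where the logarithmic bound is valid.
  set d₁ := r₀ ^ (1 / β ^ m) with hd₁
  have hd₁0 : 0 < d₁ := Real.rpow_pos_of_pos hr0 _
  have hd₁1 : d₁ ≤ 1 := Real.rpow_le_one hr0.le hr1.le (by positivity)
  have hpos := clampInt_pos hφ hd₁0 hd₁1
  have hiter : ∀ d, 0 < d → d ≤ d₁ → ∀ i, i ≤ m → clampInt φ (d ^ β ^ i) ≤ 2 ^ i * clampInt φ d := by
    intro d hd hdd i
    induction i with
    | zero => intro _; simp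
    | succ i ih =>
      intro hi
      have h1 : d ^ β ^ (i + 1) = (d ^ β ^ i) ^ β := by
        rw [← Real.rpow_mul hd.le, pow_succ]
      have h2 : d ^ β ^ (i + 1) ≤ r₀ := by
        calc d ^ β ^ (i + 1) ≤ d ^ β ^ m :=
              Real.rpow_le_rpow_of_exponent_ge hd (hdd.trans hd₁1)
                (pow_le_pow_of_le_one hβ0.le hβ1.le hi)
          _ ≤ d₁ ^ β ^ m := Real.rpow_le_rpow hd.le hdd hq0.le
          _ = r₀ := by rw [hd₁, ← Real.rpow_mul hr0.le, one_div_mul_cancel hq0.ne', Real.rpow_one]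
      rw [h1] at h2 ⊢
      have h3 := clampInt_rpow_le hφ hr1 hC0 hC hβ0 hβ1.le hCβ (Real.rpow_pos_of_pos hd _) h2
      have h4 := ih (by omega)
      rw [pow_succ]
      linarith
  have hq : 0 ≤ clampInt φ 1 / clampInt φ d₁ := div_nonneg (clampInt_nonneg hm 1) hpos.le
  refine ⟨2 ^ m + clampInt φ 1 / clampInt φ d₁, ?_, fun d hd hd1 => ?_⟩
  · linarith [one_le_pow₀ (one_le_two (α := ℝ)) (n := m)]
  rcases le_or_gt d d₁ with h | h
  · calc clampInt φ (√d) ≤ clampInt φ (d ^ β ^ m) := by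
          refine clampInt_mono hφ ?_
          rw [Real.sqrt_eq_rpow]
          exact Real.rpow_le_rpow_of_exponent_ge hd hd1 hmβ.le
      _ ≤ 2 ^ m * clampInt φ d := hiter d hd h m le_rfl
      _ ≤ _ := mul_le_mul_of_nonneg_right (by linarith) (clampInt_nonneg hm d)
  · calc clampInt φ (√d) ≤ clampInt φ 1 := clampInt_le_one hφ _
      _ = clampInt φ 1 / clampInt φ d₁ * clampInt φ d₁ := by field_simp
      _ ≤ clampInt φ 1 / clampInt φ d₁ * clampInt φ d :=
          mul_le_mul_of_nonneg_left (clampInt_mono hφ h.le) hq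
      _ ≤ _ := mul_le_mul_of_nonneg_right (by linarith [pow_pos (two_pos (α := ℝ)) m])
          (clampInt_nonneg hm d)

theorem exists_clampMod_le (hφ : IsAdmissibleModulus φ) :
    ∃ K : ℝ, 1 ≤ K ∧ ∀ s, 0 < s → s ≤ 1 → clampMod φ s ≤ K * clampInt φ s := by
  obtain ⟨r₀, C, hr0, hr1, hC0, hC⟩ := exists_clampMod_mul_log_le hφ
  have hm := hφ.toIsModulus
  set r₂ := min r₀ (Real.exp (-1)) with hr₂
  have hr₂0 : 0 < r₂ := lt_min hr0 (Real.exp_pos _)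
  have hpos := clampInt_pos hφ hr₂0 ((min_le_left _ _).trans hr1.le)
  have hq : 0 ≤ clampMod φ 1 / clampInt φ r₂ := div_nonneg (clampMod_nonneg hm 1) hpos.le
  refine ⟨1 + C + clampMod φ 1 / clampInt φ r₂, by linarith, fun s hs hs1 => ?_⟩
  rcases le_or_gt s r₂ with h | h
  · have h1 := hC s hs (h.trans (min_le_left _ _))
    have h2 : 1 ≤ -Real.log s := by
      have := Real.log_le_log hs (h.trans (min_le_right _ _))
      rw [Real.log_exp] at this; linarith
    have h3 : clampMod φ s ≤ clampMod φ s * (-Real.log s) :=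
      le_mul_of_one_le_right (clampMod_nonneg hm s) h2
    calc _ ≤ C * clampInt φ s := h3.trans h1
      _ ≤ _ := mul_le_mul_of_nonneg_right (by linarith) (clampInt_nonneg hm s)
  · calc clampMod φ s ≤ clampMod φ 1 := clampMod_le hm s
      _ = clampMod φ 1 / clampInt φ r₂ * clampInt φ r₂ := by field_simp
      _ ≤ clampMod φ 1 / clampInt φ r₂ * clampInt φ s :=
          mul_le_mul_of_nonneg_left (clampInt_mono hφ h.le) hq
      _ ≤ _ := mul_le_mul_of_nonneg_right (by linarith) (clampInt_nonneg hm s)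

/-- Because Ω(√d) ≤ KΩ(d), Ω cannot vanish faster than a small power of d: passing from d to √d
costs Ω a factor K, while d^(1/8) gains d^(1/16), which is smaller than 1/K near 0. -/
theorem exists_sqrt_le_clampInt (hφ : IsAdmissibleModulus φ) :
    ∃ C : ℝ, 0 < C ∧ ∀ d, 0 < d → d ≤ 1 → √√√d ≤ C * clampInt φ d := by
  obtain ⟨K, hK, hKd⟩ := exists_clampInt_sqrt_le hφ
  have hm := hφ.toIsModulus
  have hKi : 0 < 1 / (2 * K) := by positivity
  -- Below d₂ the gain d^(1/16) is at most 1/(2K). The induction covers [d₂^(2^n), 1], since taking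
  -- the square root halves the exponent.
  set d₂ := ((1 / (2 * K)) ^ 16 : ℝ) with hd₂
  have hK1 : 1 / (2 * K) < 1 := by rw [div_lt_one (by positivity)]; linarith
  have hd₂0 : 0 < d₂ := by positivity
  have hd₂1 : d₂ < 1 := pow_lt_one₀ hKi.le hK1 (by norm_num)
  have hpos := clampInt_pos hφ hd₂0 hd₂1.le
  have hroot : ∀ a : ℝ, 0 ≤ a → √√√√(a ^ 16) = a := by
    intro a ha
    rw [show a ^ 16 = (a ^ 8) ^ 2 by ring, Real.sqrt_sq (by positivity),
      show a ^ 8 = (a ^ 4) ^ 2 by ring, Real.sqrt_sq (by positivity),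
      show a ^ 4 = (a ^ 2) ^ 2 by ring, Real.sqrt_sq (by positivity), Real.sqrt_sq ha]
  have hbase : ∀ d, d₂ ≤ d → d ≤ 1 → √√√d ≤ 1 / clampInt φ d₂ * clampInt φ d := by
    intro d hd hd1
    have h1 : √√√d ≤ 1 := by
      rw [Real.sqrt_le_one, Real.sqrt_le_one, Real.sqrt_le_one]; exact hd1
    refine h1.trans ?_
    rw [one_div, ← div_eq_inv_mul, one_le_div hpos]
    exact clampInt_mono hφ hd
  have hind : ∀ n : ℕ, ∀ d, d₂ ^ 2 ^ n ≤ d → d ≤ 1 →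
      √√√d ≤ 1 / clampInt φ d₂ * clampInt φ d := by
    intro n
    induction n with
    | zero => intro d hd; rw [pow_zero, pow_one] at hd; exact hbase d hd
    | succ n ih =>
      intro d hd hd1
      rcases le_or_gt d₂ d with h | h
      · exact hbase d h hd1
      have hd0 : 0 < d := lt_of_lt_of_le (by positivity) hd
      have h1 : d₂ ^ 2 ^ n ≤ √d := by
        rw [Real.le_sqrt (by positivity) hd0.le, ← pow_mul, ← pow_succ]; exact hd
      have h2 := ih (√d) h1 (by rw [Real.sqrt_le_one]; exact hd1)
      have h3 : √√√√d ≤ 1 / (2 * K) := by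
        rw [← hroot (1 / (2 * K)) hKi.le]
        exact Real.sqrt_le_sqrt (Real.sqrt_le_sqrt (Real.sqrt_le_sqrt (Real.sqrt_le_sqrt h.le)))
      have h4 : √√√d = √√√√d * √√√√d := (Real.mul_self_sqrt (Real.sqrt_nonneg _)).symm
      have h5 := hKd d hd0 hd1
      calc √√√d = √√√√d * √√√√d := h4
        _ ≤ 1 / (2 * K) * (1 / clampInt φ d₂ * clampInt φ (√d)) :=
            mul_le_mul h3 h2 (Real.sqrt_nonneg _) hKi.le
        _ ≤ 1 / (2 * K) * (1 / clampInt φ d₂ * (K * clampInt φ d)) := by gcongr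
        _ = 1 / 2 * (1 / clampInt φ d₂ * clampInt φ d) := by field_simp
        _ ≤ _ := by
            have : 0 ≤ 1 / clampInt φ d₂ * clampInt φ d :=
              mul_nonneg (by positivity) (clampInt_nonneg hm d)
            linarith
  refine ⟨1 / clampInt φ d₂, by positivity, fun d hd hd1 => ?_⟩
  obtain ⟨n, hn⟩ := exists_pow_lt_of_lt_one hd hd₂1
  refine hind n d (le_trans ?_ hn.le) hd1
  exact pow_le_pow_of_le_one hd₂0.le hd₂1.le (Nat.lt_two_pow_self).le

/-- This is (A2) at δ = 1/2. The threshold keeps s in the admissible range and 2s below 1, where the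
frozen modulus agrees with φ; larger s are covered by boundedness. -/
theorem exists_clampMod_double (hφ : IsAdmissibleModulus φ) :
    ∃ K : ℝ, 1 ≤ K ∧ ∀ s, 0 ≤ s → clampMod φ (2 * s) ≤ K * clampMod φ s := by
  obtain ⟨C, hC, h⟩ := hφ.scaling
  have hm := hφ.toIsModulus
  obtain ⟨M, hM⟩ := h (1 / 2) (by norm_num) (by norm_num)
  set r₃ := min (C / 4) (1 / 4) with hr₃
  have hr₃0 : 0 < r₃ := lt_min (by linarith) (by norm_num)
  have hpos := clampMod_pos hm hr₃0
  have hp2 : 0 < φ (1 / 2) := hm.pos _ (by norm_num)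
  have hq : 0 ≤ clampMod φ 1 / clampMod φ r₃ := div_nonneg (clampMod_nonneg hm 1) hpos.le
  have hq' : 0 ≤ |M| / φ (1 / 2) := by positivity
  refine ⟨1 + |M| / φ (1 / 2) + clampMod φ 1 / clampMod φ r₃, by linarith, fun s hs => ?_⟩
  rcases hs.eq_or_lt with rfl | hs
  · rw [mul_zero, clampMod_zero hm, mul_zero]
  rcases le_or_gt s r₃ with h1 | h1
  · have hs1 : s ≤ C / 4 := h1.trans (min_le_left _ _)
    have hs2 : s ≤ 1 / 4 := h1.trans (min_le_right _ _)
    have h2 := hM ⟨s, ⟨hs, by linarith⟩, rfl⟩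
    simp only at h2
    have hps := hm.pos s hs
    rw [show ((1 : ℝ) / 2)⁻¹ * s = 2 * s by norm_num] at h2
    have h3 : φ (2 * s) ≤ |M| / φ (1 / 2) * φ s := by
      have h4 : φ (2 * s) = φ (2 * s) / φ s * φ (1 / 2) * (φ s / φ (1 / 2)) := by field_simp
      rw [h4]
      calc _ ≤ |M| * (φ s / φ (1 / 2)) :=
            mul_le_mul_of_nonneg_right (h2.trans (le_abs_self M)) (by positivity)
        _ = _ := by ring
    rw [clampMod_eq (by linarith) (by linarith), clampMod_eq hs.le (by linarith)]
    refine h3.trans (mul_le_mul_of_nonneg_right (by linarith) hps.le)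
  · calc clampMod φ (2 * s) ≤ clampMod φ 1 := clampMod_le hm _
      _ = clampMod φ 1 / clampMod φ r₃ * clampMod φ r₃ := by field_simp
      _ ≤ clampMod φ 1 / clampMod φ r₃ * clampMod φ s :=
          mul_le_mul_of_nonneg_left (clampMod_mono hm h1.le) hq
      _ ≤ _ := mul_le_mul_of_nonneg_right (by linarith) (clampMod_nonneg hm s)

/-- All later estimates use only this list of inequalities. The decisive one is Ω² ≤ Kω, from Ω =
O(ω^(1-θ)) and 2(1-θ) > 1; the comparison on [d, √d] comes from (A3), and doubling from (A2). -/
theorem IsAdmissibleModulus.exists_modData (hφ : IsAdmissibleModulus φ) :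
    ∃ K, ModData (clampMod φ) (clampInt φ) K := by
  have hm := hφ.toIsModulus
  obtain ⟨θ, I, h0, h1, hI0, hI⟩ := hφ.exists_dini
  obtain ⟨K₁, hK₁, hsqrt⟩ := exists_clampInt_sqrt_le hφ
  obtain ⟨K₂, hK₂, hle⟩ := exists_clampMod_le hφ
  obtain ⟨C, hC, hpow⟩ := exists_sqrt_le_clampInt hφ
  obtain ⟨K₃, hK₃, hdbl⟩ := exists_clampMod_double hφ
  set W := clampMod φ 1 with hW
  have hW0 : 0 ≤ W := clampMod_nonneg hm 1
  have hWp : 0 ≤ W ^ (1 - 2 * θ) := Real.rpow_nonneg hW0 _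
  set A := W ^ (1 - 2 * θ) * (I * I) with hA
  have hA0 : 0 ≤ A := by positivity
  have hI1 : 0 ≤ clampInt φ 1 := clampInt_nonneg hm 1
  have hCA : 0 ≤ C ^ 2 * A := by positivity
  have hKK : 0 ≤ K₁ * K₂ := by positivity
  set K := 1 + K₁ + K₁ * K₂ + K₃ + W + A + clampInt φ 1 + C ^ 2 * A with hK
  have hsq : ∀ d, 0 < d → d ≤ 1 → clampInt φ d ^ 2 ≤ A * clampMod φ d := by
    intro d hd hd1
    have h2 := clampInt_le hφ h0 h1 hI0 hI hd1
    have hp := clampMod_pos hm hd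
    calc clampInt φ d ^ 2 ≤ (clampMod φ d ^ (1 - θ) * I) ^ 2 :=
          pow_le_pow_left₀ (clampInt_nonneg hm d) h2 2
      _ = clampMod φ d ^ (1 - 2 * θ) * (I * I) * clampMod φ d := by
          have : (clampMod φ d ^ (1 - θ)) ^ 2 = clampMod φ d ^ (1 - 2 * θ) * clampMod φ d := by
            rw [← Real.rpow_natCast, ← Real.rpow_mul hp.le]
            conv_rhs => rw [← Real.rpow_one (clampMod φ d), ← Real.rpow_mul hp.le,
              ← Real.rpow_add hp]
            congr 1; push_cast; ring
          rw [mul_pow, this]; ring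
      _ ≤ _ := by
          refine mul_le_mul_of_nonneg_right ?_ hp.le
          refine mul_le_mul_of_nonneg_right ?_ (by positivity)
          exact Real.rpow_le_rpow hp.le (clampMod_le hm d) (by linarith)
  refine ⟨K, ?_⟩
  constructor
  · linarith
  · exact clampMod_mono hm
  · exact clampMod_nonneg hm
  · exact fun s hs => clampMod_pos hm hs
  · exact fun s => (clampMod_le hm s).trans (by linarith)
  · refine hm.tendsto_zero.congr' ?_
    have h4 : ∀ᶠ ε in 𝓝[>] (0 : ℝ), ε < 1 := mem_nhdsWithin_of_mem_nhds (Iio_mem_nhds one_pos)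
    filter_upwards [h4, eventually_mem_nhdsWithin] with s hs hs0
    rw [clampMod_eq (le_of_lt hs0) hs.le]
  · exact clampMod_zero hm
  · exact fun s hs => (hdbl s hs).trans
      (mul_le_mul_of_nonneg_right (by linarith) (clampMod_nonneg hm s))
  · exact clampInt_mono hφ
  · exact clampInt_nonneg hm
  · exact fun s => (clampInt_le_one hφ s).trans (by linarith)
  · exact fun r hr => lb_clampInt hφ hr
  -- Again θ < 1/2 is used: Ω ≤ I ω^(1-2θ) ω^θ, and the last factor is the Dini integrand. Thus Ω is
  -- itself a Dini modulus.
  · have h2 : LB (Set.Ioc 0 1) (fun s => clampInt φ s / s) (W ^ (1 - 2 * θ) * I * I) := by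
      refine lb_of_abs_le measurableSet_Ioc hI (by positivity) fun s hs => ?_
      have hp := clampMod_pos hm hs.1
      rw [← mul_div_assoc]
      refine div_le_div_of_nonneg_right ?_ hs.1.le
      refine (clampInt_le hφ h0 h1 hI0 hI hs.2).trans ?_
      have h3 : clampMod φ s ^ (1 - θ) = clampMod φ s ^ (1 - 2 * θ) * clampMod φ s ^ θ := by
        rw [← Real.rpow_add hp]; congr 1; ring
      rw [h3]
      calc clampMod φ s ^ (1 - 2 * θ) * clampMod φ s ^ θ * I
          ≤ W ^ (1 - 2 * θ) * clampMod φ s ^ θ * I := by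
            refine mul_le_mul_of_nonneg_right ?_ (by linarith)
            refine mul_le_mul_of_nonneg_right ?_ (Real.rpow_nonneg hp.le _)
            exact Real.rpow_le_rpow hp.le (clampMod_le hm s) (by linarith)
        _ = _ := by ring
    refine h2.mono_const ?_
    rw [mul_assoc, ← hA]; linarith
  · intro d s hd hd1 hds hsd
    have hs1 : s ≤ 1 := hsd.trans (Real.sqrt_le_one.mpr hd1)
    have e1 : clampInt φ s ≤ K₁ * clampInt φ d :=
      (clampInt_mono hφ hsd).trans (hsqrt d hd hd1)
    have e2 : clampMod φ s ≤ K₂ * (K₁ * clampInt φ d) :=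
      (hle s (hd.trans_le hds) hs1).trans (mul_le_mul_of_nonneg_left e1 (by linarith))
    constructor
    · refine e2.trans ?_
      rw [← mul_assoc]
      exact mul_le_mul_of_nonneg_right (by linarith) (clampInt_nonneg hm d)
    · exact e1.trans (mul_le_mul_of_nonneg_right (by linarith) (clampInt_nonneg hm d))
  · exact fun d hd hd1 => (hsq d hd hd1).trans
      (mul_le_mul_of_nonneg_right (by linarith) (clampMod_nonneg hm d))
  · intro d hd hd1
    have h2 := hpow d hd hd1
    -- Squaring d^(1/8) ≤ CΩ(d) and applying Ω² = O(ω) gives d^(1/4) = O(ω(d)).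
    calc √√d = √√√d ^ 2 := (Real.sq_sqrt (Real.sqrt_nonneg _)).symm
      _ ≤ (C * clampInt φ d) ^ 2 := pow_le_pow_left₀ (Real.sqrt_nonneg _) h2 2
      _ = C ^ 2 * clampInt φ d ^ 2 := by ring
      _ ≤ C ^ 2 * (A * clampMod φ d) :=
          mul_le_mul_of_nonneg_left (hsq d hd hd1) (by positivity)
      _ = C ^ 2 * A * clampMod φ d := by ring
      _ ≤ _ := mul_le_mul_of_nonneg_right (by linarith) (clampMod_nonneg hm d)

/-- Membership in `C^φ` in terms of the frozen modulus. -/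
theorem memC_iff_hasMod (hφ : IsModulus φ) {g : ℝ → ℝ} :
    MemC φ g ↔ ∃ C, HasMod (clampMod φ) C g := by
  constructor
  · rintro ⟨⟨B, hB⟩, C, hC⟩
    have hp := clampMod_pos hφ one_pos
    have hB0 : 0 ≤ B := (abs_nonneg _).trans (hB 0)
    have hq : 0 ≤ 2 * B / clampMod φ 1 := by positivity
    refine ⟨B + |C| + 2 * B / clampMod φ 1, fun x => (hB x).trans ?_, fun x y => ?_⟩
    · linarith [abs_nonneg C]
    · rcases le_or_gt |x - y| 1 with h | h
      · have h1 := hC x y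
        rw [← clampMod_eq (φ := φ) (abs_nonneg _) h] at h1
        refine h1.trans (mul_le_mul_of_nonneg_right ?_ (clampMod_nonneg hφ _))
        linarith [le_abs_self C]
      · have h1 : clampMod φ |x - y| = clampMod φ 1 := by
          rw [clampMod, clampMod, min_eq_right h.le, min_self]
        rw [h1]
        calc |g x - g y| ≤ |g x| + |g y| := abs_sub _ _
          _ ≤ B + B := add_le_add (hB x) (hB y)
          _ = 2 * B / clampMod φ 1 * clampMod φ 1 := by field_simp; ring
          _ ≤ _ := mul_le_mul_of_nonneg_right (by linarith [abs_nonneg C]) hp.le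
  · rintro ⟨C, hC⟩
    refine ⟨⟨C, hC.bdd⟩, C, fun x y => (hC.diff x y).trans ?_⟩
    refine mul_le_mul_of_nonneg_left ?_ hC.nonneg
    have : clampMod φ |x - y| = φ (min |x - y| 1) := by
      rw [clampMod, max_eq_right (le_min (abs_nonneg _) zero_le_one)]
    rw [this]
    exact hφ.mono (Set.mem_Ici.mpr (le_min (abs_nonneg _) zero_le_one))
      (Set.mem_Ici.mpr (abs_nonneg _)) (min_le_left _ _)

end

end CriticalHilbert

namespace CriticalHilbert

/-! ### Bilinear singular integrals -/

theorem far_subset_union (x ρ r : ℝ) : far x ρ ⊆ (far x ρ ∩ near x r) ∪ far x r := by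
  intro y hy
  rcases le_or_gt |x - y| r with h | h
  · exact Or.inl ⟨hy, h⟩
  · exact Or.inr h

/-- The gain factor in the variation of the kernels away from the diagonal. -/
noncomputable def gain (Ω : ℝ → ℝ) (d s : ℝ) : ℝ := √(d / s) * (if s ≤ √d then Ω d else 1)

/-- The data of a bilinear singular integral
`x ↦ P.V. ∫ (g(x) - g(z)) (b(x) - M(x, z)) / (x - z) dz`. -/
structure BilData (ω Ω : ℝ → ℝ) (C : ℝ) (g b : ℝ → ℝ) (M : ℝ → ℝ → ℝ) : Prop where
  hg : HasMod ω C g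
  hb : HasMod ω C b
  hMb : ∀ x z, |M x z| ≤ C
  hMm : ∀ x, AEStronglyMeasurable (M x) volume
  hdiag : ∀ x z, x ≠ z → |x - z| ≤ 1 → |b x - M x z| ≤ C * Ω |x - z|
  hMfar : ∀ x, LB (far x 1) (fun z => |M x z| / |x - z|) C
  hgfar : ∀ x, LB (far x 1) (fun z => |g z| / |x - z|) C
  hvar : ∀ x x' z, 0 < |x - x'| → |x - x'| ≤ 1 / 100 → 8 * |x - x'| < |x - z| →
    |M x z - M x' z| ≤ C * gain Ω |x - x'| |x - z|

section

variable {ω Ω : ℝ → ℝ} {K C : ℝ} {g b : ℝ → ℝ} {M : ℝ → ℝ → ℝ}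

theorem BilData.C_nonneg (D : BilData ω Ω C g b M) : 0 ≤ C := D.hg.nonneg

theorem BilData.abs_le (D : BilData ω Ω C g b M) {x z : ℝ} (hxz : x ≠ z)
    (h1 : |x - z| ≤ 1) :
    |(g x - g z) * (b x - M x z)| ≤ C ^ 2 * (ω |x - z| * Ω |x - z|) := by
  rw [abs_mul]
  calc |g x - g z| * |b x - M x z| ≤ (C * ω |x - z|) * (C * Ω |x - z|) :=
        mul_le_mul (D.hg.diff x z) (D.hdiag x z hxz h1) (abs_nonneg _)
          ((abs_nonneg _).trans (D.hg.diff x z))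
    _ = _ := by ring

theorem BilData.abs_le' (D : BilData ω Ω C g b M) (x z : ℝ) :
    |(g x - g z) * (b x - M x z)| ≤ 4 * C ^ 2 := by
  have h0 := D.C_nonneg
  rw [abs_mul]
  have e1 : |g x - g z| ≤ 2 * C :=
    (abs_sub _ _).trans (by linarith [D.hg.bdd x, D.hg.bdd z])
  have e2 : |b x - M x z| ≤ 2 * C :=
    (abs_sub _ _).trans (by linarith [D.hb.bdd x, D.hMb x z])
  calc _ ≤ (2 * C) * (2 * C) := mul_le_mul e1 e2 (abs_nonneg _) (by linarith)
    _ = _ := by ring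

theorem BilData.aestronglyMeasurable (D : BilData ω Ω C g b M) (h : ModData ω Ω K) (x : ℝ) :
    AEStronglyMeasurable (fun z => (g x - g z) * (b x - M x z)) volume :=
  ((aestronglyMeasurable_const).sub (D.hg.continuous h).aestronglyMeasurable).mul
    (aestronglyMeasurable_const.sub (D.hMm x))

theorem BilData.measurable_far (D : BilData ω Ω C g b M) (h : ModData ω Ω K) (x : ℝ) :
    Measurable fun z => |g z| / |x - z| :=
  ((D.hg.continuous h).measurable.abs).div (by fun_prop)

/-- Near x the numerator is O(ωΩ), hence absolutely integrable against 1/|x - z|. Far away only the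
constant g(x)b(x) fails to be integrable, and it is removed as an odd function. -/
theorem BilData.exists_hasPV (D : BilData ω Ω C g b M) (h : ModData ω Ω K) (x : ℝ) :
    ∃ L, HasPV (fun z => (g x - g z) * (b x - M x z) / (x - z)) x L ∧
      |L| ≤ C ^ 2 * K * (2 * K) + 3 * C ^ 2 := by
  have h0 := D.C_nonneg
  have hK := h.K_pos
  have e1 : LB (near x 1) (fun z => |(g x - g z) * (b x - M x z) - 0| / |x - z|)
      (C ^ 2 * K * (2 * K)) := by
    refine ((h.lb_near' x).const_mul (a := C ^ 2 * K) (by positivity)).mono_fun_ae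
      (measurableSet_near _ _) x fun z hz hzx => ?_
    rw [sub_zero, ← mul_div_assoc]
    refine div_le_div_of_nonneg_right ((D.abs_le hzx.symm hz).trans ?_) (abs_nonneg _)
    rw [mul_assoc]
    refine mul_le_mul_of_nonneg_left ?_ (by positivity)
    exact mul_le_mul_of_nonneg_right (h.le _) (h.nonneg' _)
  have e2 : LB (far x 1) (fun z => |(g x - g z) * (b x - M x z) - g x * b x| / |x - z|)
      (3 * C ^ 2) := by
    have k1 := ((D.hgfar x).const_mul h0).add ((D.hMfar x).const_mul (a := 2 * C) (by linarith))
      ((D.measurable_far h x).const_mul C) (by positivity) (by positivity)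
    refine (k1.mono_const (le_of_eq (by ring))).mono_fun (measurableSet_far _ _) fun z _ => ?_
    rw [← mul_div_assoc, ← mul_div_assoc, ← add_div]
    refine div_le_div_of_nonneg_right ?_ (abs_nonneg _)
    have hid : (g x - g z) * (b x - M x z) - g x * b x
        = -(g z * b x) + -(g x * M x z) + g z * M x z := by ring
    rw [hid]
    refine (abs_add_three _ _ _).trans ?_
    rw [abs_neg, abs_neg, abs_mul, abs_mul, abs_mul]
    have := mul_le_mul_of_nonneg_left (D.hb.bdd x) (abs_nonneg (g z))
    have := mul_le_mul_of_nonneg_right (D.hg.bdd x) (abs_nonneg (M x z))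
    have := mul_le_mul_of_nonneg_right (D.hg.bdd z) (abs_nonneg (M x z))
    linarith
  exact exists_hasPV_div (D.aestronglyMeasurable h x) e1 e2 (by positivity) (by positivity)

/-- Up to √d both ω and the gain contribute a factor Ω(d), and √(d/s) makes the integral converge at
scale d. Beyond √d the same root leaves d^(1/4). -/
theorem ModData.lb_gain (h : ModData ω Ω K) (x : ℝ) {d : ℝ} (hd : 0 < d) (hd1 : d ≤ 1) :
    LB (far x (8 * d)) (fun z => ω |x - z| * gain Ω d |x - z| / |x - z|)
      (4 * K * Ω d ^ 2 + 4 * K * √√d) := by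
  have hK := h.K_pos
  have hΩ := h.nonneg' d
  have hsd : 0 < √d := Real.sqrt_pos.mpr hd
  refine LB.mono_set ?_ (far_subset_union x (8 * d) (√d))
  refine LB.union ?_ ?_ (by positivity) (by positivity)
  · have k1 := ((lb_far_sqrt x (ρ := 8 * d) (d := d) (by linarith) hd.le).const_mul
      (a := K * Ω d ^ 2) (by positivity)).mono_set
      (Set.inter_subset_left (t := near x (√d)))
    refine (k1.mono_const ?_).mono_fun ((measurableSet_far _ _).inter (measurableSet_near _ _))
      fun z hz => ?_
    · have : √(d / (8 * d)) ≤ 1 := by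
        rw [Real.sqrt_le_one]
        rw [div_le_one (by linarith)]; linarith
      nlinarith [mul_nonneg hK.le (sq_nonneg (Ω d))]
    · have hz1 : 8 * d < |x - z| := hz.1
      have hz2 : |x - z| ≤ √d := hz.2
      rw [gain, if_pos hz2, ← mul_div_assoc]
      refine div_le_div_of_nonneg_right ?_ (abs_nonneg _)
      have k2 := (h.comp d |x - z| hd hd1 (by linarith) hz2).1
      calc ω |x - z| * (√(d / |x - z|) * Ω d) ≤ K * Ω d * (√(d / |x - z|) * Ω d) :=
            mul_le_mul_of_nonneg_right k2 (by positivity)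
        _ = _ := by ring
  · have k1 := (lb_far_sqrt x (ρ := √d) (d := d) hsd hd.le).const_mul (a := K) hK.le
    rw [Real.div_sqrt] at k1
    refine (k1.mono_const (le_of_eq (by ring))).mono_fun (measurableSet_far _ _) fun z hz => ?_
    have hz1 : √d < |x - z| := hz
    rw [gain, if_neg (not_le.mpr hz1), mul_one, ← mul_div_assoc]
    exact div_le_div_of_nonneg_right (mul_le_mul_of_nonneg_right (h.le _) (Real.sqrt_nonneg _))
      (abs_nonneg _)

theorem sqrt_le_sqrt_sqrt {d : ℝ} (hd1 : d ≤ 1) : √d ≤ √√d := by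
  refine Real.le_sqrt_of_sq_le ?_
  have : √d ≤ 1 := Real.sqrt_le_one.mpr hd1
  nlinarith [Real.sqrt_nonneg d]

/-- A bilinear singular integral has the modulus of continuity of its data. -/
theorem BilData.diff_le (D : BilData ω Ω C g b M) (h : ModData ω Ω K) {x x' J J' : ℝ}
    (hd : 0 < |x - x'|) (hd1 : |x - x'| ≤ 1 / 100)
    (hJ : HasPV (fun z => (g x - g z) * (b x - M x z) / (x - z)) x J)
    (hJ' : HasPV (fun z => (g x' - g z) * (b x' - M x' z) / (x' - z)) x' J') :
    |J - J'| ≤ 100 * C ^ 2 * K ^ 3 * ω |x - x'| := by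
  set d := |x - x'| with hd_def
  have h0 := D.C_nonneg
  have hK := h.K_pos
  have hK1 := h.one_le
  have hΩ := h.nonneg' d
  have hω := h.nonneg d
  have hd2 : d ≤ 1 := by linarith
  have hsd : 0 < √d := Real.sqrt_pos.mpr hd
  -- The smallness of d places all radii comparable to d, up to 10d, in the range where ω and Ω are
  -- controlled by Ω(d).
  have h10 : 10 * d ≤ √d := by
    refine Real.le_sqrt_of_sq_le ?_; nlinarith
  have hsd1 : √d ≤ 1 := Real.sqrt_le_one.mpr hd2
  have hs' : ∀ z, |x' - z| ≤ |x - z| + d := fun z => by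
    calc |x' - z| = |(x - z) - (x - x')| := by congr 1; ring
      _ ≤ _ := abs_sub _ _
  have hs : ∀ z, |x - z| ≤ |x' - z| + d := fun z => by
    calc |x - z| = |(x' - z) + (x - x')| := by congr 1; ring
      _ ≤ _ := abs_add_le _ _
  -- In a ball of radius comparable to d, pulling Ω(r) out of ∫ ωΩ/s leaves another Ω(r): this is
  -- the origin of Ω(d)².
  have hnr : ∀ w r, 0 < r → r ≤ 10 * d → d ≤ r →
      LB (near w r) (fun z => |(g w - g z) * (b w - M w z)| / |w - z|) (2 * C ^ 2 * (K * Ω d) ^ 2) := by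
    intro w r hr hr1 hdr
    have hr2 : r ≤ 1 := by linarith
    have hΩr := (h.comp d r hd hd2 hdr (hr1.trans h10)).2
    have k1 := (h.lb_near w hr2).const_mul (a := C ^ 2 * Ω r)
      (mul_nonneg (by positivity) (h.nonneg' _))
    refine (k1.mono_const ?_).mono_fun_ae (measurableSet_near _ _) w fun z hz hzw => ?_
    · calc C ^ 2 * Ω r * (2 * Ω r) = 2 * C ^ 2 * Ω r ^ 2 := by ring
        _ ≤ _ := mul_le_mul_of_nonneg_left (pow_le_pow_left₀ (h.nonneg' _) hΩr 2) (by positivity)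
    · have hz1 : |w - z| ≤ r := hz
      rw [← mul_div_assoc]
      refine div_le_div_of_nonneg_right ((D.abs_le hzw.symm (hz1.trans hr2)).trans ?_)
        (abs_nonneg _)
      calc C ^ 2 * (ω |w - z| * Ω |w - z|) ≤ C ^ 2 * (ω |w - z| * Ω r) :=
            mul_le_mul_of_nonneg_left (mul_le_mul_of_nonneg_left (h.mono' hz1) (h.nonneg _))
              (by positivity)
        _ = _ := by ring
  have e1 := hnr x (8 * d) (by linarith) (by linarith) (by linarith)
  have e2 : LB (near x (8 * d)) (fun z => |(g x' - g z) * (b x' - M x' z)| / |x' - z|)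
      (2 * C ^ 2 * (K * Ω d) ^ 2) := by
    refine (hnr x' (9 * d) (by linarith) (by linarith) (by linarith)).mono_set fun z hz => ?_
    have : |x - z| ≤ 8 * d := hz
    show |x' - z| ≤ 9 * d
    linarith [hs' z]
  -- Divided at √d: below, both factors are at most a multiple of Ω(d); above, mere boundedness
  -- suffices because d/√d = √d is a power of d.
  have e3 : LB (far x (8 * d)) (fun z => |(g x - g z) * (b x - M x z)| / |x - z| ^ 2)
      (C ^ 2 * (K * Ω d) ^ 2 * (2 / (8 * d)) + 4 * C ^ 2 * (2 / √d)) := by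
    refine LB.mono_set ?_ (far_subset_union x (8 * d) (√d))
    refine LB.union ?_ ?_ (by positivity) (by positivity)
    · refine (((lb_far_inv_sq x (ρ := 8 * d) (by linarith)).const_mul
        (a := C ^ 2 * (K * Ω d) ^ 2) (by positivity)).mono_set Set.inter_subset_left).mono_fun
        ((measurableSet_far _ _).inter (measurableSet_near _ _)) fun z hz => ?_
      have hz1 : 8 * d < |x - z| := hz.1
      have hz2 : |x - z| ≤ √d := hz.2
      have hzx : x ≠ z := fun h => by rw [h, sub_self, abs_zero] at hz1; linarith
      obtain ⟨k1, k2⟩ := h.comp d |x - z| hd hd2 (by linarith) hz2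
      rw [mul_one_div]
      refine div_le_div_of_nonneg_right ((D.abs_le hzx (hz2.trans hsd1)).trans ?_) (by positivity)
      rw [sq (K * Ω d)]
      exact mul_le_mul_of_nonneg_left (mul_le_mul k1 k2 (h.nonneg' _) (by positivity))
        (by positivity)
    · refine ((lb_far_inv_sq x hsd).const_mul (a := 4 * C ^ 2) (by positivity)).mono_fun
        (measurableSet_far _ _) fun z hz => ?_
      rw [mul_one_div]
      exact div_le_div_of_nonneg_right (D.abs_le' x z) (by positivity)
  have hgain : ∀ s, 0 ≤ gain Ω d s := fun s => by
    unfold gain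
    split_ifs <;> positivity
  have e4 : LB (far x (8 * d) ∩ near x 1)
      (fun z => |(g x - g z) * (b x - M x z) - (g x' - g z) * (b x' - M x' z) - 0| / |x - z|)
      (C ^ 2 * ω d * (2 * K) + (K * C ^ 2 * ω d * (2 * K)
        + K * C ^ 2 * (4 * K * Ω d ^ 2 + 4 * K * √√d))) := by
    have k1 := ((h.lb_near' x).mono_set (Set.inter_subset_right (s := far x (8 * d)))).const_mul
      (a := C ^ 2 * ω d) (by positivity)
    have k2 := (((h.lb_near x le_rfl).mono_const (c' := 2 * K) (by linarith [h.le' 1])).mono_set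
      (Set.inter_subset_right (s := far x (8 * d)))).const_mul (a := K * C ^ 2 * ω d)
      (by positivity)
    have k3 := ((h.lb_gain x hd hd2).mono_set (Set.inter_subset_left (t := near x 1))).const_mul
      (a := K * C ^ 2) (by positivity)
    have hmω : Measurable ω := h.mono.measurable
    have hmΩ : Measurable Ω := h.mono'.measurable
    have habs : Measurable fun z : ℝ => |x - z| := by fun_prop
    have k4 := k1.add (k2.add k3
      (((hmω.comp habs).div habs).const_mul _) (by positivity) (by positivity))
      (((hmΩ.comp habs).div habs).const_mul _) (by positivity) (by positivity)
    refine k4.mono_fun ((measurableSet_far _ _).inter (measurableSet_near _ _)) fun z hz => ?_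
    have hz1 : 8 * d < |x - z| := hz.1
    have hz2 : |x - z| ≤ 1 := hz.2
    have hzx : x ≠ z := fun h => by rw [h, sub_self, abs_zero] at hz1; linarith
    rw [sub_zero, ← mul_div_assoc, ← mul_div_assoc, ← mul_div_assoc, ← add_div, ← add_div]
    refine div_le_div_of_nonneg_right ?_ (abs_nonneg _)
    -- The first two terms carry an increment O(ω(d)) of g or b times a Dini-integrable factor. The
    -- third pairs O(ω) with the variation of M, which is measured by `gain`.
    have hid : (g x - g z) * (b x - M x z) - (g x' - g z) * (b x' - M x' z)
        = (g x - g x') * (b x - M x z) + (g x' - g z) * (b x - b x')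
          + -((g x' - g z) * (M x z - M x' z)) := by ring
    rw [hid]
    refine (abs_add_three _ _ _).trans ?_
    rw [abs_neg, abs_mul, abs_mul, abs_mul]
    have hω2 : |g x' - g z| ≤ C * (K * ω |x - z|) := by
      refine (D.hg.diff x' z).trans (mul_le_mul_of_nonneg_left ?_ h0)
      exact (h.mono (by linarith [hs' z])).trans (h.double _ (abs_nonneg _))
    have m1 : |g x - g x'| * |b x - M x z| ≤ C * ω d * (C * Ω |x - z|) :=
      mul_le_mul (D.hg.diff x x') (D.hdiag x z hzx hz2) (abs_nonneg _) (by positivity)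
    have hωs := h.nonneg |x - z|
    have m2 : |g x' - g z| * |b x - b x'| ≤ C * (K * ω |x - z|) * (C * ω d) :=
      mul_le_mul hω2 (D.hb.diff x x') (abs_nonneg _) (by positivity)
    have m3 : |g x' - g z| * |M x z - M x' z|
        ≤ C * (K * ω |x - z|) * (C * gain Ω d |x - z|) :=
      mul_le_mul hω2 (D.hvar x x' z hd hd1 hz1) (abs_nonneg _) (by positivity)
    calc _ ≤ C * ω d * (C * Ω |x - z|) + C * (K * ω |x - z|) * (C * ω d)
          + C * (K * ω |x - z|) * (C * gain Ω d |x - z|) := add_le_add (add_le_add m1 m2) m3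
      _ = _ := by ring
  have e5 : LB (far x 1)
      (fun z => |(g x - g z) * (b x - M x z) - (g x' - g z) * (b x' - M x' z)
        - (g x * b x - g x' * b x')| / |x - z|)
      (C * ω d * C + (2 * C ^ 2 * (4 * √d) + C * ω d * C)) := by
    have k1 := (D.hgfar x).const_mul (a := C * ω d) (by positivity)
    have k2 := (D.hMfar x).const_mul (a := C * ω d) (by positivity)
    have k3 := (lb_far_sqrt x one_pos hd.le).const_mul (a := 2 * C ^ 2) (by positivity)
    rw [div_one] at k3
    have k4 := k1.add (k3.add k2 (by fun_prop) (by positivity) (by positivity))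
      ((D.measurable_far h x).const_mul _) (by positivity) (by positivity)
    refine k4.mono_fun (measurableSet_far _ _) fun z hz => ?_
    have hz1 : 1 < |x - z| := hz
    rw [← mul_div_assoc, ← mul_div_assoc, ← mul_div_assoc, ← add_div, ← add_div]
    refine div_le_div_of_nonneg_right ?_ (abs_nonneg _)
    -- After removal of the constant at infinity every term has a decaying factor: √(d/|x-z|) from
    -- the variation of M, or g(z), or M(x, z).
    have hid : (g x - g z) * (b x - M x z) - (g x' - g z) * (b x' - M x' z)
        - (g x * b x - g x' * b x')
        = (g z - g x') * (M x z - M x' z) + -(g z * (b x - b x')) + -((g x - g x') * M x z) := by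
      ring
    rw [hid]
    refine (abs_add_three _ _ _).trans ?_
    rw [abs_neg, abs_neg, abs_mul, abs_mul, abs_mul]
    have hv := D.hvar x x' z hd hd1 (by linarith)
    rw [gain, if_neg (not_le.mpr (by linarith)), mul_one] at hv
    have hgg : |g z - g x'| ≤ 2 * C :=
      (abs_sub _ _).trans (by linarith [D.hg.bdd z, D.hg.bdd x'])
    have m1 : |g z - g x'| * |M x z - M x' z| ≤ 2 * C * (C * √(d / |x - z|)) :=
      mul_le_mul hgg hv (abs_nonneg _) (by linarith)
    have m2 : |g z| * |b x - b x'| ≤ |g z| * (C * ω d) :=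
      mul_le_mul_of_nonneg_left (D.hb.diff x x') (abs_nonneg _)
    have m3 : |g x - g x'| * |M x z| ≤ C * ω d * |M x z| :=
      mul_le_mul_of_nonneg_right (D.hg.diff x x') (abs_nonneg _)
    calc _ ≤ 2 * C * (C * √(d / |x - z|)) + |g z| * (C * ω d) + C * ω d * |M x z| :=
          add_le_add (add_le_add m1 m2) m3
      _ = _ := by ring
  have hmain := pv_diff (ρ := 8 * d) (D.aestronglyMeasurable h x) (D.aestronglyMeasurable h x')
    (by linarith) (by linarith) (by linarith) (D.abs_le' x') hJ hJ' e1 e2 e3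
    (lb_far_inv_sq x (by linarith)) e4 e5 (by positivity) (by positivity) (by positivity)
    (by positivity) (by positivity)
  rw [← hd_def] at hmain
  refine hmain.trans ?_
  have he : |g x * b x - g x' * b x'| ≤ 2 * C ^ 2 * ω d := by
    have := (D.hg.mul D.hb).diff x x'
    rw [← hd_def] at this
    linarith
  have hd' : d ≠ 0 := hd.ne'
  have t1 : 2 * d * (C ^ 2 * (K * Ω d) ^ 2 * (2 / (8 * d)) + 4 * C ^ 2 * (2 / √d))
      = C ^ 2 * (K * Ω d) ^ 2 / 2 + 16 * C ^ 2 * √d := by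
    have : d / √d = √d := Real.div_sqrt
    calc _ = C ^ 2 * (K * Ω d) ^ 2 / 2 * (d / d) + 16 * C ^ 2 * (d / √d) := by
          field_simp; ring
      _ = _ := by rw [this, div_self hd', mul_one]
  have t2 : 4 * d / (8 * d) = 1 / 2 := by field_simp; norm_num
  rw [t1, t2, abs_zero]
  -- The bound so far consists of Ω(d)², ω(d), √d and d^(1/4); the properties `sq` and `pow` convert
  -- all of them into multiples of ω(d).
  have hsq := h.sq d hd hd2
  have hpw := h.pow d hd hd2
  have hpw' : √d ≤ K * ω d := (sqrt_le_sqrt_sqrt hd2).trans hpw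
  have hC2 : 0 ≤ C ^ 2 := by positivity
  have q1 : C ^ 2 * (K * Ω d) ^ 2 ≤ C ^ 2 * K ^ 3 * ω d := by
    calc C ^ 2 * (K * Ω d) ^ 2 = C ^ 2 * K ^ 2 * Ω d ^ 2 := by ring
      _ ≤ C ^ 2 * K ^ 2 * (K * ω d) := mul_le_mul_of_nonneg_left hsq (by positivity)
      _ = _ := by ring
  have hK2 : K ≤ K ^ 3 := by nlinarith [mul_nonneg (sub_nonneg.mpr hK1) hK.le, sq_nonneg (K - 1)]
  have hK3 : K ^ 2 ≤ K ^ 3 := by nlinarith [mul_nonneg (sub_nonneg.mpr hK1) (sq_nonneg K)]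
  have hK4 : 1 ≤ K ^ 3 := hK1.trans hK2
  have hCω : 0 ≤ C ^ 2 * ω d := by positivity
  have q2 : C ^ 2 * √d ≤ C ^ 2 * K ^ 3 * ω d := by
    calc C ^ 2 * √d ≤ C ^ 2 * (K * ω d) := mul_le_mul_of_nonneg_left hpw' hC2
      _ = K * (C ^ 2 * ω d) := by ring
      _ ≤ K ^ 3 * (C ^ 2 * ω d) := mul_le_mul_of_nonneg_right hK2 hCω
      _ = _ := by ring
  have q3 : K ^ 2 * C ^ 2 * √√d ≤ C ^ 2 * K ^ 3 * ω d := by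
    calc K ^ 2 * C ^ 2 * √√d ≤ K ^ 2 * C ^ 2 * (K * ω d) :=
          mul_le_mul_of_nonneg_left hpw (by positivity)
      _ = _ := by ring
  have q4 : C ^ 2 * ω d ≤ C ^ 2 * K ^ 3 * ω d := by
    calc C ^ 2 * ω d = 1 * (C ^ 2 * ω d) := by ring
      _ ≤ K ^ 3 * (C ^ 2 * ω d) := mul_le_mul_of_nonneg_right hK4 hCω
      _ = _ := by ring
  have q5 : C ^ 2 * ω d * K ≤ C ^ 2 * K ^ 3 * ω d := by
    calc C ^ 2 * ω d * K = K * (C ^ 2 * ω d) := by ring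
      _ ≤ K ^ 3 * (C ^ 2 * ω d) := mul_le_mul_of_nonneg_right hK2 hCω
      _ = _ := by ring
  have q6 : C ^ 2 * ω d * K ^ 2 ≤ C ^ 2 * K ^ 3 * ω d := by
    calc C ^ 2 * ω d * K ^ 2 = K ^ 2 * (C ^ 2 * ω d) := by ring
      _ ≤ K ^ 3 * (C ^ 2 * ω d) := mul_le_mul_of_nonneg_right hK3 hCω
      _ = _ := by ring
  nlinarith [q1, q2, q3, q4, q5, q6, he]

theorem BilData.exists_hasMod (D : BilData ω Ω C g b M) (h : ModData ω Ω K) :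
    ∃ (J : ℝ → ℝ) (C' : ℝ),
      (∀ x, HasPV (fun z => (g x - g z) * (b x - M x z) / (x - z)) x (J x)) ∧ HasMod ω C' J := by
  choose J hJ hJb using D.exists_hasPV h
  have h0 := D.C_nonneg
  have hK := h.K_pos
  set B := C ^ 2 * K * (2 * K) + 3 * C ^ 2 with hB
  have hB0 : 0 ≤ B := by positivity
  have hp := h.pos (1 / 100) (by norm_num)
  refine ⟨J, B + 2 * B / ω (1 / 100) + 100 * C ^ 2 * K ^ 3, hJ, fun x => ?_, fun x x' => ?_⟩
  · refine (hJb x).trans ?_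
    have : 0 ≤ 2 * B / ω (1 / 100) := by positivity
    have : 0 ≤ 100 * C ^ 2 * K ^ 3 := by positivity
    linarith
  have hω := h.nonneg |x - x'|
  have hsplit : (B + 2 * B / ω (1 / 100) + 100 * C ^ 2 * K ^ 3) * ω |x - x'|
      = B * ω |x - x'| + 2 * B / ω (1 / 100) * ω |x - x'|
        + 100 * C ^ 2 * K ^ 3 * ω |x - x'| := by ring
  rw [hsplit]
  have n1 : 0 ≤ B * ω |x - x'| := by positivity
  have n2 : 0 ≤ 2 * B / ω (1 / 100) * ω |x - x'| := by positivity
  have n3 : 0 ≤ 100 * C ^ 2 * K ^ 3 * ω |x - x'| := by positivity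
  rcases (abs_nonneg (x - x')).eq_or_lt with h1 | h1
  · have : x = x' := sub_eq_zero.mp (abs_eq_zero.mp h1.symm)
    subst this
    rw [sub_self, abs_zero]; linarith
  rcases le_or_gt |x - x'| (1 / 100) with h2 | h2
  · have := D.diff_le h h1 h2 (hJ x) (hJ x')
    linarith
  · have h3 : |J x - J x'| ≤ 2 * B := (abs_sub _ _).trans (by linarith [hJb x, hJb x'])
    have h4 : 2 * B ≤ 2 * B / ω (1 / 100) * ω |x - x'| := by
      calc 2 * B = 2 * B / ω (1 / 100) * ω (1 / 100) := by field_simp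
        _ ≤ _ := mul_le_mul_of_nonneg_left (h.mono h2.le) (by positivity)
    linarith

end

end CriticalHilbert

namespace CriticalHilbert

/-! ### Symmetric kernels -/

/-- Symmetric bounded kernels with modulus `ω` that are smoother away from the diagonal. -/
structure PreKernel (ω : ℝ → ℝ) (C : ℝ) (F : ℝ → ℝ → ℝ) : Prop where
  symm : ∀ x z, F x z = F z x
  bdd : ∀ x z, |F x z| ≤ C
  hol : ∀ x y z, |F y z - F x z| ≤ C * ω |x - y|
  smooth : ∀ x y z, 0 < |x - z| → 2 * |x - y| ≤ |x - z| →
    |F y z - F x z| ≤ C * (|x - y| / |x - z| * ω |x - z|)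

/-- Kernels that moreover decay off the diagonal and vanish when both arguments are large. -/
structure SymKernel (ω : ℝ → ℝ) (A C : ℝ) (F : ℝ → ℝ → ℝ) : Prop extends PreKernel ω C F where
  decay : ∀ x z, |F x z| * (1 + |x - z|) ≤ C
  supp : ∀ x z, A < |x| → A < |z| → F x z = 0

section

variable {ω Ω : ℝ → ℝ} {K C C' A : ℝ} {F G : ℝ → ℝ → ℝ} {g h : ℝ → ℝ}

theorem PreKernel.nonneg (hF : PreKernel ω C F) : 0 ≤ C := (abs_nonneg _).trans (hF.bdd 0 0)

theorem PreKernel.mono (hF : PreKernel ω C F) (h : ModData ω Ω K) (hC : C ≤ C') :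
    PreKernel ω C' F where
  symm := hF.symm
  bdd x z := (hF.bdd x z).trans hC
  hol x y z := (hF.hol x y z).trans (mul_le_mul_of_nonneg_right hC (h.nonneg _))
  smooth x y z h1 h2 := (hF.smooth x y z h1 h2).trans
    (mul_le_mul_of_nonneg_right hC (mul_nonneg (by positivity) (h.nonneg _)))

theorem preKernel_one (h : ModData ω Ω K) : PreKernel ω 1 fun _ _ => 1 where
  symm _ _ := rfl
  bdd _ _ := by simp
  hol x y z := by simpa using h.nonneg _
  smooth x y z h1 _ := by
    simpa using mul_nonneg (by positivity) (h.nonneg _)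

theorem PreKernel.mul (hF : PreKernel ω C F) (hG : PreKernel ω C' G) :
    PreKernel ω (2 * C * C') fun x z => F x z * G x z := by
  have h0 := hF.nonneg
  have h0' := hG.nonneg
  have key : ∀ x y z a b : ℝ, |F y z - F x z| ≤ C * a → |G y z - G x z| ≤ C' * a →
      |F y z * G y z - F x z * G x z| ≤ 2 * C * C' * a := by
    intro x y z a b h1 h2
    calc |F y z * G y z - F x z * G x z|
        = |F y z * (G y z - G x z) + (F y z - F x z) * G x z| := by congr 1; ring
      _ ≤ |F y z| * |G y z - G x z| + |F y z - F x z| * |G x z| := by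
          rw [← abs_mul, ← abs_mul]; exact abs_add_le _ _
      _ ≤ C * (C' * a) + C * a * C' := by
          refine add_le_add (mul_le_mul (hF.bdd y z) h2 (abs_nonneg _) h0)
            (mul_le_mul h1 (hG.bdd x z) (abs_nonneg _) ((abs_nonneg _).trans h1))
      _ = _ := by ring
  refine ⟨fun x z => by rw [hF.symm, hG.symm], fun x z => ?_,
    fun x y z => key x y z _ 0 (hF.hol x y z) (hG.hol x y z),
    fun x y z h1 h2 => key x y z _ 0 (hF.smooth x y z h1 h2) (hG.smooth x y z h1 h2)⟩
  rw [abs_mul]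
  have := mul_le_mul (hF.bdd x z) (hG.bdd x z) (abs_nonneg _) h0
  nlinarith [mul_nonneg h0 h0']

theorem PreKernel.exists_pow (hF : PreKernel ω C F) (h : ModData ω Ω K) (n : ℕ) :
    ∃ C', PreKernel ω C' fun x z => F x z ^ n := by
  induction n with
  | zero => exact ⟨1, by simpa using preKernel_one h⟩
  | succ n ih =>
    obtain ⟨C', hC'⟩ := ih
    exact ⟨_, by simpa only [pow_succ] using hC'.mul hF⟩

theorem exists_preKernel_prod {ι : Type*} (h : ModData ω Ω K) (s : Finset ι)
    {F : ι → ℝ → ℝ → ℝ} (hF : ∀ i, ∃ C, PreKernel ω C (F i)) :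
    ∃ C, PreKernel ω C fun x z => ∏ i ∈ s, F i x z := by
  classical
  induction s using Finset.induction_on with
  | empty => exact ⟨1, by simpa using preKernel_one h⟩
  | insert a s ha ih =>
    obtain ⟨C', hC'⟩ := ih
    obtain ⟨C, hC⟩ := hF a
    exact ⟨_, by simpa only [Finset.prod_insert ha] using hC.mul hC'⟩

theorem ModData.tendsto_abs (h : ModData ω Ω K) : Tendsto (fun t => ω |t|) (𝓝 0) (𝓝 0) := by
  have h1 : Tendsto ω (𝓝[≥] 0) (𝓝 0) := by
    rw [← Set.Ioi_insert, nhdsWithin_insert]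
    refine Tendsto.sup ?_ h.tendsto
    rw [tendsto_pure_left]
    intro s hs
    rw [h.zero]
    exact mem_of_mem_nhds hs
  refine h1.comp (tendsto_nhdsWithin_iff.mpr ⟨?_, Eventually.of_forall fun y =>
    Set.mem_Ici.mpr (abs_nonneg _)⟩)
  simpa using (continuous_abs (G := ℝ)).tendsto 0

theorem PreKernel.continuous (hF : PreKernel ω C F) (h : ModData ω Ω K) :
    Continuous fun p : ℝ × ℝ => F p.1 p.2 := by
  rw [continuous_iff_continuousAt]
  rintro ⟨x, z⟩
  rw [ContinuousAt, tendsto_iff_dist_tendsto_zero]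
  have h1 : Tendsto (fun p : ℝ × ℝ => C * ω |x - p.1| + C * ω |z - p.2|) (𝓝 (x, z))
      (𝓝 (C * 0 + C * 0)) := by
    refine ((h.tendsto_abs.comp ?_).const_mul C).add ((h.tendsto_abs.comp ?_).const_mul C)
    · have : Continuous fun p : ℝ × ℝ => x - p.1 := by fun_prop
      simpa using this.tendsto (x, z)
    · have : Continuous fun p : ℝ × ℝ => z - p.2 := by fun_prop
      simpa using this.tendsto (x, z)
  rw [mul_zero, add_zero] at h1
  refine squeeze_zero (fun _ => dist_nonneg) (fun p => ?_) h1
  calc dist (F p.1 p.2) (F x z) ≤ dist (F p.1 p.2) (F x p.2) + dist (F x p.2) (F x z) :=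
        dist_triangle _ _ _
    _ ≤ _ := by
        refine add_le_add (hF.hol x p.1 p.2) ?_
        rw [hF.symm x p.2, hF.symm x z]
        exact hF.hol z p.2 x

theorem PreKernel.hasMod_left (hF : PreKernel ω C F) (z : ℝ) : HasMod ω C fun y => F y z :=
  ⟨fun y => hF.bdd y z, fun x y => by rw [abs_sub_comm]; exact hF.hol x y z⟩

theorem PreKernel.hasMod_right (hF : PreKernel ω C F) (x : ℝ) : HasMod ω C fun y => F x y := by
  simpa only [hF.symm x] using hF.hasMod_left x

theorem PreKernel.hasMod_diag (hF : PreKernel ω C F) : HasMod ω (2 * C) fun y => F y y := by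
  refine ⟨fun x => (hF.bdd x x).trans (by linarith [hF.nonneg]), fun x y => ?_⟩
  calc |F x x - F y y| ≤ |F x x - F y x| + |F y x - F y y| := abs_sub_le _ _ _
    _ ≤ C * ω |x - y| + C * ω |x - y| :=
        add_le_add ((hF.hasMod_left x).diff x y) ((hF.hasMod_right y).diff x y)
    _ = _ := by ring

/-! ### Decay at infinity and existence of principal values -/

/-- Decay of order one at infinity. -/
def HasDecay (C : ℝ) (g : ℝ → ℝ) : Prop := ∀ x, |g x| * (1 + |x|) ≤ C

theorem lb_far_of_decay {p : ℝ → ℝ} {w : ℝ} (x : ℝ) (hp : ∀ y, |p y| * (1 + |w - y|) ≤ C) :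
    LB (far x 1) (fun y => |p y| / |x - y|) (C * 3) := by
  have hC : 0 ≤ C := (mul_nonneg (abs_nonneg _) (by positivity)).trans (hp 0)
  refine lb_of_abs_le (measurableSet_far _ _) (lb_decay x w) hC fun y _ => ?_
  rw [← mul_div_assoc]
  refine div_le_div_of_nonneg_right ?_ (abs_nonneg _)
  rw [mul_one_div, le_div_iff₀ (by positivity)]
  exact hp y

theorem HasDecay.lb_far (hg : HasDecay C g) (x : ℝ) :
    LB (far x 1) (fun y => |g y| / |x - y|) (C * 3) :=
  lb_far_of_decay (w := 0) x fun y => by simpa using hg y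

theorem SymKernel.lb_far (hF : SymKernel ω A C F) (x z : ℝ) :
    LB (far x 1) (fun y => |F y z| / |x - y|) (C * 3) :=
  lb_far_of_decay (w := z) x fun y => by rw [hF.symm]; exact hF.decay z y

theorem HasMod.lb_near (hg : HasMod ω C g) (h : ModData ω Ω K) (x : ℝ) {r : ℝ} (hr : r ≤ 1) :
    LB (near x r) (fun y => |g y - g x| / |x - y|) (C * (2 * Ω r)) := by
  refine lb_of_abs_le (measurableSet_near _ _) (h.lb_near x hr) hg.nonneg fun y _ => ?_
  rw [← mul_div_assoc]
  refine div_le_div_of_nonneg_right ?_ (abs_nonneg _)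
  rw [abs_sub_comm]
  exact hg.diff x y

theorem HasMod.exists_hasPV (hg : HasMod ω C g) (h : ModData ω Ω K) {x c : ℝ} (hc : 0 ≤ c)
    (hfar : LB (far x 1) (fun y => |g y| / |x - y|) c) :
    ∃ L, HasPV (fun y => g y / (x - y)) x L ∧ |L| ≤ 2 * C * K + c := by
  have h0 := hg.nonneg
  obtain ⟨L, hL, hLb⟩ := exists_hasPV_div (c₂ := 0)
    (hg.continuous h).aestronglyMeasurable (hg.lb_near h x le_rfl) (by simpa using hfar)
    (mul_nonneg h0 (by linarith [h.nonneg' 1])) hc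
  refine ⟨L, hL, hLb.trans ?_⟩
  have := mul_le_mul_of_nonneg_left (h.le' 1) h0
  linarith

/-- For |x| > 2A the support stays at distance at least |x|/2 from x, so nothing is singular and the
integral has size 1/|x|. -/
theorem hasPV_of_support {p : ℝ → ℝ} {x : ℝ} (hp : AEStronglyMeasurable p volume)
    (hC : ∀ y, |p y| ≤ C) (hA : 0 < A) (hs : ∀ y, A < |y| → p y = 0) (hx : 2 * A < |x|) :
    ∃ L, HasPV (fun y => p y / (x - y)) x L ∧ |L| ≤ 4 * A * C / |x| := by
  have hC0 : 0 ≤ C := (abs_nonneg _).trans (hC 0)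
  have hx0 : 0 < |x| := by linarith
  have h1 : LB (near 0 A) (fun y => |p y / (x - y) - 0|) (4 * A * C / |x|) := by
    have h0 : LB (near 0 A) (fun _ => 2 * C / |x|) (4 * A * C / |x|) := by
      unfold LB
      rw [near_eq_Icc, setLIntegral_const, Real.volume_Icc, ← ENNReal.ofReal_mul (by positivity)]
      apply ENNReal.ofReal_le_ofReal
      refine le_of_eq ?_
      ring
    refine h0.mono_fun (measurableSet_near _ _) fun y hy => ?_
    have hy1 : |y| ≤ A := by
      have : |0 - y| ≤ A := hy
      simpa using this
    have h2 : |x| / 2 ≤ |x - y| := by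
      have := abs_sub_abs_le_abs_sub x y
      linarith
    rw [sub_zero, abs_div]
    calc |p y| / |x - y| ≤ C / (|x| / 2) := div_le_div₀ hC0 (hC y) (by linarith) h2
      _ = _ := by field_simp
  have h2 : LB (far 0 A) (fun y => |p y / (x - y) - 0|) 0 := by
    have h0 : LB (far 0 A) (fun _ => (0 : ℝ)) 0 := by simp [LB]
    refine h0.mono_fun (measurableSet_far _ _) fun y hy => ?_
    have hy1 : A < |y| := by
      have : A < |0 - y| := hy
      simpa using this
    simp [hs y hy1]
  have h3 := LB.univ_of h1 h2 (by positivity) le_rfl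
  have := hasPV_of_odd_add (aestronglyMeasurable_div_sub hp x) (hasPV_zero x)
    aestronglyMeasurable_const h3 (by positivity)
  simpa using this

/-- Decay of `T(x) = P.V. ∫ a(x, y)/(x - y) dy` when `a` vanishes unless `x` or `y` lies in a
compact set. -/
theorem exists_hasDecay {a : ℝ → ℝ → ℝ} {T : ℝ → ℝ} {B : ℝ} (hA : 1 ≤ A)
    (ha : ∀ x, AEStronglyMeasurable (a x) volume) (hC : ∀ x y, |a x y| ≤ C)
    (hs : ∀ x y, A < |x| → A < |y| → a x y = 0) (hB : ∀ x, |T x| ≤ B)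
    (hT : ∀ x, HasPV (fun y => a x y / (x - y)) x (T x)) : ∃ C', HasDecay C' T := by
  have hB0 : 0 ≤ B := (abs_nonneg _).trans (hB 0)
  have hC0 : 0 ≤ C := (abs_nonneg _).trans (hC 0 0)
  refine ⟨B * (1 + 2 * A) + 8 * A * C, fun x => ?_⟩
  rcases le_or_gt |x| (2 * A) with h | h
  · have := mul_le_mul (hB x) (by linarith : 1 + |x| ≤ 1 + 2 * A) (by positivity) hB0
    have : 0 ≤ 8 * A * C := by positivity
    linarith
  · obtain ⟨L, hL, hLb⟩ := hasPV_of_support (ha x) (hC x) (by linarith)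
      (fun y hy => hs x y (by linarith) hy) h
    rw [(hT x).unique hL]
    have hx0 : 0 < |x| := by linarith
    calc |L| * (1 + |x|) ≤ 4 * A * C / |x| * (2 * |x|) :=
          mul_le_mul hLb (by linarith) (by positivity) (by positivity)
      _ = 8 * A * C := by field_simp; ring
      _ ≤ _ := by
          have : 0 ≤ B * (1 + 2 * A) := by positivity
          linarith

theorem ModData.le_Omega (h : ModData ω Ω K) {s : ℝ} (hs : 0 < s) (hs1 : s ≤ 1) :
    ω s ≤ K * Ω s := by
  refine (h.comp s s hs hs1 le_rfl ?_).1
  refine Real.le_sqrt_of_sq_le ?_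
  nlinarith

theorem gain_nonneg (h : ModData ω Ω K) (d s : ℝ) : 0 ≤ gain Ω d s := by
  have := h.nonneg' d
  unfold gain
  split_ifs <;> positivity

theorem sqrt_div_mul_le_gain (h : ModData ω Ω K) {d s : ℝ} (hd : 0 < d) (hd1 : d ≤ 1)
    (hds : d ≤ s) : √(d / s) * ω s ≤ K * gain Ω d s := by
  have hK := h.K_pos
  unfold gain
  split_ifs with hs
  · calc √(d / s) * ω s ≤ √(d / s) * (K * Ω d) :=
          mul_le_mul_of_nonneg_left (h.comp d s hd hd1 hds hs).1 (Real.sqrt_nonneg _)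
      _ = _ := by ring
  · calc √(d / s) * ω s ≤ √(d / s) * K :=
          mul_le_mul_of_nonneg_left (h.le s) (Real.sqrt_nonneg _)
      _ = _ := by ring

theorem le_sqrt_self {t : ℝ} (ht0 : 0 ≤ t) (ht : t ≤ 1) : t ≤ √t := by
  refine Real.le_sqrt_of_sq_le ?_
  nlinarith

/-- The off-diagonal factor d/s is weakened to √(d/s), so that F satisfies the same variation bound
as its partial Hilbert transform. -/
theorem PreKernel.abs_sub_le_gain (hF : PreKernel ω C F) (h : ModData ω Ω K) {x x' z : ℝ}
    (hd : 0 < |x - x'|) (hd1 : |x - x'| ≤ 1) (hs : 2 * |x - x'| ≤ |x - z|) :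
    |F x z - F x' z| ≤ C * (K * gain Ω |x - x'| |x - z|) := by
  rw [abs_sub_comm]
  have hs0 : 0 < |x - z| := by linarith
  refine (hF.smooth x x' z hs0 hs).trans (mul_le_mul_of_nonneg_left ?_ hF.nonneg)
  refine le_trans (mul_le_mul_of_nonneg_right ?_ (h.nonneg _))
    (sqrt_div_mul_le_gain h hd hd1 (by linarith))
  exact le_sqrt_self (by positivity) (by rw [div_le_one hs0]; linarith)

/-- The kernel itself yields bilinear data. -/
theorem SymKernel.bilData (hF : SymKernel ω A C F) (h : ModData ω Ω K) (hg : HasMod ω C' g)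
    (hg' : HasDecay C' g) :
    BilData ω Ω (3 * C * K + 3 * C') g (fun x => F x x) F := by
  have h0 := hF.nonneg
  have h0' := hg.nonneg
  have hK := h.K_pos
  have hCK : C ≤ C * K := le_mul_of_one_le_right h0 h.one_le
  refine ⟨hg.mono h (by nlinarith), hF.hasMod_diag.mono h (by linarith),
    fun x z => (hF.bdd x z).trans (by linarith),
    fun x => ((hF.hasMod_right x).continuous h).aestronglyMeasurable, fun x z hxz h1 => ?_,
    fun x => (lb_far_of_decay (w := x) x fun y => hF.decay x y).mono_const (by linarith),
    fun x => (hg'.lb_far x).mono_const (by nlinarith), fun x x' z hd hd1 hs => ?_⟩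
  · have hp : 0 < |x - z| := abs_pos.mpr (sub_ne_zero.mpr hxz)
    calc |F x x - F x z| ≤ C * ω |x - z| := (hF.hasMod_right x).diff x z
      _ ≤ C * (K * Ω |x - z|) := mul_le_mul_of_nonneg_left (h.le_Omega hp h1) h0
      _ = C * K * Ω |x - z| := by ring
      _ ≤ _ := mul_le_mul_of_nonneg_right (by nlinarith) (h.nonneg' _)
  · refine (hF.abs_sub_le_gain h hd (by linarith) (by linarith)).trans ?_
    rw [← mul_assoc]
    exact mul_le_mul_of_nonneg_right (by nlinarith) (gain_nonneg h _ _)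

/-- Products of functions yield bilinear data. -/
theorem bilData_mul (h : ModData ω Ω K) (hg : HasMod ω C g) (hg' : HasDecay C g) {k : ℝ → ℝ}
    (hk : HasMod ω C' k) (hk' : HasDecay C' k) :
    BilData ω Ω (3 * C + 3 * C' * K) g k (fun _ z => k z) := by
  have h0 := hg.nonneg
  have h0' := hk.nonneg
  have hK := h.K_pos
  have hCK : C' ≤ C' * K := le_mul_of_one_le_right h0' h.one_le
  refine ⟨hg.mono h (by linarith), hk.mono h (by linarith),
    fun x z => (hk.bdd z).trans (by linarith),
    fun x => (hk.continuous h).aestronglyMeasurable, fun x z hxz h1 => ?_,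
    fun x => (hk'.lb_far x).mono_const (by linarith),
    fun x => (hg'.lb_far x).mono_const (by linarith), fun x x' z hd hd1 hs => ?_⟩
  · have hp : 0 < |x - z| := abs_pos.mpr (sub_ne_zero.mpr hxz)
    calc |k x - k z| ≤ C' * ω |x - z| := hk.diff x z
      _ ≤ C' * (K * Ω |x - z|) := mul_le_mul_of_nonneg_left (h.le_Omega hp h1) h0'
      _ = C' * K * Ω |x - z| := by ring
      _ ≤ _ := mul_le_mul_of_nonneg_right (by linarith) (h.nonneg' _)
  · rw [sub_self, abs_zero]
    exact mul_nonneg (by positivity) (gain_nonneg h _ _)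

/-! ### Difference quotients -/

/-- The difference quotient, extended by the derivative to the diagonal. -/
noncomputable def dq (g : ℝ → ℝ) (x y : ℝ) : ℝ := if x = y then deriv g x else diffQuot g x y

theorem dq_of_ne {x y : ℝ} (hxy : x ≠ y) : dq g x y = diffQuot g x y := if_neg hxy

theorem dq_self (x : ℝ) : dq g x x = deriv g x := if_pos rfl

theorem dq_symm (x y : ℝ) : dq g x y = dq g y x := by
  rcases eq_or_ne x y with rfl | hxy
  · rfl
  · rw [dq_of_ne hxy, dq_of_ne hxy.symm, diffQuot, diffQuot, ← neg_div_neg_eq]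
    congr 1 <;> ring

theorem dq_mul (x y : ℝ) : dq g x y * (x - y) = g x - g y := by
  rcases eq_or_ne x y with rfl | hxy
  · simp
  · rw [dq_of_ne hxy, diffQuot, div_mul_cancel₀ _ (sub_ne_zero.mpr hxy)]

/-- Stands in for the representation of the quotient as ∫₀¹ g'(z + t(y-z)) dt: with a primitive in t
the mean value inequality applies directly, and the diagonal is included. -/
theorem exists_path_dq (hg : Differentiable ℝ g) (y z : ℝ) :
    ∃ ψ : ℝ → ℝ, (∀ t, HasDerivAt ψ (deriv g (z + t * (y - z))) t) ∧ ψ 1 - ψ 0 = dq g y z := by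
  rcases eq_or_ne y z with rfl | hyz
  · refine ⟨fun t => t * deriv g y, fun t => ?_, ?_⟩
    · simpa using (hasDerivAt_id t).mul_const (deriv g y)
    · simp [dq_self]
  · have hne : y - z ≠ 0 := sub_ne_zero.mpr hyz
    refine ⟨fun t => g (z + t * (y - z)) / (y - z), fun t => ?_, ?_⟩
    · have h1 : HasDerivAt (fun t => z + t * (y - z)) (y - z) t := by
        simpa using ((hasDerivAt_id t).mul_const (y - z)).const_add z
      have h2 := ((hg (z + t * (y - z))).hasDerivAt.comp t h1).div_const (y - z)
      rwa [mul_div_cancel_right₀ _ hne] at h2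
    · rw [dq_of_ne hyz, diffQuot]
      simp only [one_mul, zero_mul, add_zero, add_sub_cancel]
      rw [sub_div]

/-- Bound and modulus follow by averaging g' along segments. Off the diagonal, Q(y,z) - Q(x,z) =
(y-x)/(y-z) · (Q(y,x) - Q(z,x)) shows the gain: the second factor is O(ω(|z-y|)), and |y-z| is
comparable to |x-z|. -/
theorem preKernel_dq (h : ModData ω Ω K) (hg : Differentiable ℝ g)
    (hg' : HasMod ω C (deriv g)) : PreKernel ω (2 * C * K) (dq g) := by
  have h0 := hg'.nonneg
  have hK := h.one_le
  have hCK : C ≤ C * K := le_mul_of_one_le_right h0 hK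
  have hbd : ∀ x z, |dq g x z| ≤ C := by
    intro x z
    obtain ⟨ψ, h1, h2⟩ := exists_path_dq hg x z
    have := norm_image_sub_le_of_norm_deriv_le_segment_01' (f := ψ) (C := C)
      (fun t _ => (h1 t).hasDerivWithinAt) fun t _ => hg'.bdd _
    rwa [h2] at this
  have hhol : ∀ x y z, |dq g y z - dq g x z| ≤ C * ω |x - y| := by
    intro x y z
    obtain ⟨ψ, h1, h2⟩ := exists_path_dq hg y z
    obtain ⟨χ, k1, k2⟩ := exists_path_dq hg x z
    have := norm_image_sub_le_of_norm_deriv_le_segment_01' (f := fun t => ψ t - χ t)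
      (C := C * ω |x - y|) (fun t _ => ((h1 t).sub (k1 t)).hasDerivWithinAt) fun t ht => ?_
    · rw [Real.norm_eq_abs] at this
      rw [← h2, ← k2]
      refine le_trans (le_of_eq ?_) this
      congr 1; ring
    · refine (hg'.diff _ _).trans (mul_le_mul_of_nonneg_left (h.mono ?_) h0)
      have : z + t * (y - z) - (z + t * (x - z)) = t * (y - x) := by ring
      rw [this, abs_mul, abs_of_nonneg ht.1, abs_sub_comm]
      exact mul_le_of_le_one_left (abs_nonneg _) ht.2.le
  refine ⟨dq_symm, fun x z => (hbd x z).trans (by linarith), fun x y z => (hhol x y z).trans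
    (mul_le_mul_of_nonneg_right (by linarith) (h.nonneg _)), fun x y z hs hxy => ?_⟩
  have hyz : |x - z| ≤ |y - z| + |x - y| := by
    calc |x - z| = |(y - z) + (x - y)| := by congr 1; ring
      _ ≤ _ := abs_add_le _ _
  have hyz' : |z - y| ≤ 2 * |x - z| := by
    calc |z - y| = |(x - y) - (x - z)| := by congr 1; ring
      _ ≤ |x - y| + |x - z| := abs_sub _ _
      _ ≤ _ := by linarith
  have hp : 0 < |y - z| := by linarith
  have hne : y - z ≠ 0 := abs_pos.mp hp
  have hid : dq g y z - dq g x z = (y - x) / (y - z) * (dq g y x - dq g z x) := by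
    rw [div_mul_eq_mul_div, eq_div_iff hne, sub_mul, dq_mul]
    have e1 := dq_mul (g := g) x z
    have e2 := dq_mul (g := g) y x
    rw [dq_symm z x]
    linear_combination -e1 - e2
  rw [hid, abs_mul, abs_div, abs_sub_comm y x]
  have h3 : |dq g y x - dq g z x| ≤ C * (K * ω |x - z|) := by
    refine (hhol z y x).trans (mul_le_mul_of_nonneg_left ?_ h0)
    exact (h.mono hyz').trans (h.double _ (abs_nonneg _))
  have h4 : |x - y| / |y - z| ≤ 2 * (|x - y| / |x - z|) := by
    rw [← mul_div_assoc, div_le_div_iff₀ hp hs]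
    nlinarith [abs_nonneg (x - y)]
  calc |x - y| / |y - z| * |dq g y x - dq g z x|
      ≤ 2 * (|x - y| / |x - z|) * (C * (K * ω |x - z|)) :=
        mul_le_mul h4 h3 (abs_nonneg _) (by positivity)
    _ = _ := by ring

/-- The continuous version of `prodQuot`. -/
noncomputable def dqProd {l : ℕ} (f : Fin l → ℝ → ℝ) (n : Fin l → ℕ) (x y : ℝ) : ℝ :=
  ∏ k, dq (f k) x y ^ n k

theorem dqProd_of_ne {l : ℕ} (f : Fin l → ℝ → ℝ) (n : Fin l → ℕ) {x y : ℝ} (hxy : x ≠ y) :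
    dqProd f n x y = prodQuot f n x y := by
  simp only [dqProd, prodQuot, dq_of_ne hxy]

theorem prod_pow_lower {l : ℕ} (a : Fin l → ℝ) (n : Fin l → ℕ) (k : Fin l) (hk : n k ≠ 0) :
    ∏ i, a i ^ n i = a k * ∏ i, a i ^ lower n k i := by
  rw [← Finset.mul_prod_erase _ _ (Finset.mem_univ k),
    ← Finset.mul_prod_erase _ (fun i => a i ^ lower n k i) (Finset.mem_univ k)]
  have h1 : ∀ i ∈ Finset.univ.erase k, a i ^ lower n k i = a i ^ n i := by
    intro i hi
    rw [lower, Function.update_of_ne (Finset.ne_of_mem_erase hi)]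
  rw [Finset.prod_congr rfl h1, lower, Function.update_self, ← mul_assoc, ← pow_succ',
    Nat.sub_add_cancel (Nat.one_le_iff_ne_zero.mpr hk)]

theorem dqProd_lower {l : ℕ} (f : Fin l → ℝ → ℝ) (n : Fin l → ℕ) (k : Fin l) (hk : n k ≠ 0)
    (x y : ℝ) : dqProd f n x y = dq (f k) x y * dqProd f (lower n k) x y :=
  prod_pow_lower _ n k hk

theorem exists_preKernel_dqProd {l : ℕ} {f : Fin l → ℝ → ℝ} (h : ModData ω Ω K)
    (hf : ∀ k, Differentiable ℝ (f k)) (hf' : ∀ k, ∃ C, HasMod ω C (deriv (f k)))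
    (n : Fin l → ℕ) : ∃ C, PreKernel ω C (dqProd f n) :=
  exists_preKernel_prod h Finset.univ (F := fun k x z => dq (f k) x z ^ n k) fun k => by
    obtain ⟨C, hC⟩ := hf' k
    exact (preKernel_dq h (hf k) hC).exists_pow h (n k)

theorem deriv_eq_zero_of_support (hs : ∀ x, A < |x| → g x = 0) {x : ℝ} (hx : A < |x|) :
    deriv g x = 0 := by
  have h1 : g =ᶠ[𝓝 x] fun _ => 0 := by
    have : IsOpen {y : ℝ | A < |y|} := isOpen_lt continuous_const continuous_abs
    filter_upwards [this.mem_nhds hx] with y hy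
    exact hs y hy
  rw [h1.deriv_eq, deriv_const]

/-- One factor with nonzero exponent suffices: (x-z)Q(x,z) = f_k(x) - f_k(z) is bounded, which gives
the decay, and Q vanishes when both arguments lie outside the support. -/
theorem exists_symKernel_dqProd {l : ℕ} {f : Fin l → ℝ → ℝ} (h : ModData ω Ω K)
    (hf : ∀ k, Differentiable ℝ (f k)) (hfb : ∀ k, ∃ B, ∀ x, |f k x| ≤ B)
    (hf' : ∀ k, ∃ C, HasMod ω C (deriv (f k)))
    (hs : ∀ k x, A < |x| → f k x = 0) (n : Fin l → ℕ) (hn : n ≠ 0) :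
    ∃ C, SymKernel ω A C (dqProd f n) := by
  obtain ⟨k, hk⟩ := Function.ne_iff.mp hn
  have hk : n k ≠ 0 := hk
  obtain ⟨C₁, h1⟩ := exists_preKernel_dqProd h hf hf' n
  obtain ⟨C₂, h2⟩ := exists_preKernel_dqProd h hf hf' (lower n k)
  obtain ⟨B, hB⟩ := hfb k
  have hB0 : 0 ≤ B := (abs_nonneg _).trans (hB 0)
  have h10 := h1.nonneg
  have h20 := h2.nonneg
  have hBC : 0 ≤ 2 * B * C₂ := by positivity
  refine ⟨C₁ + 2 * B * C₂, h1.mono h (by linarith), fun x z => ?_, fun x z hx hz => ?_⟩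
  · rw [mul_add, mul_one]
    refine add_le_add (h1.bdd x z) ?_
    rw [dqProd_lower f n k hk, abs_mul, mul_right_comm, ← abs_mul, dq_mul]
    refine mul_le_mul ?_ (h2.bdd x z) (abs_nonneg _) (by linarith)
    exact (abs_sub _ _).trans (by linarith [hB x, hB z])
  · have : dq (f k) x z = 0 := by
      rcases eq_or_ne x z with rfl | hxz
      · rw [dq_self, deriv_eq_zero_of_support (hs k) hx]
      · rw [dq_of_ne hxz, diffQuot, hs k x hx, hs k z hz, sub_zero, zero_div]
    rw [dqProd_lower f n k hk, this, zero_mul]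

end

end CriticalHilbert

namespace CriticalHilbert

/-! ### The partial Hilbert transform of a symmetric kernel -/

/-- `p` is, up to a constant near `x`, absolutely integrable against `1 / (x - y)`, with bound
`c`. -/
def PVBound (p : ℝ → ℝ) (x c : ℝ) : Prop :=
  ∃ ρ k a b, LB (near x ρ) (fun y => |p y - k| / |x - y|) a ∧
    LB (far x ρ) (fun y => |p y| / |x - y|) b ∧ 0 ≤ a ∧ 0 ≤ b ∧ a + b ≤ c

theorem PVBound.mono {p : ℝ → ℝ} {x c c' : ℝ} (hb : PVBound p x c) (hc : c ≤ c') :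
    PVBound p x c' := by
  obtain ⟨ρ, k, a, b, h1, h2, h3, h4, h5⟩ := hb
  exact ⟨ρ, k, a, b, h1, h2, h3, h4, h5.trans hc⟩

theorem PVBound.abs_le {p : ℝ → ℝ} {x c L : ℝ} (hb : PVBound p x c)
    (hp : AEStronglyMeasurable p volume) (hL : HasPV (fun y => p y / (x - y)) x L) :
    |L| ≤ c := by
  obtain ⟨ρ, k, a, b, h1, h2, h3, h4, h5⟩ := hb
  exact (hL.abs_le hp h1 (c₂ := 0) (by simpa only [sub_zero] using h2) h3 h4).trans h5

theorem HasMod.pvBound {ω Ω : ℝ → ℝ} {K C c : ℝ} {g : ℝ → ℝ} (hg : HasMod ω C g)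
    (h : ModData ω Ω K) {x : ℝ} (hc : 0 ≤ c)
    (hfar : LB (far x 1) (fun y => |g y| / |x - y|) c) : PVBound g x (2 * C * K + c) := by
  have hC := hg.nonneg
  refine ⟨1, g x, C * (2 * Ω 1), c, hg.lb_near h x le_rfl, hfar,
    mul_nonneg hC (by linarith [h.nonneg' 1]), hc, ?_⟩
  have := mul_le_mul_of_nonneg_left (h.le' 1) hC
  linarith

section

variable {ω Ω : ℝ → ℝ} {K C C' A : ℝ} {F : ℝ → ℝ → ℝ} {P : ℝ → ℝ → ℝ}

theorem integrableOn_far_div {p : ℝ → ℝ} {x B c ε : ℝ} (hp : AEStronglyMeasurable p volume)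
    (hB : ∀ y, |p y| ≤ B) (hfar : LB (far x 1) (fun y => |p y| / |x - y|) c) (hε : 0 < ε) :
    IntegrableOn (fun y => p y / (x - y)) (far x ε) := by
  have hm := aestronglyMeasurable_div_sub hp x
  have h1 : IntegrableOn (fun y => p y / (x - y)) (far x 1) :=
    LB.integrableOn (c := c) (by simpa only [abs_div] using hfar) hm.restrict
  have h2 : IntegrableOn (fun y => p y / (x - y)) (far x ε ∩ near x 1) := by
    refine Measure.integrableOn_of_bounded (M := B / ε)
      ((measure_mono Set.inter_subset_right).trans_lt (volume_near_lt_top x 1)).ne hm ?_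
    refine (ae_restrict_iff' ((measurableSet_far _ _).inter (measurableSet_near _ _))).mpr
      (Eventually.of_forall fun y hy => ?_)
    rw [Real.norm_eq_abs, abs_div]
    exact div_le_div₀ ((abs_nonneg _).trans (hB 0)) (hB y) hε (le_of_lt hy.1)
  exact (h2.union h1).mono_set (far_subset_union x ε 1)

theorem SymKernel.integrableOn_far (hF : SymKernel ω A C F) (h : ModData ω Ω K) (x z : ℝ) {ε : ℝ}
    (hε : 0 < ε) : IntegrableOn (fun y => F y z / (x - y)) (far x ε) :=
  integrableOn_far_div ((hF.hasMod_left z).continuous h).aestronglyMeasurable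
    (fun y => hF.bdd y z) (hF.lb_far x z) hε

theorem SymKernel.exists_partial (hF : SymKernel ω A C F) (h : ModData ω Ω K) (x z : ℝ) :
    ∃ L, HasPV (fun y => F y z / (x - y)) x L ∧ |L| ≤ 2 * C * K + C * 3 :=
  (hF.hasMod_left z).exists_hasPV h (mul_nonneg hF.nonneg (by norm_num)) (hF.lb_far x z)

theorem SymKernel.abs_partial_le (hF : SymKernel ω A C F) (h : ModData ω Ω K)
    (hP : ∀ x z, HasPV (fun y => F y z / (x - y)) x (P x z)) (x z : ℝ) :
    |P x z| ≤ 5 * C * K := by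
  obtain ⟨L, hL, hLb⟩ := hF.exists_partial h x z
  rw [(hP x z).unique hL]
  have : C ≤ C * K := le_mul_of_one_le_right hF.nonneg h.one_le
  linarith

/-- A pointwise limit of truncated integrals, each measurable in the parameter because F is jointly
continuous. -/
theorem SymKernel.measurable_partial (hF : SymKernel ω A C F) (h : ModData ω Ω K)
    (hP : ∀ x z, HasPV (fun y => F y z / (x - y)) x (P x z)) (x : ℝ) : Measurable (P x) := by
  have hε : ∀ m : ℕ, (0 : ℝ) < 1 / ((m : ℝ) + 1) := fun m => by positivity
  have hlim : Tendsto (fun m : ℕ => 1 / ((m : ℝ) + 1)) atTop (𝓝[>] 0) :=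
    tendsto_nhdsWithin_iff.mpr ⟨tendsto_one_div_add_atTop_nhds_zero_nat,
      Eventually.of_forall hε⟩
  have hc : Measurable fun q : ℝ × ℝ => F q.2 q.1 / (x - q.2) := by
    have h1 : Continuous fun q : ℝ × ℝ => F q.2 q.1 :=
      (hF.toPreKernel.continuous h).comp continuous_swap
    exact h1.measurable.div (by fun_prop)
  refine measurable_of_tendsto_metrizable
    (f := fun (m : ℕ) z => ∫ y in far x (1 / ((m : ℝ) + 1)), F y z / (x - y)) (fun m => ?_) ?_
  · exact (hc.stronglyMeasurable.integral_prod_right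
      (ν := volume.restrict (far x (1 / ((m : ℝ) + 1))))).measurable
  · rw [tendsto_pi_nhds]
    intro z
    exact ((hP x z).tendsto_setIntegral_far fun ε hε => hF.integrableOn_far h x z hε).comp hlim

/-- The numerator F(y,x) - F(y,z) is estimated with s = |x-z|: for |x-y| ≤ 2s by the modulus of F,
which costs Ω instead of ω; beyond, by the off-diagonal gain s/|x-y|, divided at √s. For s > 1/4
boundedness is enough. -/
theorem SymKernel.partial_diag (hF : SymKernel ω A C F) (h : ModData ω Ω K)
    (hP : ∀ x z, HasPV (fun y => F y z / (x - y)) x (P x z)) {x z : ℝ} (hxz : x ≠ z)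
    (h1 : |x - z| ≤ 1) :
    |P x x - P x z| ≤ (10 * C * K ^ 3 + 10 * C * K / Ω (1 / 4)) * Ω |x - z| := by
  have h0 := hF.nonneg
  have hK := h.K_pos
  have hK1 := h.one_le
  set s := |x - z| with hs_def
  have hs : 0 < s := abs_pos.mpr (sub_ne_zero.mpr hxz)
  have hΩs := h.nonneg' s
  have hΩ4 : 0 < Ω (1 / 4) := by
    have e1 := h.le_Omega (s := 1 / 4) (by norm_num) (by norm_num)
    have e2 := h.pos (1 / 4) (by norm_num)
    by_contra hcon
    have : K * Ω (1 / 4) ≤ 0 := mul_nonpos_of_nonneg_of_nonpos hK.le (not_lt.mp hcon)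
    linarith
  rcases le_or_gt s (1 / 4) with h2 | h2
  · have hsd : 0 < √s := Real.sqrt_pos.mpr hs
    have h2s : 2 * s ≤ √s := by
      refine Real.le_sqrt_of_sq_le ?_; nlinarith
    have hG := (hP x x).sub (hP x z)
    have hG' : HasPV (fun y => (F y x - F y z) / (x - y)) x (P x x - P x z) := by
      simpa only [sub_div] using hG
    have hmod : HasMod ω (C + C) fun y => F y x - F y z := by
      have := (hF.hasMod_left x).add ((hF.hasMod_left z).const_mul (-1))
      simpa [sub_eq_add_neg] using this
    have e1 := hmod.lb_near h x (r := 2 * s) (by linarith)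
    have e2 : LB (far x (2 * s)) (fun y => |F y x - F y z - 0| / |x - y|)
        (C * s * (K * Ω s) * (2 / (2 * s)) + C * s * K * (2 / √s)) := by
      have hpt : ∀ y, 2 * s < |x - y| → |F y x - F y z - 0| / |x - y|
          ≤ C * s * ω |x - y| * (1 / |x - y| ^ 2) := by
        intro y hy
        have hy0 : 0 < |x - y| := by linarith
        rw [sub_zero, hF.symm y x, hF.symm y z, abs_sub_comm]
        have := hF.smooth x z y hy0 hy.le
        calc |F z y - F x y| / |x - y| ≤ C * (s / |x - y| * ω |x - y|) / |x - y| :=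
              div_le_div_of_nonneg_right this hy0.le
          _ = _ := by field_simp
      refine LB.mono_set ?_ (far_subset_union x (2 * s) (√s))
      refine LB.union ?_ ?_ (by positivity) (by positivity)
      · refine (((lb_far_inv_sq x (ρ := 2 * s) (by linarith)).const_mul
          (a := C * s * (K * Ω s)) (by positivity)).mono_set Set.inter_subset_left).mono_fun
          ((measurableSet_far _ _).inter (measurableSet_near _ _)) fun y hy => ?_
        have hy1 : 2 * s < |x - y| := hy.1
        have hy2 : |x - y| ≤ √s := hy.2
        refine (hpt y hy1).trans (mul_le_mul_of_nonneg_right ?_ (by positivity))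
        exact mul_le_mul_of_nonneg_left (h.comp s _ hs h1 (by linarith) hy2).1 (by positivity)
      · refine ((lb_far_inv_sq x hsd).const_mul (a := C * s * K) (by positivity)).mono_fun
          (measurableSet_far _ _) fun y hy => ?_
        have hy1 : √s < |x - y| := hy
        refine (hpt y (by linarith)).trans (mul_le_mul_of_nonneg_right ?_ (by positivity))
        exact mul_le_mul_of_nonneg_left (h.le _) (by positivity)
    have h3 := hG'.abs_le (hmod.continuous h).aestronglyMeasurable e1 e2
      (mul_nonneg (by linarith) (by linarith [h.nonneg' (2 * s)])) (by positivity)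
    refine h3.trans ?_
    have t1 : C * s * (K * Ω s) * (2 / (2 * s)) = C * K * Ω s := by field_simp
    have t2 : C * s * K * (2 / √s) = 2 * C * K * √s := by
      have : s / √s = √s := Real.div_sqrt
      calc _ = 2 * C * K * (s / √s) := by ring
        _ = _ := by rw [this]
    have t3 : √s ≤ K * (K * Ω s) := by
      calc √s ≤ √√s := sqrt_le_sqrt_sqrt h1
        _ ≤ K * ω s := h.pow s hs h1
        _ ≤ K * (K * Ω s) := mul_le_mul_of_nonneg_left (h.le_Omega hs h1) hK.le
    have t4 : Ω (2 * s) ≤ K * Ω s := (h.comp s (2 * s) hs h1 (by linarith) h2s).2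
    rw [t1, t2]
    have hK3 : K ≤ K ^ 3 := by nlinarith [mul_nonneg (sub_nonneg.mpr hK1) hK.le]
    have q1 : C * (K * Ω s) ≤ C * K ^ 3 * Ω s := by
      calc C * (K * Ω s) = K * (C * Ω s) := by ring
        _ ≤ K ^ 3 * (C * Ω s) := mul_le_mul_of_nonneg_right hK3 (by positivity)
        _ = _ := by ring
    have q2 : (C + C) * (2 * Ω (2 * s)) ≤ 4 * (C * K ^ 3 * Ω s) := by
      calc (C + C) * (2 * Ω (2 * s)) = 4 * (C * Ω (2 * s)) := by ring
        _ ≤ 4 * (C * (K * Ω s)) := by gcongr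
        _ ≤ _ := by linarith
    have q3 : 2 * C * K * √s ≤ 2 * (C * K ^ 3 * Ω s) := by
      calc 2 * C * K * √s ≤ 2 * C * K * (K * (K * Ω s)) :=
            mul_le_mul_of_nonneg_left t3 (by positivity)
        _ = _ := by ring
    have q4 : 0 ≤ 10 * C * K / Ω (1 / 4) * Ω s := by positivity
    have q5 : 0 ≤ C * K ^ 3 * Ω s := by positivity
    calc _ ≤ 10 * (C * K ^ 3 * Ω s) := by linarith
      _ ≤ _ := by rw [add_mul]; linarith
  · have e1 := hF.abs_partial_le h hP x x
    have e2 := hF.abs_partial_le h hP x z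
    calc |P x x - P x z| ≤ |P x x| + |P x z| := abs_sub _ _
      _ ≤ 10 * C * K := by linarith
      _ = 10 * C * K / Ω (1 / 4) * Ω (1 / 4) := by field_simp
      _ ≤ 10 * C * K / Ω (1 / 4) * Ω s :=
          mul_le_mul_of_nonneg_left (h.mono' h2.le) (by positivity)
      _ ≤ _ := mul_le_mul_of_nonneg_right (by
          have : 0 ≤ 10 * C * K ^ 3 := by positivity
          linarith) hΩs

theorem lb_one_add_rpow (w : ℝ) :
    LB Set.univ (fun z => (1 + |w - z|) ^ (-1 - 1 / 2 : ℝ)) 6 := by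
  have h1 : LB (near w 1) (fun z => (1 + |w - z|) ^ (-1 - 1 / 2 : ℝ)) 2 := by
    have h0 : LB (near w 1) (fun _ => (1 : ℝ)) 2 := by
      unfold LB
      rw [near_eq_Icc, setLIntegral_const, Real.volume_Icc, ENNReal.ofReal_one, one_mul]
      apply ENNReal.ofReal_le_ofReal; linarith
    refine h0.mono_fun (measurableSet_near _ _) fun z _ => ?_
    exact Real.rpow_le_one_of_one_le_of_nonpos (by linarith [abs_nonneg (w - z)]) (by norm_num)
  have h2 : LB (far w 1) (fun z => (1 + |w - z|) ^ (-1 - 1 / 2 : ℝ)) 4 := by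
    refine ((lb_far_rpow w one_pos (a := 1 / 2) (by norm_num)).mono_const (by norm_num)).mono_fun
      (measurableSet_far _ _) fun z hz => ?_
    have : 1 < |w - z| := hz
    exact Real.rpow_le_rpow_of_nonpos (by linarith) (by linarith) (by norm_num)
  exact (LB.univ_of h1 h2 (by norm_num) (by norm_num)).mono_const (by norm_num)

/-- From (a-1)(b-1) ≥ 0 one gets ab ≥ a + b - 1 ≥ s, so a quarter power of ab is traded for decay in
s; the remaining (ab)^(-3/4) splits by AM–GM into two integrable powers. -/
theorem one_div_mul_le_rpow {a b s : ℝ} (ha : 1 ≤ a) (hb : 1 ≤ b) (hs : 1 ≤ s)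
    (hab : s + 1 ≤ a + b) :
    1 / a / b ≤ s ^ (-(1 / 4) : ℝ) * (a ^ (-1 - 1 / 2 : ℝ) + b ^ (-1 - 1 / 2 : ℝ)) := by
  have ha0 : 0 < a := by linarith
  have hb0 : 0 < b := by linarith
  have hab' : s ≤ a * b := by nlinarith
  have h1 : (a * b) ^ (-(1 / 4) : ℝ) ≤ s ^ (-(1 / 4) : ℝ) :=
    Real.rpow_le_rpow_of_nonpos (by linarith) hab' (by norm_num)
  have h2 : 1 / a / b = (a * b) ^ (-(1 / 4) : ℝ) * (a ^ (-(3 / 4) : ℝ) * b ^ (-(3 / 4) : ℝ)) := by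
    rw [← Real.mul_rpow ha0.le hb0.le, ← Real.rpow_add (by positivity), div_div]
    norm_num
    rw [Real.rpow_neg_one, mul_inv, mul_comm]
  have h3 : a ^ (-(3 / 4) : ℝ) * b ^ (-(3 / 4) : ℝ) ≤ a ^ (-1 - 1 / 2 : ℝ) + b ^ (-1 - 1 / 2 : ℝ) := by
    have e : ∀ t : ℝ, 0 < t → t ^ (-1 - 1 / 2 : ℝ) = (t ^ (-(3 / 4) : ℝ)) ^ 2 := by
      intro t ht
      rw [← Real.rpow_natCast, ← Real.rpow_mul ht.le]; norm_num
    rw [e a ha0, e b hb0]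
    nlinarith [sq_nonneg (a ^ (-(3 / 4) : ℝ) - b ^ (-(3 / 4) : ℝ)),
      sq_nonneg (a ^ (-(3 / 4) : ℝ)), sq_nonneg (b ^ (-(3 / 4) : ℝ))]
  rw [h2]
  exact mul_le_mul h1 h3 (by positivity) (by positivity)

theorem SymKernel.pvBound (hF : SymKernel ω A C F) (h : ModData ω Ω K) (x z : ℝ) :
    PVBound (fun y => F y z) x (5 * C * K) := by
  refine ((hF.hasMod_left z).pvBound h (mul_nonneg hF.nonneg (by norm_num))
    (hF.lb_far x z)).mono ?_
  have : C ≤ C * K := le_mul_of_one_le_right hF.nonneg h.one_le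
  linarith

/-- The partial transform inherits only a fractional power of the decay of F, but any positive power
makes it integrable against 1/|x-z|. Within distance 1 of x the smoothness of F(·, z) is used,
beyond it the decay about z. -/
theorem SymKernel.pvBound_far (hF : SymKernel ω A C F) (h : ModData ω Ω K) {x z : ℝ}
    (h1 : 1 < |x - z|) :
    PVBound (fun y => F y z) x (20 * C * K * |x - z| ^ (-(1 / 4) : ℝ)) := by
  have h0 := hF.nonneg
  have hK := h.K_pos
  have hCK : C ≤ C * K := le_mul_of_one_le_right h0 h.one_le
  set s := |x - z| with hs_def
  have hs0 : 0 < s := by linarith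
  have hsp : 0 < s ^ (-(1 / 4) : ℝ) := Real.rpow_pos_of_pos hs0 _
  rcases le_or_gt 2 s with h2 | h2
  · have hinv : 1 / s ≤ s ^ (-(1 / 4) : ℝ) := by
      rw [one_div, ← Real.rpow_neg_one]
      exact Real.rpow_le_rpow_of_exponent_le h1.le (by norm_num)
    have e1 : LB (near x 1) (fun y => |F y z - F x z| / |x - y|) (2 * (C * K * (1 / s))) := by
      have hc : LB (near x 1) (fun _ => C * K * (1 / s)) (2 * (C * K * (1 / s))) := by
        unfold LB
        rw [near_eq_Icc, setLIntegral_const, Real.volume_Icc, ← ENNReal.ofReal_mul (by positivity)]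
        apply ENNReal.ofReal_le_ofReal
        exact le_of_eq (by ring)
      refine hc.mono_fun_ae (measurableSet_near _ _) x fun y hy hyx => ?_
      have hy1 : |x - y| ≤ 1 := hy
      have hy0 : 0 < |x - y| := abs_pos.mpr (sub_ne_zero.mpr hyx.symm)
      have := hF.smooth x y z hs0 (by linarith)
      rw [div_le_iff₀ hy0]
      calc |F y z - F x z| ≤ C * (|x - y| / s * ω s) := this
        _ ≤ C * (|x - y| / s * K) := by
            gcongr; exact h.le _
        _ = _ := by ring
    have e2 : LB (far x 1) (fun y => |F y z| / |x - y|)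
        (C * s ^ (-(1 / 4) : ℝ) * (6 + 4)) := by
      have k1 := (lb_one_add_rpow z).mono_set (Set.subset_univ (far x 1))
      have k2 := lb_far_rpow x one_pos (a := 1 / 2) (by norm_num)
      have k3 := (k1.add (k2.mono_const (c' := 4) (by norm_num)) (by fun_prop) (by norm_num)
        (by norm_num)).const_mul (a := C * s ^ (-(1 / 4) : ℝ)) (by positivity)
      refine k3.mono_fun (measurableSet_far _ _) fun y hy => ?_
      have hy1 : 1 < |x - y| := hy
      have hd := hF.decay z y
      have ha : 1 ≤ 1 + |z - y| := by linarith [abs_nonneg (z - y)]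
      have hab : s + 1 ≤ 1 + |z - y| + |x - y| := by
        have : s ≤ |x - y| + |z - y| := by
          calc s = |(x - y) - (z - y)| := by rw [hs_def]; congr 1; ring
            _ ≤ _ := abs_sub _ _
        linarith
      have key := one_div_mul_le_rpow ha hy1.le h1.le hab
      rw [hF.symm y z]
      calc |F z y| / |x - y| ≤ (C * (1 / (1 + |z - y|))) / |x - y| := by
            refine div_le_div_of_nonneg_right ?_ (abs_nonneg _)
            rw [mul_one_div, le_div_iff₀ (by linarith)]
            exact hd
        _ = C * (1 / (1 + |z - y|) / |x - y|) := by ring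
        _ ≤ C * (s ^ (-(1 / 4) : ℝ) * ((1 + |z - y|) ^ (-1 - 1 / 2 : ℝ)
            + |x - y| ^ (-1 - 1 / 2 : ℝ))) := mul_le_mul_of_nonneg_left key h0
        _ = _ := by ring
    refine ⟨1, F x z, _, _, e1, e2, by positivity, by positivity, ?_⟩
    have q1 : C * K * (1 / s) ≤ C * K * s ^ (-(1 / 4) : ℝ) :=
      mul_le_mul_of_nonneg_left hinv (by positivity)
    have q2 : C * s ^ (-(1 / 4) : ℝ) ≤ C * K * s ^ (-(1 / 4) : ℝ) :=
      mul_le_mul_of_nonneg_right hCK hsp.le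
    nlinarith [mul_nonneg (mul_nonneg h0 hK.le) hsp.le]
  · refine (hF.pvBound h x z).mono ?_
    have : (1 / 2 : ℝ) ≤ s ^ (-(1 / 4) : ℝ) := by
      calc (1 / 2 : ℝ) = (2 : ℝ) ^ (-1 : ℝ) := by rw [Real.rpow_neg_one]; norm_num
        _ ≤ (2 : ℝ) ^ (-(1 / 4) : ℝ) := Real.rpow_le_rpow_of_exponent_le (by norm_num) (by norm_num)
        _ ≤ _ := Real.rpow_le_rpow_of_nonpos hs0 h2.le (by norm_num)
    have hCK0 : 0 ≤ C * K := by positivity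
    nlinarith

theorem SymKernel.partial_far (hF : SymKernel ω A C F) (h : ModData ω Ω K)
    (hP : ∀ x z, HasPV (fun y => F y z / (x - y)) x (P x z)) {x z : ℝ} (h1 : 1 < |x - z|) :
    |P x z| ≤ 20 * C * K * |x - z| ^ (-(1 / 4) : ℝ) :=
  (hF.pvBound_far h h1).abs_le ((hF.hasMod_left z).continuous h).aestronglyMeasurable (hP x z)

theorem SymKernel.lb_partial_far (hF : SymKernel ω A C F) (h : ModData ω Ω K)
    (hP : ∀ x z, HasPV (fun y => F y z / (x - y)) x (P x z)) (x : ℝ) :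
    LB (far x 1) (fun z => |P x z| / |x - z|) (20 * C * K * 8) := by
  have h0 := hF.nonneg
  have hK := h.K_pos
  refine lb_of_abs_le (measurableSet_far _ _)
    ((lb_far_rpow x one_pos (a := 1 / 4) (by norm_num)).mono_const (by norm_num)) (by positivity)
    fun z hz => ?_
  have hz1 : 1 < |x - z| := hz
  have hz0 : 0 < |x - z| := by linarith
  rw [show (-1 - 1 / 4 : ℝ) = -(1 / 4) - 1 by norm_num, Real.rpow_sub hz0, Real.rpow_one,
    ← mul_div_assoc]
  exact div_le_div_of_nonneg_right (hF.partial_far h hP hz1) hz0.le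

theorem lb_near_of_le {p : ℝ → ℝ} {x s a ρ : ℝ} (hρ : 0 ≤ ρ) (ha : 0 ≤ a)
    (hp : ∀ y, |x - y| ≤ ρ → |p y| ≤ a * √(|x - y| / s)) :
    LB (near x ρ) (fun y => |p y| / |x - y|) (a * (4 * √(ρ / s))) := by
  refine lb_of_abs_le (measurableSet_near _ _) (lb_near_sqrt x (c := s) hρ) ha fun y hy => ?_
  rw [← mul_div_assoc]
  exact div_le_div_of_nonneg_right (hp y hy) (abs_nonneg _)

set_option maxHeartbeats 400000 in
-- Subtracting F(x,z) and F(x',z) changes neither principal value and makes each numerator vanish at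
-- its own centre. The two numerators then differ by a constant, so in the comparison of principal
-- values only the change of the singular kernel and the neighbourhood of the centres remain.
theorem SymKernel.partial_var (hF : SymKernel ω A C F) (h : ModData ω Ω K)
    (hP : ∀ x z, HasPV (fun y => F y z / (x - y)) x (P x z)) {x x' z : ℝ} (hd : 0 < |x - x'|)
    (hd1 : |x - x'| ≤ 1 / 100) (hs : 8 * |x - x'| < |x - z|) :
    |P x z - P x' z| ≤ 200 * C * K ^ 2 * gain Ω |x - x'| |x - z| := by
  have h0 := hF.nonneg
  have hK := h.K_pos
  have hK1 := h.one_le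
  set d := |x - x'| with hd_def
  set s := |x - z| with hs_def
  have hs0 : 0 < s := by linarith
  have hd2 : d ≤ 1 := by linarith
  have hsd : 0 < √d := Real.sqrt_pos.mpr hd
  have hss : 0 < √s := Real.sqrt_pos.mpr hs0
  have hΩd := h.nonneg' d
  -- This quantity dominates ω(s) in both regimes, and √(d/s)·m is K times the gain.
  set m : ℝ := K * (if s ≤ √d then Ω d else 1) with hm
  have hm0 : 0 ≤ m := by rw [hm]; split_ifs <;> positivity
  have hgain : K * gain Ω d s = √(d / s) * m := by rw [gain, hm]; ring
  have hωm : ω s ≤ m := by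
    rw [hm]; split_ifs with hc
    · exact (h.comp d s hd hd2 (by linarith) hc).1
    · rw [mul_one]; exact h.le s
  have hs's : s / 2 ≤ |x' - z| := by
    have : s ≤ |x' - z| + d := by
      calc s = |(x' - z) + (x - x')| := by rw [hs_def]; congr 1; ring
        _ ≤ _ := abs_add_le _ _
    linarith
  have hs's2 : |x' - z| ≤ 2 * s := by
    have : |x' - z| ≤ s + d := by
      calc |x' - z| = |(x - z) - (x - x')| := by congr 1; ring
        _ ≤ _ := abs_sub _ _
    linarith
  have hs'7 : 7 * d ≤ |x' - z| := by
    have : s ≤ |x' - z| + d := by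
      calc s = |(x' - z) + (x - x')| := by rw [hs_def]; congr 1; ring
        _ ≤ _ := abs_add_le _ _
    linarith
  have hyx' : ∀ y, |x' - y| ≤ |x - y| + d := fun y => by
    calc |x' - y| = |(x - y) - (x - x')| := by congr 1; ring
      _ ≤ _ := abs_sub _ _
  -- With this constant the numerator terms in the comparison of principal values vanish
  -- identically.
  set e := F x' z - F x z with he_def
  have hp : HasPV (fun y => (F y z - F x z) / (x - y)) x (P x z) := by
    have := (hP x z).sub (hasPV_const_div x (F x z))
    simpa only [sub_div, sub_zero] using this
  have hp' : HasPV (fun y => (F y z - F x' z) / (x' - y)) x' (P x' z) := by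
    have := (hP x' z).sub (hasPV_const_div x' (F x' z))
    simpa only [sub_div, sub_zero] using this
  have hmeas : ∀ c, AEStronglyMeasurable (fun y => F y z - c) volume := fun c =>
    ((hF.hasMod_left z).continuous h).aestronglyMeasurable.sub aestronglyMeasurable_const
  have hpt : ∀ y, 2 * |x - y| ≤ s → |F y z - F x z| ≤ C * m * √(|x - y| / s) := by
    intro y hy
    calc |F y z - F x z| ≤ C * (|x - y| / s * ω s) := hF.smooth x y z hs0 hy
      _ ≤ C * (√(|x - y| / s) * m) := by
          refine mul_le_mul_of_nonneg_left (mul_le_mul ?_ hωm (h.nonneg _) (Real.sqrt_nonneg _)) h0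
          exact le_sqrt_self (by positivity)
            (by rw [div_le_one hs0]; linarith [abs_nonneg (x - y)])
      _ = _ := by ring
  have a1 : LB (near x (2 * d)) (fun y => |F y z - F x z| / |x - y|)
      (C * m * (4 * √(2 * d / s))) :=
    lb_near_of_le (by linarith) (by positivity) fun y hy => hpt y (by linarith)
  have a2 : LB (near x (2 * d)) (fun y => |F y z - F x' z| / |x' - y|)
      (C * K * m * (4 * √(3 * d / (s / 2)))) := by
    have : LB (near x' (3 * d)) (fun y => |F y z - F x' z| / |x' - y|)
        (C * K * m * (4 * √(3 * d / (s / 2)))) := by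
      refine lb_near_of_le (by linarith) (by positivity) fun y hy => ?_
      have hsp : 0 < |x' - z| := by linarith
      calc |F y z - F x' z| ≤ C * (|x' - y| / |x' - z| * ω |x' - z|) :=
            hF.smooth x' y z hsp (by linarith)
        _ ≤ C * (√(|x' - y| / (s / 2)) * (K * m)) := by
            refine mul_le_mul_of_nonneg_left (mul_le_mul ?_ ?_ (h.nonneg _) (Real.sqrt_nonneg _)) h0
            · refine (le_sqrt_self (by positivity) ?_).trans (Real.sqrt_le_sqrt ?_)
              · rw [div_le_one hsp]; linarith
              · exact div_le_div_of_nonneg_left (abs_nonneg _) (by linarith) hs's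
            · exact (h.mono hs's2).trans ((h.double s hs0.le).trans
                (mul_le_mul_of_nonneg_left hωm hK.le))
        _ = _ := by ring
    refine this.mono_set fun y hy => ?_
    have : |x - y| ≤ 2 * d := hy
    show |x' - y| ≤ 3 * d
    linarith [hyx' y]
  have hg0 : 0 ≤ √(d / s) * m := by positivity
  have hsqd : √(d / s) = √d / √s := Real.sqrt_div hd.le s
  have hbig : ∀ y, s < 2 * |x - y| → 1 ≤ 2 * √(|x - y| / s) := by
    intro y hy
    have : (1 / 2 : ℝ) ≤ √(|x - y| / s) := by
      refine Real.le_sqrt_of_sq_le ?_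
      rw [le_div_iff₀ hs0]; linarith
    linarith
  have hrs : ∀ y, 0 < |x - y| → √(|x - y| / s) / |x - y| ^ 2
      = 1 / √s * |x - y| ^ (-1 - 1 / 2 : ℝ) := by
    intro y hy
    rw [Real.sqrt_div hy.le, Real.sqrt_eq_rpow |x - y|, show (-1 - 1 / 2 : ℝ) = 1 / 2 - (2 : ℕ) by
      norm_num, Real.rpow_sub hy, Real.rpow_natCast]
    ring
  have hI := lb_far_rpow x (ρ := 2 * d) (a := 1 / 2) (by linarith) (by norm_num)
  have hIval : (2 * d) ^ (-(1 / 2) : ℝ) ≤ 1 / √d := by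
    have h12 : 1 / √d = d ^ (-(1 / 2) : ℝ) := by
      rw [Real.rpow_neg hd.le, ← Real.sqrt_eq_rpow, one_div]
    rw [h12]
    exact Real.rpow_le_rpow_of_nonpos hd (by linarith) (by norm_num)
  have a3 : LB (far x (2 * d)) (fun y => |F y z - F x z| / |x - y| ^ 2)
      (2 * C * m * (1 / √s) * (4 * (1 / √d)) + 2 * C * (K * (√(d / s) * m)) * (2 / d)) := by
    have hI' := (hI.mono_const (c' := 4 * (1 / √d)) (by linarith)).const_mul
      (a := 2 * C * m * (1 / √s)) (by positivity)
    have hpt2 : ∀ y, 2 * d < |x - y| → |F y z - F x z| ≤ 2 * C * m * √(|x - y| / s) →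
        |F y z - F x z| / |x - y| ^ 2 ≤ 2 * C * m * (1 / √s) * |x - y| ^ (-1 - 1 / 2 : ℝ) := by
      intro y hy hb
      have hy0 : 0 < |x - y| := by linarith
      calc |F y z - F x z| / |x - y| ^ 2 ≤ 2 * C * m * √(|x - y| / s) / |x - y| ^ 2 :=
            div_le_div_of_nonneg_right hb (by positivity)
        _ = 2 * C * m * (√(|x - y| / s) / |x - y| ^ 2) := by ring
        _ = _ := by rw [hrs y hy0]; ring
    have hb1 : ∀ y, 2 * |x - y| ≤ s → |F y z - F x z| ≤ 2 * C * m * √(|x - y| / s) := by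
      intro y hy
      refine (hpt y hy).trans (mul_le_mul_of_nonneg_right ?_ (Real.sqrt_nonneg _))
      nlinarith [mul_nonneg h0 hm0]
    have hb2 : ∀ y, s < 2 * |x - y| → |F y z - F x z| ≤ C * m →
        |F y z - F x z| ≤ 2 * C * m * √(|x - y| / s) := by
      intro y hy hb
      refine hb.trans ?_
      calc C * m = C * m * 1 := (mul_one _).symm
        _ ≤ C * m * (2 * √(|x - y| / s)) :=
            mul_le_mul_of_nonneg_left (hbig y hy) (by positivity)
        _ = _ := by ring
    -- If s ≤ √d, the Hölder bound up to √d is in terms of Ω(d) and a separate argument is needed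
    -- beyond; if s > √d, m = K already dominates ω everywhere.
    by_cases hc : s ≤ √d
    · have hmv : m = K * Ω d := by rw [hm, if_pos hc]
      refine LB.mono_set ?_ (far_subset_union x (2 * d) (√d))
      refine LB.union (hI'.mono_set Set.inter_subset_left |>.mono_fun
        ((measurableSet_far _ _).inter (measurableSet_near _ _)) fun y hy => ?_) ?_
        (by positivity) (by positivity)
      · have hy1 : 2 * d < |x - y| := hy.1
        have hy2 : |x - y| ≤ √d := hy.2
        refine hpt2 y hy1 ?_
        rcases le_or_gt (2 * |x - y|) s with h3 | h3
        · exact hb1 y h3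
        · refine hb2 y h3 ((hF.hol x y z).trans (mul_le_mul_of_nonneg_left ?_ h0))
          rw [hmv]
          exact (h.comp d _ hd hd2 (by linarith) hy2).1
      -- Write √d as the square of d^(1/4). One factor is at most √(d/s) because s ≤ √d, and the
      -- other is O(ω(d)), hence O(Ω(d)).
      · have hkey : √d ≤ K * (√(d / s) * m) := by
          have e1 : √√d ≤ √(d / s) := by
            refine Real.sqrt_le_sqrt ?_
            rw [le_div_iff₀ hs0]
            calc √d * s ≤ √d * √d := mul_le_mul_of_nonneg_left hc hsd.le
              _ = d := Real.mul_self_sqrt hd.le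
          have e2 : √√d ≤ K * m := by
            rw [hmv]
            exact (h.pow d hd hd2).trans (mul_le_mul_of_nonneg_left (h.le_Omega hd hd2) hK.le)
          calc √d = √√d * √√d := (Real.mul_self_sqrt hsd.le).symm
            _ ≤ √(d / s) * (K * m) := mul_le_mul e1 e2 (Real.sqrt_nonneg _) (Real.sqrt_nonneg _)
            _ = _ := by ring
        refine (((lb_far_inv_sq x hsd).const_mul (a := 2 * C) (by positivity)).mono_const
          ?_).mono_fun (measurableSet_far _ _) fun y _ => ?_
        · have e1 : 2 / √d = √d * (2 / d) := by
            have := Real.mul_self_sqrt hd.le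
            field_simp
            nlinarith
          rw [e1]
          calc 2 * C * (√d * (2 / d)) ≤ 2 * C * (K * (√(d / s) * m) * (2 / d)) := by gcongr
            _ = _ := by ring
        · rw [mul_one_div]
          refine div_le_div_of_nonneg_right ?_ (by positivity)
          exact (abs_sub _ _).trans (by linarith [hF.bdd y z, hF.bdd x z])
    · have hmv : m = K := by rw [hm, if_neg hc, mul_one]
      refine (hI'.mono_const ?_).mono_fun (measurableSet_far _ _) fun y hy => ?_
      · have : 0 ≤ 2 * C * (K * (√(d / s) * m)) * (2 / d) := by positivity
        linarith
      · refine hpt2 y hy ?_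
        rcases le_or_gt (2 * |x - y|) s with h3 | h3
        · exact hb1 y h3
        · refine hb2 y h3 ((hF.hol x y z).trans (mul_le_mul_of_nonneg_left ?_ h0))
          rw [hmv]
          exact h.le _
  have hzero : ∀ S, LB S (fun y => |F y z - F x z - (F y z - F x' z) - e| / |x - y|) 0 := by
    intro S
    have : ∀ y, F y z - F x z - (F y z - F x' z) - e = 0 := fun y => by rw [he_def]; ring
    simp only [LB, this]
    simp
  have hB : ∀ y, |F y z - F x' z| ≤ 2 * C := fun y =>
    (abs_sub _ _).trans (by linarith [hF.bdd y z, hF.bdd x' z])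
  have hmain := pv_diff (ρ := 2 * d) (e₁ := e) (e₂ := e) (hmeas _) (hmeas _) (by linarith)
    (by linarith) le_rfl hB hp hp' a1 a2 a3 (lb_far_inv_sq x (by linarith)) (hzero _) (hzero _)
    (by positivity) (by positivity) (by positivity) le_rfl le_rfl
  rw [← hd_def] at hmain
  refine hmain.trans ?_
  have he : |e| ≤ C * m * √(d / s) := by
    have := hpt x' (by linarith)
    rwa [← hd_def] at this
  have v1 : √(2 * d / s) ≤ 2 * √(d / s) := by
    rw [mul_div_assoc, Real.sqrt_mul zero_le_two]
    refine mul_le_mul_of_nonneg_right ?_ (Real.sqrt_nonneg _)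
    rw [Real.sqrt_le_left (by norm_num)]; norm_num
  have v2 : √(3 * d / (s / 2)) ≤ 3 * √(d / s) := by
    rw [show 3 * d / (s / 2) = 6 * (d / s) by field_simp; norm_num,
      Real.sqrt_mul (by norm_num)]
    refine mul_le_mul_of_nonneg_right ?_ (Real.sqrt_nonneg _)
    rw [Real.sqrt_le_left (by norm_num)]; norm_num
  have v3 : 2 * d * (2 * C * m * (1 / √s) * (4 * (1 / √d))
      + 2 * C * (K * (√(d / s) * m)) * (2 / d))
      = 16 * C * m * √(d / s) + 8 * C * K * (√(d / s) * m) := by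
    have e1 : d / √d = √d := Real.div_sqrt
    have e2 : d / d = 1 := div_self hd.ne'
    calc _ = 16 * C * m * ((d / √d) / √s) + 8 * C * K * (√(d / s) * m) * (d / d) := by
          field_simp
          ring
      _ = _ := by rw [e1, e2, ← hsqd, mul_one]
  have v4 : 4 * d / (2 * d) = 2 := by field_simp; norm_num
  rw [v3, v4]
  have hG : 200 * C * K ^ 2 * gain Ω d s = 200 * C * K * (√(d / s) * m) := by
    rw [← hgain]; ring
  rw [hG]
  have w1 : C * m * (4 * √(2 * d / s)) ≤ 8 * (C * (√(d / s) * m)) := by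
    calc C * m * (4 * √(2 * d / s)) ≤ C * m * (4 * (2 * √(d / s))) := by gcongr
      _ = _ := by ring
  have w2 : C * K * m * (4 * √(3 * d / (s / 2))) ≤ 12 * (C * K * (√(d / s) * m)) := by
    calc C * K * m * (4 * √(3 * d / (s / 2))) ≤ C * K * m * (4 * (3 * √(d / s))) := by gcongr
      _ = _ := by ring
  have w3 : C * (√(d / s) * m) ≤ C * K * (√(d / s) * m) :=
    mul_le_mul_of_nonneg_right (le_mul_of_one_le_right h0 hK1) hg0
  have w4 : 0 ≤ C * K * (√(d / s) * m) := by positivity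
  have w5 : |e| ≤ C * (√(d / s) * m) := he.trans_eq (by ring)
  linarith

/-- The modulus ω on the diagonal is a separate hypothesis. In the application the diagonal of P is
T_0, whose regularity is obtained by induction. -/
theorem SymKernel.exists_bilData_partial (hF : SymKernel ω A C F) (h : ModData ω Ω K)
    (hP : ∀ x z, HasPV (fun y => F y z / (x - y)) x (P x z)) {g : ℝ → ℝ} (hg : HasMod ω C' g)
    (hg' : HasDecay C' g) {B : ℝ} (hb : HasMod ω B fun x => P x x) :
    ∃ C₁, BilData ω Ω C₁ g (fun x => P x x) P := by
  have h0 := hF.nonneg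
  have h0' := hg.nonneg
  have hB := hb.nonneg
  have hK := h.K_pos
  have hΩ4 := h.nonneg' (1 / 4)
  have n1 : 0 ≤ 10 * C * K / Ω (1 / 4) := by positivity
  have n2 : 0 ≤ 10 * C * K ^ 3 := by positivity
  have n3 : 0 ≤ C * K := by positivity
  have n4 : 0 ≤ 200 * C * K ^ 2 := by positivity
  set C₁ := 3 * C' + B + 10 * C * K / Ω (1 / 4) + 10 * C * K ^ 3 + 160 * (C * K)
    + 200 * C * K ^ 2 with hC₁
  refine ⟨C₁, hg.mono h (by linarith), hb.mono h (by linarith),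
    fun x z => (hF.abs_partial_le h hP x z).trans (by linarith),
    fun x => (hF.measurable_partial h hP x).aestronglyMeasurable,
    fun x z hxz h1 => (hF.partial_diag h hP hxz h1).trans
      (mul_le_mul_of_nonneg_right (by linarith) (h.nonneg' _)),
    fun x => (hF.lb_partial_far h hP x).mono_const (by linarith),
    fun x => (hg'.lb_far x).mono_const (by linarith),
    fun x x' z hd hd1 hs => (hF.partial_var h hP hd hd1 hs).trans
      (mul_le_mul_of_nonneg_right (by linarith) (gain_nonneg h _ _))⟩

end

end CriticalHilbert

namespace CriticalHilbert

/-! ### The conjugate Poisson kernel as a regularisation of the principal value -/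

/-- The conjugate Poisson kernel. -/
noncomputable def ck (ε t : ℝ) : ℝ := t / (t ^ 2 + ε ^ 2)

theorem measurable_ck (ε : ℝ) : Measurable (ck ε) := by
  unfold ck; fun_prop

theorem ck_neg (ε t : ℝ) : ck ε (-t) = -ck ε t := by
  rw [ck, ck, neg_sq, neg_div]

theorem mul_ck_nonneg (ε t : ℝ) : 0 ≤ t * ck ε t := by
  rw [ck, ← mul_div_assoc, ← sq]; positivity

theorem mul_ck_le_one (ε t : ℝ) : t * ck ε t ≤ 1 := by
  rw [ck, ← mul_div_assoc, ← sq]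
  exact div_le_one_of_le₀ (by nlinarith [sq_nonneg ε]) (by positivity)

theorem abs_mul_ck_le_one (ε t : ℝ) : |t * ck ε t| ≤ 1 := by
  rw [abs_of_nonneg (mul_ck_nonneg ε t)]; exact mul_ck_le_one ε t

theorem abs_ck_le (ε t : ℝ) : |ck ε t| ≤ 1 / |t| := by
  rcases eq_or_ne t 0 with rfl | ht
  · simp [ck]
  · rw [le_div_iff₀ (abs_pos.mpr ht), mul_comm, ← abs_mul]
    exact abs_mul_ck_le_one ε t

theorem abs_ck_le_inv {ε : ℝ} (hε : 0 < ε) (t : ℝ) : |ck ε t| ≤ 1 / ε := by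
  rw [ck, abs_div, abs_of_pos (show 0 < t ^ 2 + ε ^ 2 by positivity),
    div_le_div_iff₀ (by positivity) hε]
  nlinarith [sq_abs t, sq_nonneg (|t| - ε), abs_nonneg t, sq_nonneg (|t|)]

theorem tendsto_mul_ck {t : ℝ} (ht : t ≠ 0) :
    Tendsto (fun ε => t * ck ε t) (𝓝[>] 0) (𝓝 1) := by
  have hc : ContinuousAt (fun ε => t * ck ε t) 0 := by
    unfold ck
    have : t ^ 2 + (0 : ℝ) ^ 2 ≠ 0 := by positivity
    fun_prop (disch := assumption)
  have := hc.tendsto.mono_left (nhdsWithin_le_nhds (s := Set.Ioi 0))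
  have e : t * ck 0 t = 1 := by rw [ck]; field_simp; ring
  rwa [e] at this

theorem integral_ck_step (ε x ρ k : ℝ) :
    ∫ y, ck ε (x - y) * (if |x - y| ≤ ρ then k else 0) = 0 := by
  have h1 : ∫ y, ck ε (x - y) * (if |x - y| ≤ ρ then k else 0)
      = ∫ t, ck ε t * (if |t| ≤ ρ then k else 0) :=
    integral_sub_left_eq_self (fun t => ck ε t * (if |t| ≤ ρ then k else 0)) volume x
  have h2 := integral_neg_eq_self (fun t => ck ε t * (if |t| ≤ ρ then k else 0)) volume
  simp only [ck_neg, abs_neg, neg_mul, integral_neg] at h2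
  linarith

theorem integrable_ck_step {ε : ℝ} (hε : 0 < ε) (x ρ k : ℝ) :
    Integrable fun y => ck ε (x - y) * (if |x - y| ≤ ρ then k else 0) := by
  have h1 : IntegrableOn (fun y => ck ε (x - y) * k) (near x ρ) := by
    refine Measure.integrableOn_of_bounded (M := 1 / ε * |k|) (volume_near_lt_top x ρ).ne ?_ ?_
    · exact (((measurable_ck ε).comp (measurable_const.sub measurable_id)).mul_const
        k).aestronglyMeasurable
    · refine Eventually.of_forall fun y => ?_
      rw [Real.norm_eq_abs, abs_mul]
      exact mul_le_mul_of_nonneg_right (abs_ck_le_inv hε _) (abs_nonneg _)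
  refine ((integrable_indicator_iff (measurableSet_near _ _)).mpr h1).congr
    (Eventually.of_forall fun y => ?_)
  by_cases hy : |x - y| ≤ ρ
  · have : y ∈ near x ρ := hy
    simp [hy, this]
  · have : y ∉ near x ρ := hy
    simp [hy, this]

/-- Removing an odd step turns the principal value into an absolutely convergent integral with the
same value. -/
theorem integrable_sub_step {p : ℝ → ℝ} {x ρ k a b : ℝ}
    (h1 : LB (near x ρ) (fun y => |p y - k| / |x - y|) a)
    (h2 : LB (far x ρ) (fun y => |p y| / |x - y|) b) (h3 : 0 ≤ a) (h4 : 0 ≤ b)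
    (hp : AEStronglyMeasurable p volume) :
    Integrable (fun y => (p y - if |x - y| ≤ ρ then k else 0) / (x - y)) ∧
      LB Set.univ (fun y => |(p y - if |x - y| ≤ ρ then k else 0) / (x - y)|) (a + b) ∧
      ∀ L, HasPV (fun y => p y / (x - y)) x L →
        L = ∫ y, (p y - if |x - y| ≤ ρ then k else 0) / (x - y) := by
  have hq : (fun y => (p y - if |x - y| ≤ ρ then k else 0) / (x - y)) =
      fun y => p y / (x - y) - oddStep x ρ k 0 y := by
    ext y; simp only [oddStep, ← sub_div]
  have hqm : AEStronglyMeasurable (fun y => p y / (x - y) - oddStep x ρ k 0 y) volume :=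
    (aestronglyMeasurable_div_sub hp x).sub (measurable_oddStep _ _ _ _).aestronglyMeasurable
  rw [← hq] at hqm
  have hlb : LB Set.univ (fun y => |(p y - if |x - y| ≤ ρ then k else 0) / (x - y)|)
      (a + b) := by
    refine LB.univ_of (x := x) (r := ρ) ?_ ?_ h3 h4
    · refine h1.mono_fun (measurableSet_near _ _) fun y hy => ?_
      have : |x - y| ≤ ρ := hy
      rw [if_pos this, abs_div]
    · refine h2.mono_fun (measurableSet_far _ _) fun y hy => ?_
      have : ¬ |x - y| ≤ ρ := not_le.mpr hy
      rw [if_neg this, abs_div, sub_zero]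
  have hint := hlb.integrable hqm
  refine ⟨hint, hlb, fun L hL => ?_⟩
  have := (hasPV_of_integrable hint x).add (hasPV_oddStep x ρ k 0)
  rw [add_zero] at this
  exact hL.unique (this.congr_ae (Eventually.of_forall fun y => by
    simp only [oddStep]; rw [← add_div, sub_add_cancel]))

/-- A function with a `PVBound` is an odd step plus an absolutely integrable part. -/
theorem PVBound.exists_integrable {p : ℝ → ℝ} {x c : ℝ} (hb : PVBound p x c)
    (hp : AEStronglyMeasurable p volume) :
    ∃ q : ℝ → ℝ, Integrable q ∧ LB Set.univ (fun y => |q y|) c ∧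
      (∀ L, HasPV (fun y => p y / (x - y)) x L → L = ∫ y, q y) ∧
      ∀ ε, 0 < ε → Integrable (fun y => ck ε (x - y) * p y) ∧
        ∫ y, ck ε (x - y) * p y = ∫ y, (x - y) * ck ε (x - y) * q y := by
  obtain ⟨ρ, k, a, b, h1, h2, h3, h4, h5⟩ := hb
  obtain ⟨hint, hlb, hL⟩ := integrable_sub_step h1 h2 h3 h4 hp
  refine ⟨_, hint, hlb.mono_const h5, hL, fun ε hε => ?_⟩
  have hm : Measurable fun y => (x - y) * ck ε (x - y) :=
    (measurable_const.sub measurable_id).mul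
      ((measurable_ck ε).comp (measurable_const.sub measurable_id))
  have hi : Integrable fun y => (x - y) * ck ε (x - y) * ((p y - if |x - y| ≤ ρ then k else 0) / (x - y)) :=
    hint.bdd_mul hm.aestronglyMeasurable
      (Eventually.of_forall fun y => abs_mul_ck_le_one ε (x - y))
  have hsum : (fun y => ck ε (x - y) * p y) =ᵐ[volume]
      fun y => (x - y) * ck ε (x - y) * ((p y - if |x - y| ≤ ρ then k else 0) / (x - y))
        + ck ε (x - y) * (if |x - y| ≤ ρ then k else 0) := by
    refine ae_eq_of_ne x fun y hy => ?_
    have : x - y ≠ 0 := sub_ne_zero.mpr hy.symm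
    field_simp; ring
  refine ⟨(hi.add (integrable_ck_step hε x ρ k)).congr hsum.symm, ?_⟩
  rw [integral_congr_ae hsum, integral_add hi (integrable_ck_step hε x ρ k),
    integral_ck_step, add_zero]

theorem PVBound.nonneg {p : ℝ → ℝ} {x c : ℝ} (hb : PVBound p x c) : 0 ≤ c := by
  obtain ⟨ρ, k, a, b, h1, h2, h3, h4, h5⟩ := hb
  linarith

theorem PVBound.abs_integral_ck_le {p : ℝ → ℝ} {x c ε : ℝ} (hb : PVBound p x c)
    (hp : AEStronglyMeasurable p volume) (hε : 0 < ε) :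
    |∫ y, ck ε (x - y) * p y| ≤ c := by
  obtain ⟨q, -, hq, -, h⟩ := hb.exists_integrable hp
  rw [(h ε hε).2]
  have h1 : LB Set.univ (fun y => |(x - y) * ck ε (x - y) * q y|) c := by
    refine hq.mono_fun MeasurableSet.univ fun y _ => ?_
    rw [abs_mul]
    exact mul_le_of_le_one_left (abs_nonneg _) (abs_mul_ck_le_one ε (x - y))
  simpa using h1.abs_integral_le hb.nonneg

/-- The factor t·ck_ε(t) lies in [0, 1] and tends to 1, so dominated convergence applies to the
integrable part; the odd step contributes zero for every ε. -/
theorem PVBound.tendsto_ck {p : ℝ → ℝ} {x c L : ℝ} (hb : PVBound p x c)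
    (hp : AEStronglyMeasurable p volume) (hL : HasPV (fun y => p y / (x - y)) x L) :
    Tendsto (fun ε => ∫ y, ck ε (x - y) * p y) (𝓝[>] 0) (𝓝 L) := by
  obtain ⟨q, hqi, -, hqL, h⟩ := hb.exists_integrable hp
  rw [hqL L hL]
  have h1 : Tendsto (fun ε => ∫ y, (x - y) * ck ε (x - y) * q y) (𝓝[>] 0) (𝓝 (∫ y, q y)) := by
    refine tendsto_integral_filter_of_dominated_convergence (fun y => |q y|) ?_ ?_ hqi.abs ?_
    · refine Eventually.of_forall fun ε => ?_
      have hm : Measurable fun y => (x - y) * ck ε (x - y) :=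
        (measurable_const.sub measurable_id).mul
          ((measurable_ck ε).comp (measurable_const.sub measurable_id))
      exact hm.aestronglyMeasurable.mul hqi.aestronglyMeasurable
    · refine Eventually.of_forall fun ε => Eventually.of_forall fun y => ?_
      rw [Real.norm_eq_abs, abs_mul]
      exact mul_le_of_le_one_left (abs_nonneg _) (abs_mul_ck_le_one ε (x - y))
    · have hx : ∀ᵐ y : ℝ, y ≠ x := by
        simp [ae_iff, measure_singleton]
      filter_upwards [hx] with y hy
      simpa using (tendsto_mul_ck (sub_ne_zero.mpr hy.symm)).mul_const (q y)
  refine h1.congr' ?_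
  filter_upwards [self_mem_nhdsWithin] with ε hε
  exact ((h ε hε).2).symm

/-! ### Planar domination -/

theorem integrable_indicator_mul_inv (A : ℝ) :
    Integrable fun p : ℝ × ℝ => (near 0 A).indicator (fun _ => (1 : ℝ)) p.1 *
      (1 / (1 + |p.2|) ^ 2) := by
  have h1 : Integrable ((near 0 A).indicator fun _ => (1 : ℝ)) :=
    (integrable_indicator_iff (measurableSet_near _ _)).mpr
      (integrableOn_const (volume_near_lt_top 0 A).ne)
  have h2 : Integrable fun z : ℝ => 1 / (1 + |z|) ^ 2 := by
    refine LB.integrable (c := 4) ?_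
      (show Measurable fun z : ℝ => 1 / (1 + |z|) ^ 2 by fun_prop).aestronglyMeasurable
    refine (lb_inv_one_add_sq 0).mono_fun MeasurableSet.univ fun z _ => ?_
    rw [abs_of_nonneg (by positivity), zero_sub, abs_neg]
  exact h1.mul_prod h2

/-- The support lies in the union of the strips |y| ≤ A and |z| ≤ A. On each strip quadratic decay
in y - z becomes quadratic decay in the unbounded variable. -/
theorem integrable_of_strip {u : ℝ × ℝ → ℝ} {A B : ℝ} (hu : AEStronglyMeasurable u volume)
    (hA : 0 ≤ A) (hB : ∀ p, |u p| * (1 + |p.1 - p.2|) ^ 2 ≤ B)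
    (hs : ∀ p, A < |p.1| → A < |p.2| → u p = 0) : Integrable u := by
  have hB0 : 0 ≤ B := (mul_nonneg (abs_nonneg _) (by positivity)).trans (hB 0)
  have h1 := integrable_indicator_mul_inv A
  have h2 := (h1.add h1.swap).const_mul (B * (1 + A) ^ 2)
  refine h2.mono' hu (Eventually.of_forall fun p => ?_)
  have key : ∀ y z : ℝ, |y| ≤ A → ∀ v, v * (1 + |y - z|) ^ 2 ≤ B →
      v ≤ B * (1 + A) ^ 2 * (1 / (1 + |z|) ^ 2) := by
    intro y z hy v hv
    have h3 : 1 + |z| ≤ (1 + A) * (1 + |y - z|) := by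
      have : |z| ≤ |y| + |y - z| := by
        calc |z| = |y - (y - z)| := by congr 1; ring
          _ ≤ _ := abs_sub _ _
      nlinarith [abs_nonneg (y - z)]
    have h4 : (1 + |z|) ^ 2 ≤ (1 + A) ^ 2 * (1 + |y - z|) ^ 2 := by
      rw [← mul_pow]; exact pow_le_pow_left₀ (by positivity) h3 2
    rw [mul_one_div, le_div_iff₀ (by positivity)]
    rcases le_or_gt v 0 with hv0 | hv0
    · exact (mul_nonpos_of_nonpos_of_nonneg hv0 (by positivity)).trans (by positivity)
    · calc v * (1 + |z|) ^ 2 ≤ v * ((1 + A) ^ 2 * (1 + |y - z|) ^ 2) :=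
            mul_le_mul_of_nonneg_left h4 hv0.le
        _ = v * (1 + |y - z|) ^ 2 * (1 + A) ^ 2 := by ring
        _ ≤ _ := mul_le_mul_of_nonneg_right hv (by positivity)
  have i0 : ∀ t : ℝ, 0 ≤ (near 0 A).indicator (fun _ => (1 : ℝ)) t := fun t =>
    Set.indicator_nonneg (fun _ _ => zero_le_one) t
  have i1 : ∀ t : ℝ, |t| ≤ A → (near 0 A).indicator (fun _ => (1 : ℝ)) t = 1 := fun t ht =>
    Set.indicator_of_mem (show t ∈ near 0 A by simpa [near] using ht) _
  have hBA : 0 ≤ B * (1 + A) ^ 2 := by positivity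
  simp only [Pi.add_apply, Function.comp_apply, Prod.fst_swap, Prod.snd_swap, Real.norm_eq_abs]
  rcases le_or_gt |p.1| A with h3 | h3
  · refine (key p.1 p.2 h3 _ (hB p)).trans (mul_le_mul_of_nonneg_left ?_ hBA)
    rw [i1 _ h3, one_mul]
    exact le_add_of_nonneg_right (mul_nonneg (i0 _) (by positivity))
  · rcases le_or_gt |p.2| A with h4 | h4
    · refine (key p.2 p.1 h4 _ (by rw [abs_sub_comm]; exact hB p)).trans
        (mul_le_mul_of_nonneg_left ?_ hBA)
      rw [i1 _ h4, one_mul]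
      exact le_add_of_nonneg_left (mul_nonneg (i0 _) (by positivity))
    · rw [hs p h3 h4, abs_zero]
      exact mul_nonneg hBA (add_nonneg (mul_nonneg (i0 _) (by positivity))
        (mul_nonneg (i0 _) (by positivity)))

end CriticalHilbert

/-! ### Poisson kernels and symmetrisation of the regularised double integral -/

namespace CriticalHilbert

/-- The Poisson kernel, up to the factor `π`. -/
noncomputable def pk (ε t : ℝ) : ℝ := ε / (t ^ 2 + ε ^ 2)

theorem measurable_pk (ε : ℝ) : Measurable (pk ε) := by
  unfold pk; fun_prop

theorem pk_nonneg {ε : ℝ} (hε : 0 < ε) (t : ℝ) : 0 ≤ pk ε t := by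
  unfold pk; positivity

theorem abs_ck_mul_le {ε : ℝ} (hε : 0 < ε) (t : ℝ) : |ck ε t| * (1 + |t|) ≤ 1 / ε + 1 := by
  rw [mul_add, mul_one, ← abs_mul, mul_comm (ck ε t)]
  exact add_le_add (abs_ck_le_inv hε t) (abs_mul_ck_le_one ε t)

/-- With 1/(t - iε) = ck + i·pk this is the real part of the resolvent identity 1/a - 1/b = (b -
a)/(ab). The product of Poisson kernels is what becomes the Poincaré–Bertrand correction as ε → 0.
-/
theorem ck_mul_ck_sub {ε : ℝ} (hε : 0 < ε) (s p q : ℝ) :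
    s * (ck ε p - ck ε q) = s * (q - p) * (ck ε p * ck ε q - pk ε p * pk ε q) := by
  have h1 : p ^ 2 + ε ^ 2 ≠ 0 := by positivity
  have h2 : q ^ 2 + ε ^ 2 ≠ 0 := by positivity
  unfold ck pk
  field_simp
  ring

/-- Used to show that a product of two regularised kernels decays like 1/|p - q|, the power that F
lacks for integrability on the plane. -/
theorem one_add_abs_sub_le {ε : ℝ} (hε : 0 < ε) (p q : ℝ) :
    1 + |p - q| ≤ (1 / ε ^ 2 + 2 / ε) * (√(p ^ 2 + ε ^ 2) * √(q ^ 2 + ε ^ 2)) := by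
  have hP : ∀ t : ℝ, |t| ≤ √(t ^ 2 + ε ^ 2) ∧ ε ≤ √(t ^ 2 + ε ^ 2) := fun t =>
    ⟨Real.abs_le_sqrt (by nlinarith), Real.le_sqrt_of_sq_le (by nlinarith)⟩
  obtain ⟨p1, p2⟩ := hP p
  obtain ⟨q1, q2⟩ := hP q
  set P := √(p ^ 2 + ε ^ 2)
  set Q := √(q ^ 2 + ε ^ 2)
  have hP0 : 0 < P := hε.trans_le p2
  have hQ0 : 0 < Q := hε.trans_le q2
  have e1 : 1 ≤ 1 / ε ^ 2 * (P * Q) := by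
    rw [one_div, ← div_eq_inv_mul, one_le_div (by positivity)]
    nlinarith
  have e2 : P ≤ 1 / ε * (P * Q) := by
    rw [one_div, ← div_eq_inv_mul, le_div_iff₀ hε]
    exact mul_le_mul_of_nonneg_left q2 hP0.le
  have e3 : Q ≤ 1 / ε * (P * Q) := by
    rw [one_div, ← div_eq_inv_mul, le_div_iff₀ hε]
    nlinarith
  have e4 : |p - q| ≤ |p| + |q| := abs_sub _ _
  have e5 : (1 / ε ^ 2 + 2 / ε) * (P * Q) = 1 / ε ^ 2 * (P * Q) + 1 / ε * (P * Q) + 1 / ε * (P * Q) := by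
    ring
  linarith

theorem div_mul_le_of_num {ε : ℝ} (hε : 0 < ε) {p q n : ℝ}
    (hn : |n| ≤ √(p ^ 2 + ε ^ 2) * √(q ^ 2 + ε ^ 2)) :
    |n / ((p ^ 2 + ε ^ 2) * (q ^ 2 + ε ^ 2))| * (1 + |p - q|) ≤ 1 / ε ^ 2 + 2 / ε := by
  have h1 := one_add_abs_sub_le hε p q
  have hp : 0 < p ^ 2 + ε ^ 2 := by positivity
  have hq : 0 < q ^ 2 + ε ^ 2 := by positivity
  have sp := Real.sqrt_pos.mpr hp
  have sq := Real.sqrt_pos.mpr hq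
  have e : (p ^ 2 + ε ^ 2) * (q ^ 2 + ε ^ 2)
      = (√(p ^ 2 + ε ^ 2) * √(q ^ 2 + ε ^ 2)) * (√(p ^ 2 + ε ^ 2) * √(q ^ 2 + ε ^ 2)) := by
    rw [mul_mul_mul_comm, Real.mul_self_sqrt hp.le, Real.mul_self_sqrt hq.le]
  rw [abs_div, abs_of_pos (mul_pos hp hq), div_mul_eq_mul_div, div_le_iff₀ (mul_pos hp hq), e,
    ← mul_assoc, mul_comm (1 / ε ^ 2 + 2 / ε)]
  calc |n| * (1 + |p - q|) ≤ (√(p ^ 2 + ε ^ 2) * √(q ^ 2 + ε ^ 2)) *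
        ((1 / ε ^ 2 + 2 / ε) * (√(p ^ 2 + ε ^ 2) * √(q ^ 2 + ε ^ 2))) :=
      mul_le_mul hn h1 (by positivity) (by positivity)
    _ = _ := by ring

theorem abs_ck_mul_ck_le {ε : ℝ} (hε : 0 < ε) (p q : ℝ) :
    |ck ε p * ck ε q| * (1 + |p - q|) ≤ 1 / ε ^ 2 + 2 / ε := by
  rw [ck, ck, div_mul_div_comm]
  refine div_mul_le_of_num hε ?_
  rw [abs_mul]
  exact mul_le_mul (Real.abs_le_sqrt (by nlinarith)) (Real.abs_le_sqrt (by nlinarith))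
    (abs_nonneg _) (Real.sqrt_nonneg _)

theorem abs_pk_mul_pk_le {ε : ℝ} (hε : 0 < ε) (p q : ℝ) :
    |pk ε p * pk ε q| * (1 + |p - q|) ≤ 1 / ε ^ 2 + 2 / ε := by
  rw [pk, pk, div_mul_div_comm]
  refine div_mul_le_of_num hε ?_
  rw [abs_mul]
  have key : ∀ t : ℝ, |ε| ≤ √(t ^ 2 + ε ^ 2) := fun t => by
    rw [abs_of_pos hε]; exact Real.le_sqrt_of_sq_le (by nlinarith [sq_nonneg t])
  exact mul_le_mul (key p) (key q) (abs_nonneg _) (Real.sqrt_nonneg _)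

/-- The Poisson integral after rescaling. -/
theorem integral_pk_mul {ε : ℝ} (hε : 0 < ε) (x : ℝ) (u : ℝ → ℝ) :
    ∫ y, pk ε (x - y) * u y = ∫ t, (1 + t ^ 2)⁻¹ * u (x - ε * t) := by
  have h1 : ∫ y, pk ε (x - y) * u y = ∫ t, pk ε t * u (x - t) := by
    rw [← integral_sub_left_eq_self (fun t => pk ε t * u (x - t)) volume x]
    simp
  have h2 := Measure.integral_comp_mul_left (fun t => pk ε t * u (x - t)) ε
  rw [abs_inv, abs_of_pos hε, smul_eq_mul, inv_mul_eq_div, eq_div_iff hε.ne', mul_comm] at h2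
  rw [h1, ← h2, ← integral_const_mul]
  refine integral_congr_ae (Eventually.of_forall fun t => ?_)
  have : (1 + t ^ 2) ≠ 0 := by positivity
  simp only [pk]
  field_simp
  ring

theorem integral_pk {ε : ℝ} (hε : 0 < ε) (x : ℝ) : ∫ y, pk ε (x - y) = Real.pi := by
  have := integral_pk_mul hε x fun _ => 1
  simpa using this

theorem integrable_pk {ε : ℝ} (hε : 0 < ε) (x : ℝ) : Integrable fun y => pk ε (x - y) :=
  Integrable.of_integral_ne_zero (by rw [integral_pk hε]; exact Real.pi_ne_zero)

theorem tendsto_integral_pk {u : ℝ → ℝ} (hu : Continuous u) {B x : ℝ} (hB : ∀ y, |u y| ≤ B)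
    (h0 : u x = 0) : Tendsto (fun ε => ∫ y, pk ε (x - y) * u y) (𝓝[>] 0) (𝓝 0) := by
  have h1 : Tendsto (fun ε => ∫ t, (1 + t ^ 2)⁻¹ * u (x - ε * t)) (𝓝[>] 0)
      (𝓝 (∫ _ : ℝ, (0 : ℝ))) := by
    refine tendsto_integral_filter_of_dominated_convergence (fun t => (1 + t ^ 2)⁻¹ * B) ?_ ?_
      (integrable_inv_one_add_sq.mul_const B) ?_
    · refine Eventually.of_forall fun ε => ?_
      refine (show Continuous fun t : ℝ => (1 + t ^ 2)⁻¹ * u (x - ε * t) from ?_).aestronglyMeasurable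
      exact (Continuous.inv₀ (by fun_prop) fun t => by positivity).mul (hu.comp (by fun_prop))
    · refine Eventually.of_forall fun ε => Eventually.of_forall fun t => ?_
      rw [Real.norm_eq_abs, abs_mul, abs_of_nonneg (by positivity : 0 ≤ (1 + t ^ 2)⁻¹)]
      exact mul_le_mul_of_nonneg_left (hB _) (by positivity)
    · refine Eventually.of_forall fun t => ?_
      have hc : ContinuousAt (fun ε => (1 + t ^ 2)⁻¹ * u (x - ε * t)) 0 :=
        (continuous_const.mul (hu.comp (by fun_prop))).continuousAt
      have := hc.tendsto.mono_left (nhdsWithin_le_nhds (s := Set.Ioi 0))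
      simpa [h0] using this
  rw [integral_zero] at h1
  refine h1.congr' ?_
  filter_upwards [self_mem_nhdsWithin] with ε hε
  exact (integral_pk_mul hε x u).symm

section

variable {ω Ω : ℝ → ℝ} {K C C' A : ℝ} {F : ℝ → ℝ → ℝ}

/-- Integrability on the plane of the kernel times two-variable factors with one more power of
decay. -/
theorem SymKernel.integrable_mul (hF : SymKernel ω A C F) (h : ModData ω Ω K) (hA : 0 ≤ A)
    {v : ℝ × ℝ → ℝ} {B : ℝ} (hv : AEStronglyMeasurable v volume)
    (hB : ∀ p : ℝ × ℝ, |v p| * (1 + |p.1 - p.2|) ≤ B) :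
    Integrable fun p : ℝ × ℝ => v p * F p.1 p.2 := by
  refine integrable_of_strip (A := A) (B := B * C)
    (hv.mul (hF.toPreKernel.continuous h).aestronglyMeasurable) hA (fun p => ?_) fun p h1 h2 => ?_
  · have h1 := hF.decay p.1 p.2
    rw [abs_mul]
    calc |v p| * |F p.1 p.2| * (1 + |p.1 - p.2|) ^ 2
        = (|v p| * (1 + |p.1 - p.2|)) * (|F p.1 p.2| * (1 + |p.1 - p.2|)) := by ring
      _ ≤ B * C := mul_le_mul (hB p) h1 (by positivity)
          ((by positivity : 0 ≤ |v p| * (1 + |p.1 - p.2|)).trans (hB p))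
  · simp only [hF.supp _ _ h1 h2, mul_zero]

variable {g : ℝ → ℝ}

/-- Symmetrisation of the regularised double integral. -/
theorem SymKernel.integral_symm (hF : SymKernel ω A C F) (h : ModData ω Ω K) (hA : 0 ≤ A)
    (hg : Continuous g) {B : ℝ} (hgB : ∀ y, |g y| ≤ B) (x : ℝ) {ε δ : ℝ} (hε : 0 < ε)
    (hδ : 0 < δ) :
    ∫ y, ck ε (x - y) * ∫ z, ck δ (y - z) * (F y z * (g y + g z)) =
      ∫ p : ℝ × ℝ, (p.1 - p.2) * ck δ (p.1 - p.2) *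
        ((ck ε (x - p.1) * ck ε (x - p.2) - pk ε (x - p.1) * pk ε (x - p.2)) * g p.2 *
          F p.1 p.2) := by
  have hB0 : 0 ≤ B := (abs_nonneg _).trans (hgB 0)
  have m1 : Measurable fun p : ℝ × ℝ => ck ε (x - p.1) :=
    (measurable_ck ε).comp (by fun_prop)
  have m2 : Measurable fun p : ℝ × ℝ => ck δ (p.1 - p.2) :=
    (measurable_ck δ).comp (by fun_prop)
  have mg : Measurable fun p : ℝ × ℝ => g p.1 := hg.measurable.comp measurable_fst
  have mg' : Measurable fun p : ℝ × ℝ => g p.2 := hg.measurable.comp measurable_snd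
  have key : ∀ u : ℝ × ℝ → ℝ, Measurable u → (∀ p, |u p| ≤ B) →
      Integrable fun p : ℝ × ℝ => ck ε (x - p.1) * ck δ (p.1 - p.2) * u p * F p.1 p.2 := by
    intro u hu hub
    refine hF.integrable_mul h hA (B := 1 / ε * (1 / δ + 1) * B)
      ((m1.mul m2).mul hu).aestronglyMeasurable fun p => ?_
    rw [abs_mul, abs_mul]
    calc |ck ε (x - p.1)| * |ck δ (p.1 - p.2)| * |u p| * (1 + |p.1 - p.2|)
        = |ck ε (x - p.1)| * (|ck δ (p.1 - p.2)| * (1 + |p.1 - p.2|)) * |u p| := by ring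
      _ ≤ 1 / ε * (1 / δ + 1) * B := mul_le_mul (mul_le_mul (abs_ck_le_inv hε _)
          (abs_ck_mul_le hδ _) (by positivity) (by positivity)) (hub p) (abs_nonneg _)
          (by positivity)
  have i1 := key _ mg fun p => hgB p.1
  have i2 := key _ mg' fun p => hgB p.2
  have e1 : ∫ y, ck ε (x - y) * ∫ z, ck δ (y - z) * (F y z * (g y + g z)) =
      ∫ p : ℝ × ℝ, (ck ε (x - p.1) * ck δ (p.1 - p.2) * g p.1 * F p.1 p.2 +
        ck ε (x - p.1) * ck δ (p.1 - p.2) * g p.2 * F p.1 p.2) := by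
    rw [Measure.volume_eq_prod, integral_prod _ (by
      rw [← Measure.volume_eq_prod]; exact i1.add i2)]
    refine integral_congr_ae (Eventually.of_forall fun y => ?_)
    simp only []
    rw [← integral_const_mul]
    refine integral_congr_ae (Eventually.of_forall fun z => ?_)
    simp only []
    ring
  -- Only the half with g(y) is transposed. As F is symmetric and ck δ is odd, the two halves
  -- combine into ck ε(x-y) - ck ε(x-z), to which the resolvent identity applies.
  have e2 : ∫ p : ℝ × ℝ, ck ε (x - p.1) * ck δ (p.1 - p.2) * g p.1 * F p.1 p.2 =
      ∫ p : ℝ × ℝ, ck ε (x - p.2) * ck δ (p.2 - p.1) * g p.2 * F p.2 p.1 := by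
    rw [Measure.volume_eq_prod]
    exact (integral_prod_swap (fun p : ℝ × ℝ =>
      ck ε (x - p.1) * ck δ (p.1 - p.2) * g p.1 * F p.1 p.2)).symm
  have i1' : Integrable fun p : ℝ × ℝ =>
      ck ε (x - p.2) * ck δ (p.2 - p.1) * g p.2 * F p.2 p.1 := i1.swap
  rw [e1, integral_add i1 i2, e2, ← integral_add i1' i2]
  refine integral_congr_ae (Eventually.of_forall fun p => ?_)
  simp only []
  rw [hF.symm p.2 p.1, ← neg_sub p.1 p.2, ck_neg]
  have := ck_mul_ck_sub hε (ck δ (p.1 - p.2)) (x - p.1) (x - p.2)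
  linear_combination (F p.1 p.2 * g p.2) * this

theorem SymKernel.integrable_ck_pk (hF : SymKernel ω A C F) (h : ModData ω Ω K) (hA : 0 ≤ A)
    (hg : Continuous g) {B : ℝ} (hgB : ∀ y, |g y| ≤ B) (x : ℝ) {ε : ℝ} (hε : 0 < ε) :
    (Integrable fun p : ℝ × ℝ => ck ε (x - p.1) * ck ε (x - p.2) * g p.2 * F p.1 p.2) ∧
    Integrable fun p : ℝ × ℝ => pk ε (x - p.1) * pk ε (x - p.2) * g p.2 * F p.1 p.2 := by
  have hB0 : 0 ≤ B := (abs_nonneg _).trans (hgB 0)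
  have mg' : Measurable fun p : ℝ × ℝ => g p.2 := hg.measurable.comp measurable_snd
  have c1 : ∀ p : ℝ × ℝ, (x - p.1) - (x - p.2) = -(p.1 - p.2) := fun p => by ring
  have key : ∀ v : ℝ × ℝ → ℝ, Measurable v →
      (∀ p : ℝ × ℝ, |v p| * (1 + |p.1 - p.2|) ≤ 1 / ε ^ 2 + 2 / ε) →
      Integrable fun p : ℝ × ℝ => v p * g p.2 * F p.1 p.2 := by
    intro v hv hvb
    refine hF.integrable_mul h hA (B := (1 / ε ^ 2 + 2 / ε) * B)
      (hv.mul mg').aestronglyMeasurable fun p => ?_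
    rw [abs_mul]
    calc |v p| * |g p.2| * (1 + |p.1 - p.2|) = |v p| * (1 + |p.1 - p.2|) * |g p.2| := by ring
      _ ≤ _ := mul_le_mul (hvb p) (hgB _) (abs_nonneg _) (by positivity)
  constructor
  · refine key _ (((measurable_ck ε).comp (by fun_prop)).mul
      ((measurable_ck ε).comp (by fun_prop))) fun p => ?_
    have := abs_ck_mul_ck_le hε (x - p.1) (x - p.2)
    rwa [c1, abs_neg] at this
  · refine key _ (((measurable_pk ε).comp (by fun_prop)).mul
      ((measurable_pk ε).comp (by fun_prop))) fun p => ?_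
    have := abs_pk_mul_pk_le hε (x - p.1) (x - p.2)
    rwa [c1, abs_neg] at this

theorem ae_prod_ne : ∀ᵐ p : ℝ × ℝ, p.1 ≠ p.2 := by
  rw [Measure.volume_eq_prod]
  have hm : MeasurableSet {p : ℝ × ℝ | p.1 ≠ p.2} :=
    (measurableSet_eq_fun measurable_fst measurable_snd).compl
  refine (Measure.ae_prod_iff_ae_ae hm).mpr (Eventually.of_forall fun y => ?_)
  simp [ae_iff, measure_singleton]

/-- Removing the inner regularisation after symmetrisation. -/
theorem SymKernel.tendsto_symm (hF : SymKernel ω A C F) (h : ModData ω Ω K) (hA : 0 ≤ A)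
    (hg : Continuous g) {B : ℝ} (hgB : ∀ y, |g y| ≤ B) (x : ℝ) {ε : ℝ} (hε : 0 < ε) :
    Tendsto (fun δ => ∫ p : ℝ × ℝ, (p.1 - p.2) * ck δ (p.1 - p.2) *
        ((ck ε (x - p.1) * ck ε (x - p.2) - pk ε (x - p.1) * pk ε (x - p.2)) * g p.2 *
          F p.1 p.2)) (𝓝[>] 0)
      (𝓝 ((∫ z, ck ε (x - z) * (g z * ∫ y, ck ε (x - y) * F y z)) -
        ∫ z, pk ε (x - z) * (g z * ∫ y, pk ε (x - y) * F y z))) := by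
  obtain ⟨i1, i2⟩ := hF.integrable_ck_pk h hA hg hgB x hε
  have i3 : Integrable fun p : ℝ × ℝ =>
      (ck ε (x - p.1) * ck ε (x - p.2) - pk ε (x - p.1) * pk ε (x - p.2)) * g p.2 *
          F p.1 p.2 := by
    refine (i1.sub i2).congr (Eventually.of_forall fun p => ?_)
    simp only [Pi.sub_apply]
    ring
  have it : ∀ k : ℝ → ℝ → ℝ,
      Integrable (fun p : ℝ × ℝ => k ε (x - p.1) * k ε (x - p.2) * g p.2 * F p.1 p.2) →
      ∫ p : ℝ × ℝ, k ε (x - p.1) * k ε (x - p.2) * g p.2 * F p.1 p.2 =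
        ∫ z, k ε (x - z) * (g z * ∫ y, k ε (x - y) * F y z) := by
    intro k hk
    rw [Measure.volume_eq_prod] at hk ⊢
    rw [integral_prod_symm _ hk]
    refine integral_congr_ae (Eventually.of_forall fun z => ?_)
    simp only []
    rw [← integral_const_mul, ← integral_const_mul]
    refine integral_congr_ae (Eventually.of_forall fun y => ?_)
    simp only []
    ring
  rw [← it ck i1, ← it pk i2, ← integral_sub i1 i2]
  -- The resolvent identity has supplied the factor y - z, and (y-z)·ck_δ(y-z) is bounded by 1 and
  -- tends to 1 off the diagonal.
  refine tendsto_integral_filter_of_dominated_convergence _ ?_ ?_ i3.abs ?_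
  · refine Eventually.of_forall fun δ => ?_
    refine AEStronglyMeasurable.mul (Measurable.aestronglyMeasurable ?_) i3.aestronglyMeasurable
    exact (measurable_fst.sub measurable_snd).mul ((measurable_ck δ).comp (by fun_prop))
  · refine Eventually.of_forall fun δ => Eventually.of_forall fun p => ?_
    rw [Real.norm_eq_abs, abs_mul]
    exact mul_le_of_le_one_left (abs_nonneg _) (abs_mul_ck_le_one δ _)
  · filter_upwards [ae_prod_ne] with p hp
    have := (tendsto_mul_ck (sub_ne_zero.mpr hp)).mul_const
      ((ck ε (x - p.1) * ck ε (x - p.2) - pk ε (x - p.1) * pk ε (x - p.2)) * g p.2 *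
          F p.1 p.2)
    refine this.trans (le_of_eq ?_)
    congr 1
    ring

end

end CriticalHilbert

/-! ### Removing the two regularisations -/

namespace CriticalHilbert

section

variable {ω Ω : ℝ → ℝ} {K C C' A B : ℝ} {F P : ℝ → ℝ → ℝ} {g : ℝ → ℝ}

theorem SymKernel.hasMod_mul (hF : SymKernel ω A C F) (hg : HasMod ω B g) (y : ℝ) :
    HasMod ω (2 * C * (2 * B)) fun z => F y z * (g y + g z) := by
  have hB := hg.nonneg
  have h1 : HasMod ω (2 * B) fun z => g y + g z := by
    refine ⟨fun z => ?_, fun z w => ?_⟩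
    · exact (abs_add_le _ _).trans (by linarith [hg.bdd y, hg.bdd z])
    · rw [add_sub_add_left_eq_sub]
      exact (hg.diff z w).trans (by nlinarith [(abs_nonneg _).trans (hg.diff z w)])
  exact (hF.hasMod_right y).mul h1

theorem SymKernel.decay_mul (hF : SymKernel ω A C F) (hg : HasMod ω B g) (y z : ℝ) :
    |F y z * (g y + g z)| * (1 + |y - z|) ≤ 2 * B * C := by
  have hB := hg.nonneg
  have h1 : |g y + g z| ≤ 2 * B := (abs_add_le _ _).trans (by linarith [hg.bdd y, hg.bdd z])
  rw [abs_mul]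
  calc |F y z| * |g y + g z| * (1 + |y - z|) = |g y + g z| * (|F y z| * (1 + |y - z|)) := by ring
    _ ≤ _ := mul_le_mul h1 (hF.decay y z) (mul_nonneg (abs_nonneg _) (by positivity))
      (by positivity)

theorem SymKernel.pvBound_mul (hF : SymKernel ω A C F) (h : ModData ω Ω K) (hg : HasMod ω B g)
    (y : ℝ) : PVBound (fun z => F y z * (g y + g z)) y
      (2 * (2 * C * (2 * B)) * K + 2 * B * C * 3) :=
  (hF.hasMod_mul hg y).pvBound h (mul_nonneg (mul_nonneg (mul_nonneg zero_le_two hg.nonneg)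
    hF.nonneg) (by norm_num)) (lb_far_of_decay y (hF.decay_mul hg y))

/-- The regularised inner integral decays, uniformly in the regularisation. -/
theorem exists_decay_ck {b : ℝ → ℝ → ℝ} {c E : ℝ} (hA : 0 ≤ A)
    (hbm : Measurable fun p : ℝ × ℝ => b p.1 p.2) (hb : ∀ y, PVBound (b y) y c)
    (hE : ∀ y z, |b y z| ≤ E) (hs : ∀ y z, A < |y| → A < |z| → b y z = 0) :
    ∃ D, ∀ δ, 0 < δ → HasDecay D fun y => ∫ z, ck δ (y - z) * b y z := by
  have hc0 : 0 ≤ c := (hb 0).nonneg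
  have hE0 : 0 ≤ E := (abs_nonneg _).trans (hE 0 0)
  refine ⟨c * (2 * A + 2) + 8 * A * E, fun δ hδ y => ?_⟩
  have hm : AEStronglyMeasurable (b y) volume :=
    (hbm.comp measurable_prodMk_left).aestronglyMeasurable
  rcases le_or_gt |y| (2 * A + 1) with hy | hy
  · have h1 := (hb y).abs_integral_ck_le hm hδ
    have : |∫ z, ck δ (y - z) * b y z| * (1 + |y|) ≤ c * (2 * A + 2) :=
      mul_le_mul h1 (by linarith) (by positivity) hc0
    have : 0 ≤ 8 * A * E := by positivity
    linarith
  · have hy0 : 0 < |y| := by linarith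
    have hs : ∀ z, z ∉ near 0 A → ck δ (y - z) * b y z = 0 := by
      intro z hz
      have hz1 : A < |z| := by
        have : ¬ |0 - z| ≤ A := hz
        simpa using this
      rw [hs y z (by linarith) hz1, mul_zero]
    show |∫ z, ck δ (y - z) * b y z| * (1 + |y|) ≤ _
    rw [← setIntegral_eq_integral_of_forall_compl_eq_zero hs]
    have h1 : ‖∫ z in near 0 A, ck δ (y - z) * b y z‖
        ≤ 2 / |y| * E * volume.real (near 0 A) := by
      refine norm_setIntegral_le_of_norm_le_const (volume_near_lt_top 0 A) fun z hz => ?_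
      have hz1 : |z| ≤ A := by
        have : |0 - z| ≤ A := hz
        simpa using this
      have h2 : |y| / 2 ≤ |y - z| := by
        have := abs_sub_abs_le_abs_sub y z
        linarith
      rw [Real.norm_eq_abs, abs_mul]
      refine mul_le_mul ((abs_ck_le δ _).trans ?_) (hE y z) (abs_nonneg _) (by positivity)
      rw [div_le_div_iff₀ (by linarith) hy0]
      linarith
    have hv : volume.real (near 0 A) = 2 * A := by
      rw [near_eq_Icc, Real.volume_real_Icc_of_le (by linarith)]; ring
    rw [hv, Real.norm_eq_abs] at h1
    have h4 : 2 / |y| * (1 + |y|) ≤ 4 := by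
      rw [div_mul_eq_mul_div, div_le_iff₀ hy0]; linarith
    calc _ ≤ 2 / |y| * E * (2 * A) * (1 + |y|) :=
          mul_le_mul_of_nonneg_right h1 (by positivity)
      _ = 2 / |y| * (1 + |y|) * (2 * A * E) := by ring
      _ ≤ 4 * (2 * A * E) := mul_le_mul_of_nonneg_right h4 (by positivity)
      _ ≤ _ := by
        have : 0 ≤ c * (2 * A + 2) := by positivity
        linarith

/-- Removing the inner regularisation. -/
theorem tendsto_inner {b : ℝ → ℝ → ℝ} {c E : ℝ} (hA : 0 ≤ A)
    (hbm : Measurable fun p : ℝ × ℝ => b p.1 p.2) (hb : ∀ y, PVBound (b y) y c)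
    (hE : ∀ y z, |b y z| ≤ E) (hs : ∀ y z, A < |y| → A < |z| → b y z = 0) {S : ℝ → ℝ}
    (hS : ∀ y, HasPV (fun z => b y z / (y - z)) y (S y)) (x : ℝ) {ε : ℝ} (hε : 0 < ε) :
    Tendsto (fun δ => ∫ y, ck ε (x - y) * ∫ z, ck δ (y - z) * b y z)
      (𝓝[>] 0) (𝓝 (∫ y, ck ε (x - y) * S y)) := by
  obtain ⟨D, hD⟩ := exists_decay_ck hA hbm hb hE hs
  have hD0 : 0 ≤ D := (mul_nonneg (abs_nonneg _) (by positivity)).trans (hD 1 one_pos 0)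
  -- One power of decay comes from the outer kernel ck ε and one from the inner integral, uniformly
  -- in δ.
  have hi : Integrable fun y : ℝ => (1 / ε + 1) * (1 + |x|) * D * (1 / (1 + |y|) ^ 2) := by
    refine Integrable.const_mul (LB.integrable (c := 4) ?_
      (show Measurable fun z : ℝ => 1 / (1 + |z|) ^ 2 by fun_prop).aestronglyMeasurable) _
    refine (lb_inv_one_add_sq 0).mono_fun MeasurableSet.univ fun z _ => ?_
    rw [abs_of_nonneg (by positivity), zero_sub, abs_neg]
  refine tendsto_integral_filter_of_dominated_convergence _ ?_ ?_ hi ?_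
  · refine Eventually.of_forall fun δ => ?_
    refine (((measurable_ck ε).comp (by fun_prop)).aestronglyMeasurable).mul ?_
    have hm : Measurable fun p : ℝ × ℝ => ck δ (p.1 - p.2) * b p.1 p.2 :=
      ((measurable_ck δ).comp (by fun_prop)).mul hbm
    exact (hm.stronglyMeasurable.integral_prod_right').aestronglyMeasurable
  · filter_upwards [self_mem_nhdsWithin] with δ hδ
    refine Eventually.of_forall fun y => ?_
    have h1 := hD δ hδ y
    have h2 := abs_ck_mul_le hε (x - y)
    have h3 : 1 + |y| ≤ (1 + |x|) * (1 + |x - y|) := by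
      have : |y| ≤ |x| + |x - y| := by
        calc |y| = |x - (x - y)| := by congr 1; ring
          _ ≤ _ := abs_sub _ _
      nlinarith [abs_nonneg x, abs_nonneg (x - y), mul_nonneg (abs_nonneg x) (abs_nonneg (x - y))]
    rw [Real.norm_eq_abs, abs_mul, mul_one_div, le_div_iff₀ (by positivity)]
    set I := |∫ z, ck δ (y - z) * b y z| with hI
    have hI0 : 0 ≤ I := abs_nonneg _
    calc |ck ε (x - y)| * I * (1 + |y|) ^ 2
        = (|ck ε (x - y)| * (1 + |y|)) * (I * (1 + |y|)) := by ring
      _ ≤ (|ck ε (x - y)| * ((1 + |x|) * (1 + |x - y|))) * D :=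
          mul_le_mul (mul_le_mul_of_nonneg_left h3 (abs_nonneg _)) h1 (by positivity)
            (by positivity)
      _ = (|ck ε (x - y)| * (1 + |x - y|)) * (1 + |x|) * D := by ring
      _ ≤ (1 / ε + 1) * (1 + |x|) * D := by gcongr
  · refine Eventually.of_forall fun y => ?_
    exact ((hb y).tendsto_ck (hbm.comp measurable_prodMk_left).aestronglyMeasurable
      (hS y)).const_mul _

/-- The regularised Hilbert transform of the symmetrised operator. -/
theorem SymKernel.integral_ck_eq (hF : SymKernel ω A C F) (h : ModData ω Ω K) (hA : 0 ≤ A)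
    (hg : HasMod ω B g) {S : ℝ → ℝ}
    (hS : ∀ y, HasPV (fun z => F y z * (g y + g z) / (y - z)) y (S y)) (x : ℝ) {ε : ℝ}
    (hε : 0 < ε) :
    ∫ y, ck ε (x - y) * S y = (∫ z, ck ε (x - z) * (g z * ∫ y, ck ε (x - y) * F y z)) -
        ∫ z, pk ε (x - z) * (g z * ∫ y, pk ε (x - y) * F y z) := by
  have hgc := (hg.continuous h).measurable
  refine tendsto_nhds_unique (tendsto_inner (A := A) hA
    (b := fun y z => F y z * (g y + g z)) ((hF.toPreKernel.continuous h).measurable.mul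
      ((hgc.comp measurable_fst).add (hgc.comp measurable_snd)))
    (hF.pvBound_mul h hg) (fun y z => (hF.hasMod_mul hg y).bdd z)
    (fun y z hy hz => by rw [hF.supp y z hy hz, zero_mul]) hS x hε) ?_
  refine (hF.tendsto_symm h hA (hg.continuous h) hg.bdd x hε).congr' ?_
  filter_upwards [self_mem_nhdsWithin] with δ hδ
  exact (hF.integral_symm h hA (hg.continuous h) hg.bdd x hε hδ).symm

/-- The inner Poisson integrals are bounded by πC, and the outer one concentrates at x, where g
vanishes. For general g the limit would be the Poincaré–Bertrand term π² g(x)F(x,x). -/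
theorem SymKernel.tendsto_pk_pk (hF : SymKernel ω A C F) (h : ModData ω Ω K)
    (hg : HasMod ω B g) {x : ℝ} (hx : g x = 0) :
    Tendsto (fun ε => ∫ z, pk ε (x - z) * (g z * ∫ y, pk ε (x - y) * F y z))
      (𝓝[>] 0) (𝓝 0) := by
  have hgc := hg.continuous h
  have h1 := (tendsto_integral_pk (u := fun z => |g z|) hgc.abs (B := B) (x := x)
    (fun y => by rw [abs_abs]; exact hg.bdd y) (by simp [hx])).const_mul (C * Real.pi)
  rw [mul_zero] at h1
  refine squeeze_zero_norm' ?_ h1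
  filter_upwards [self_mem_nhdsWithin] with ε hε
  have hε0 : 0 < ε := hε
  have hin : ∀ z, |∫ y, pk ε (x - y) * F y z| ≤ C * Real.pi := by
    intro z
    rw [← integral_pk hε0 x, ← integral_const_mul, ← Real.norm_eq_abs]
    refine norm_integral_le_of_norm_le ((integrable_pk hε0 x).const_mul C)
      (Eventually.of_forall fun y => ?_)
    rw [Real.norm_eq_abs, abs_mul, abs_of_nonneg (pk_nonneg hε0 _), mul_comm]
    exact mul_le_mul_of_nonneg_right (hF.bdd y z) (pk_nonneg hε0 _)
  rw [← integral_const_mul]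
  refine norm_integral_le_of_norm_le ?_ (Eventually.of_forall fun z => ?_)
  · refine Integrable.const_mul ?_ _
    exact (integrable_pk hε0 x).mul_bdd (c := B) hgc.abs.aestronglyMeasurable
      (Eventually.of_forall fun z => by rw [Real.norm_eq_abs, abs_abs]; exact hg.bdd z)
  · rw [Real.norm_eq_abs, abs_mul, abs_mul, abs_of_nonneg (pk_nonneg hε0 _)]
    calc pk ε (x - z) * (|g z| * |∫ y, pk ε (x - y) * F y z|)
        ≤ pk ε (x - z) * (|g z| * (C * Real.pi)) :=
          mul_le_mul_of_nonneg_left (mul_le_mul_of_nonneg_left (hin z) (abs_nonneg _))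
            (pk_nonneg hε0 _)
      _ = _ := by ring

/-- The inner integrals converge to P(x,z) with a bound that is uniform in ε. Since g(x) = 0, the
factor g(z)/(x-z) is Dini-integrable near x, so the outer limit needs no principal value. -/
theorem SymKernel.tendsto_ck_ck (hF : SymKernel ω A C F) (h : ModData ω Ω K)
    (hg : HasMod ω B g) (hP : ∀ x z, HasPV (fun y => F y z / (x - y)) x (P x z)) {x : ℝ}
    (hx : g x = 0) {L : ℝ} (hL : HasPV (fun z => g z * P x z / (x - z)) x L) :
    Tendsto (fun ε => ∫ z, ck ε (x - z) * (g z * ∫ y, ck ε (x - y) * F y z))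
      (𝓝[>] 0) (𝓝 L) := by
  have hgc := hg.continuous h
  have hC := hF.nonneg
  have hB := hg.nonneg
  have hK := h.K_pos
  have hFm : ∀ z, AEStronglyMeasurable (fun y => F y z) volume := fun z =>
    ((hF.hasMod_left z).continuous h).aestronglyMeasurable
  have hPm := hF.measurable_partial h hP x
  -- An ε-independent majorant of the inner integrals: constant near x, and decaying like
  -- |x-z|^(-1/4) far away so that the outer integral converges.
  set G : ℝ → ℝ := fun z => if |x - z| ≤ 1 then 5 * C * K else
    20 * C * K * |x - z| ^ (-(1 / 4) : ℝ) with hG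
  have hGb : ∀ z, PVBound (fun y => F y z) x (G z) := by
    intro z
    simp only [hG]
    split_ifs with h1
    · exact hF.pvBound h x z
    · exact hF.pvBound_far h (not_le.mp h1)
  have hG0 : ∀ z, 0 ≤ G z := fun z => (hGb z).nonneg
  have hGm : Measurable G := by
    refine Measurable.ite (measurableSet_near x 1) measurable_const ?_
    fun_prop
  have hdom : Integrable fun z => |g z| / |x - z| * G z := by
    refine LB.integrable (c := 5 * C * K * (B * (2 * Ω 1)) + B * (20 * C * K) * 8) ?_
      (((hgc.abs.measurable.div (by fun_prop)).mul hGm).aestronglyMeasurable)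
    refine LB.univ_of (x := x) (r := 1) ?_ ?_
      (mul_nonneg (by positivity) (mul_nonneg hB (by linarith [h.nonneg' 1]))) (by positivity)
    · refine ((hg.lb_near h x le_rfl).const_mul (a := 5 * C * K) (by positivity)).mono_fun
        (measurableSet_near _ _) fun z hz => ?_
      have hz1 : |x - z| ≤ 1 := hz
      rw [abs_of_nonneg (mul_nonneg (by positivity) (hG0 z)), hx, sub_zero]
      simp only [hG, if_pos hz1]
      exact le_of_eq (mul_comm _ _)
    · refine lb_of_abs_le (measurableSet_far _ _)
        ((lb_far_rpow x one_pos (a := 1 / 4) (by norm_num)).mono_const (by norm_num))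
        (by positivity) fun z hz => ?_
      have hz1 : 1 < |x - z| := hz
      have hz0 : 0 < |x - z| := by linarith
      rw [abs_of_nonneg (mul_nonneg (by positivity) (hG0 z))]
      simp only [hG, if_neg (not_le.mpr hz1)]
      rw [show (-1 - 1 / 4 : ℝ) = -(1 / 4) - 1 by norm_num, Real.rpow_sub hz0, Real.rpow_one]
      have hr := Real.rpow_nonneg hz0.le (-(1 / 4) : ℝ)
      calc |g z| / |x - z| * (20 * C * K * |x - z| ^ (-(1 / 4) : ℝ))
          = |g z| * (20 * C * K * (|x - z| ^ (-(1 / 4) : ℝ) / |x - z|)) := by ring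
        _ ≤ B * (20 * C * K * (|x - z| ^ (-(1 / 4) : ℝ) / |x - z|)) :=
            mul_le_mul_of_nonneg_right (hg.bdd z) (by positivity)
        _ = _ := by ring
  have hPG : ∀ z, |P x z| ≤ G z := fun z => (hGb z).abs_le (hFm z) (hP x z)
  have hint : Integrable fun z => g z * P x z / (x - z) := by
    refine hdom.mono' ((hgc.measurable.mul hPm).div (by fun_prop)).aestronglyMeasurable
      (Eventually.of_forall fun z => ?_)
    rw [Real.norm_eq_abs, abs_div, abs_mul, mul_div_right_comm]
    exact mul_le_mul_of_nonneg_left (hPG z) (by positivity)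
  rw [hL.unique (hasPV_of_integrable hint x)]
  refine tendsto_integral_filter_of_dominated_convergence _ ?_ ?_ hdom ?_
  · refine Eventually.of_forall fun ε => ?_
    refine (((measurable_ck ε).comp (by fun_prop)).aestronglyMeasurable).mul
      (hgc.aestronglyMeasurable.mul ?_)
    have hm : Measurable fun p : ℝ × ℝ => ck ε (x - p.2) * F p.2 p.1 :=
      ((measurable_ck ε).comp (by fun_prop)).mul
        ((hF.toPreKernel.continuous h).comp continuous_swap).measurable
    exact (hm.stronglyMeasurable.integral_prod_right').aestronglyMeasurable
  · filter_upwards [self_mem_nhdsWithin] with ε hε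
    refine Eventually.of_forall fun z => ?_
    have h1 := (hGb z).abs_integral_ck_le (hFm z) hε
    rw [Real.norm_eq_abs, abs_mul, abs_mul]
    calc |ck ε (x - z)| * (|g z| * |∫ y, ck ε (x - y) * F y z|)
        ≤ 1 / |x - z| * (|g z| * G z) := mul_le_mul (abs_ck_le _ _)
          (mul_le_mul_of_nonneg_left h1 (abs_nonneg _)) (by positivity) (by positivity)
      _ = _ := by ring
  · filter_upwards [show ∀ᵐ z : ℝ, z ≠ x by simp [ae_iff, measure_singleton]] with z hz
    have hz0 : x - z ≠ 0 := sub_ne_zero.mpr hz.symm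
    have h1 := (hGb z).tendsto_ck (hFm z) (hP x z)
    have h2 := ((tendsto_mul_ck hz0).const_mul (1 / (x - z))).mul (h1.const_mul (g z))

    rw [show 1 / (x - z) * 1 * (g z * P x z) = g z * P x z / (x - z) by ring] at h2
    exact h2.congr fun ε => by field_simp

/-- The Hilbert transform of the symmetrised operator is the bilinear remainder. -/
theorem SymKernel.pv_eq (hF : SymKernel ω A C F) (h : ModData ω Ω K) (hA : 0 ≤ A)
    (hg : HasMod ω B g) (hP : ∀ x z, HasPV (fun y => F y z / (x - y)) x (P x z)) {S : ℝ → ℝ}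
    (hS : ∀ y, HasPV (fun z => F y z * (g y + g z) / (y - z)) y (S y))
    (hSm : HasMod ω C' S) (hSd : HasDecay C' S) {x : ℝ} (hx : g x = 0) {L L' : ℝ}
    (hL : HasPV (fun y => S y / (x - y)) x L)
    (hL' : HasPV (fun z => g z * P x z / (x - z)) x L') : L = L' := by
  have h1 := (hSm.pvBound h (mul_nonneg hSm.nonneg (by norm_num)) (hSd.lb_far x)).tendsto_ck
    (hSm.continuous h).aestronglyMeasurable hL
  have h2 := (hF.tendsto_ck_ck h hg hP hx hL').sub (hF.tendsto_pk_pk h hg hx)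
  rw [sub_zero] at h2
  refine tendsto_nhds_unique h1 (h2.congr' ?_)
  filter_upwards [self_mem_nhdsWithin] with ε hε
  exact (hF.integral_ck_eq h hA hg hS x hε).symm

end

end CriticalHilbert

namespace CriticalHilbert

/-! ### Inversion of the Hilbert transform -/

/-- Partial fractions arranged for p = x - y and q = z - y: the factors in p - q = x - z do not
depend on y. The bracket has principal value zero, and the last term integrates to π. -/
theorem ck_div {ε : ℝ} (hε : 0 < ε) {p q : ℝ} (hq : q ≠ 0) :
    ck ε p / q = ck ε (p - q) * (1 / q - ck ε p) + pk ε (p - q) * pk ε p := by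
  have h1 : p ^ 2 + ε ^ 2 ≠ 0 := by positivity
  have h2 : (p - q) ^ 2 + ε ^ 2 ≠ 0 := by positivity
  unfold ck pk
  field_simp
  ring

/-- Oddness gives zero about x. The function is bounded and O(1/|z-y|) at infinity, so the centre
can be moved to z. -/
theorem hasPV_ck {ε : ℝ} (hε : 0 < ε) (x z : ℝ) : HasPV (fun y => ck ε (x - y)) z 0 := by
  have hm : Measurable fun y => ck ε (x - y) := (measurable_ck ε).comp (by fun_prop)
  have hb : ∀ y, ‖ck ε (x - y)‖ ≤ 1 / ε := fun y => abs_ck_le_inv hε _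
  refine HasPV.recentre (x' := x) (ρ := 1) (B := 1 + |z - x| / ε) ?_ one_pos
    hm.aestronglyMeasurable ?_ fun y hy => ?_
  · refine hasPV_odd (fun δ R _ => ?_) fun y => ?_
    · exact Measure.integrableOn_of_bounded (volume_annulus_lt_top x δ R).ne
        hm.aestronglyMeasurable (Eventually.of_forall hb)
    · rw [← ck_neg]; congr 1; ring
  · exact Measure.integrableOn_of_bounded (volume_near_lt_top z 1).ne
      hm.aestronglyMeasurable (Eventually.of_forall hb)
  · rw [le_div_iff₀ (by linarith)]
    have h1 : |z - y| ≤ |x - y| + |z - x| := by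
      calc |z - y| = |(x - y) + (z - x)| := by congr 1; ring
        _ ≤ _ := abs_add_le _ _
    have h2 : |ck ε (x - y)| * |x - y| ≤ 1 := by
      rw [mul_comm, ← abs_mul]; exact abs_mul_ck_le_one _ _
    calc |ck ε (x - y)| * |z - y| ≤ |ck ε (x - y)| * (|x - y| + |z - x|) :=
          mul_le_mul_of_nonneg_left h1 (abs_nonneg _)
      _ = |ck ε (x - y)| * |x - y| + |ck ε (x - y)| * |z - x| := mul_add _ _ _
      _ ≤ 1 + 1 / ε * |z - x| :=
          add_le_add h2 (mul_le_mul_of_nonneg_right (hb y) (abs_nonneg _))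
      _ = _ := by ring

/-- The Hilbert transform of the conjugate Poisson kernel. -/
theorem hasPV_ck_div {ε : ℝ} (hε : 0 < ε) (x z : ℝ) :
    HasPV (fun y => ck ε (x - y) / (z - y)) z (Real.pi * pk ε (x - z)) := by
  have h1 := ((hasPV_const_div z 1).sub (hasPV_ck hε x z)).const_mul (ck ε (x - z))
  have h2 := (hasPV_of_integrable (integrable_pk hε x) z).const_mul (pk ε (x - z))
  have h3 := h1.add h2
  rw [integral_pk hε, sub_zero, mul_zero, zero_add, mul_comm] at h3
  refine h3.congr_ne z fun y hy => ?_
  rw [ck_div hε (sub_ne_zero.mpr hy.symm), sub_sub_sub_cancel_right]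

theorem abs_ck_sub_le {ε : ℝ} (hε : 0 < ε) (p q : ℝ) :
    |ck ε p - ck ε q| ≤ 2 / ε ^ 2 * |p - q| := by
  have h1 := ck_mul_ck_sub hε 1 p q
  rw [one_mul, one_mul] at h1
  have hp : ∀ t, |pk ε t| ≤ 1 / ε := fun t => by
    rw [abs_of_nonneg (pk_nonneg hε t), pk, div_le_div_iff₀ (by positivity) hε]
    nlinarith [sq_nonneg t]
  have hc : ∀ t, |ck ε t| ≤ 1 / ε := abs_ck_le_inv hε
  rw [h1, abs_mul, abs_sub_comm, mul_comm]
  refine mul_le_mul_of_nonneg_right ?_ (abs_nonneg _)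
  calc |ck ε p * ck ε q - pk ε p * pk ε q| ≤ |ck ε p * ck ε q| + |pk ε p * pk ε q| := abs_sub _ _
    _ ≤ 1 / ε * (1 / ε) + 1 / ε * (1 / ε) := by
        rw [abs_mul, abs_mul]
        exact add_le_add (mul_le_mul (hc p) (hc q) (abs_nonneg _) (by positivity))
          (mul_le_mul (hp p) (hp q) (abs_nonneg _) (by positivity))
    _ = _ := by field_simp; ring

theorem pvBound_ck {ε : ℝ} (hε : 0 < ε) (x z : ℝ) :
    PVBound (fun y => ck ε (x - y)) z (2 * (2 / ε ^ 2) + (1 / ε + 1) * 3) := by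
  refine ⟨1, ck ε (x - z), 2 * (2 / ε ^ 2), (1 / ε + 1) * 3, ?_,
    lb_far_of_decay (w := x) z fun y => abs_ck_mul_le hε (x - y), by positivity, by positivity,
    le_rfl⟩
  have hc : LB (near z 1) (fun _ => 2 / ε ^ 2) (2 * (2 / ε ^ 2)) := by
    unfold LB
    rw [near_eq_Icc, setLIntegral_const, Real.volume_Icc, ← ENNReal.ofReal_mul (by positivity)]
    apply ENNReal.ofReal_le_ofReal
    exact le_of_eq (by ring)
  refine hc.mono_fun_ae (measurableSet_near _ _) z fun y _ hyz => ?_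
  rw [div_le_iff₀ (abs_pos.mpr (sub_ne_zero.mpr hyz.symm))]
  have := abs_ck_sub_le hε (x - y) (x - z)
  rwa [sub_sub_sub_cancel_left] at this

section

variable {ω Ω : ℝ → ℝ} {K C C' A B : ℝ} {g : ℝ → ℝ}

theorem hasDecay_of_support (hg : HasMod ω B g) (hA : 0 ≤ A)
    (hs : ∀ y, A < |y| → g y = 0) :
    HasDecay (B * (1 + A)) g := by
  intro y
  rcases le_or_gt |y| A with hy | hy
  · exact mul_le_mul (hg.bdd y) (by linarith) (by positivity) hg.nonneg
  · rw [hs y hy, abs_zero, zero_mul]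
    exact mul_nonneg hg.nonneg (by linarith)

/-- Regularised form of H² = -1. The inner transform is regularised and Fubini moves both kernels
onto each other; removing the inner parameter then leaves the Hilbert transform of ck ε, which is a
Poisson kernel. -/
theorem integral_ck_hilbert (h : ModData ω Ω K) (hA : 0 ≤ A) (hg : HasMod ω B g)
    (hs : ∀ y, A < |y| → g y = 0) {S : ℝ → ℝ}
    (hS : ∀ y, HasPV (fun z => g z / (y - z)) y (S y)) (x : ℝ) {ε : ℝ} (hε : 0 < ε) :
    ∫ y, ck ε (x - y) * S y = -(Real.pi * ∫ z, pk ε (x - z) * g z) := by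
  have hB := hg.nonneg
  have hgc := hg.continuous h
  have hd := hasDecay_of_support hg hA hs
  have h1 := tendsto_inner (A := A) hA (b := fun _ z => g z) (hgc.measurable.comp measurable_snd)
    (fun y => hg.pvBound h (mul_nonneg ((mul_nonneg (abs_nonneg _) (by positivity)).trans (hd 0))
      (by norm_num)) (hd.lb_far y)) (fun _ z => hg.bdd z) (fun _ z _ hz => hs z hz) hS x hε
  refine tendsto_nhds_unique h1 ?_
  have hckm : Measurable fun y => ck ε (x - y) := (measurable_ck ε).comp (by fun_prop)
  have hcb : ∀ z, PVBound (fun y => ck ε (x - y)) z (2 * (2 / ε ^ 2) + (1 / ε + 1) * 3) :=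
    pvBound_ck hε x
  have hgi : Integrable g := by
    refine (integrableOn_iff_integrable_of_support_subset (s := near 0 A) fun y hy => ?_).mp
      (Measure.integrableOn_of_bounded (M := B) (volume_near_lt_top 0 A).ne
        hgc.aestronglyMeasurable (Eventually.of_forall hg.bdd))
    by_contra hcon
    have : ¬ |0 - y| ≤ A := hcon
    exact hy (hs y (by simpa using this))
  have h2 : Tendsto (fun δ => ∫ z, -(g z * ∫ y, ck δ (z - y) * ck ε (x - y))) (𝓝[>] 0)
      (𝓝 (∫ z, -(g z * (Real.pi * pk ε (x - z))))) := by
    refine tendsto_integral_filter_of_dominated_convergence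
      (fun z => |g z| * (2 * (2 / ε ^ 2) + (1 / ε + 1) * 3)) ?_ ?_ (hgi.abs.mul_const _) ?_
    · refine Eventually.of_forall fun δ => ?_
      refine (hgc.aestronglyMeasurable.mul ?_).neg
      have hm : Measurable fun p : ℝ × ℝ => ck δ (p.1 - p.2) * ck ε (x - p.2) :=
        ((measurable_ck δ).comp (by fun_prop)).mul ((measurable_ck ε).comp (by fun_prop))
      exact (hm.stronglyMeasurable.integral_prod_right').aestronglyMeasurable
    · filter_upwards [self_mem_nhdsWithin] with δ hδ
      refine Eventually.of_forall fun z => ?_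
      rw [norm_neg, Real.norm_eq_abs, abs_mul]
      exact mul_le_mul_of_nonneg_left
        ((hcb z).abs_integral_ck_le hckm.aestronglyMeasurable hδ) (abs_nonneg _)
    · exact Eventually.of_forall fun z => (((hcb z).tendsto_ck hckm.aestronglyMeasurable
        (hasPV_ck_div hε x z)).const_mul (g z)).neg
  have e2 : ∫ z, -(g z * (Real.pi * pk ε (x - z))) = -(Real.pi * ∫ z, pk ε (x - z) * g z) := by
    rw [integral_neg, ← integral_const_mul]
    congr 2
    ext z; ring
  rw [e2] at h2
  refine h2.congr' ?_
  filter_upwards [self_mem_nhdsWithin] with δ hδ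
  have hδ0 : 0 < δ := hδ
  have hint : Integrable fun p : ℝ × ℝ => ck ε (x - p.1) * ck δ (p.1 - p.2) * g p.2 := by
    refine integrable_of_strip (A := A)
      (B := (1 / ε + 1) * (1 / δ + 1) * (1 + |x| + A) * B) ?_ hA (fun p => ?_)
      fun p _ hp => by rw [hs _ hp, mul_zero]
    · exact ((((measurable_ck ε).comp (by fun_prop)).mul ((measurable_ck δ).comp
        (by fun_prop))).mul (hgc.measurable.comp measurable_snd)).aestronglyMeasurable
    · rcases le_or_gt |p.2| A with hp | hp
      · have h3 : 1 + |p.1 - p.2| ≤ (1 + |x - p.1|) * (1 + |x| + A) := by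
          have : |p.1 - p.2| ≤ |x - p.1| + (|x| + |p.2|) := by
            calc |p.1 - p.2| = |(x - p.2) - (x - p.1)| := by congr 1; ring
              _ ≤ |x - p.2| + |x - p.1| := abs_sub _ _
              _ ≤ _ := by linarith [abs_sub x p.2]
          nlinarith [abs_nonneg x, abs_nonneg (x - p.1),
            mul_nonneg (abs_nonneg (x - p.1)) (abs_nonneg x),
            mul_nonneg (abs_nonneg (x - p.1)) hA]
        rw [abs_mul, abs_mul]
        have e1 := abs_ck_mul_le hε (x - p.1)
        have e2 := abs_ck_mul_le hδ0 (p.1 - p.2)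
        calc |ck ε (x - p.1)| * |ck δ (p.1 - p.2)| * |g p.2| * (1 + |p.1 - p.2|) ^ 2
            = |ck ε (x - p.1)| * (1 + |p.1 - p.2|) * (|ck δ (p.1 - p.2)| * (1 + |p.1 - p.2|)) *
                |g p.2| := by ring
          _ ≤ |ck ε (x - p.1)| * ((1 + |x - p.1|) * (1 + |x| + A)) * (1 / δ + 1) * B := by
              refine mul_le_mul (mul_le_mul (mul_le_mul_of_nonneg_left h3 (abs_nonneg _)) e2
                (by positivity) (by positivity)) (hg.bdd _) (abs_nonneg _) (by positivity)
          _ = |ck ε (x - p.1)| * (1 + |x - p.1|) * ((1 + |x| + A) * (1 / δ + 1) * B) := by ring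
          _ ≤ (1 / ε + 1) * ((1 + |x| + A) * (1 / δ + 1) * B) :=
              mul_le_mul_of_nonneg_right e1 (by positivity)
          _ = _ := by ring
      · rw [hs _ hp, mul_zero, abs_zero, zero_mul]; positivity
  have e3 : ∀ y, ck ε (x - y) * ∫ z, ck δ (y - z) * g z
      = ∫ z, ck ε (x - y) * ck δ (y - z) * g z := fun y => by
    rw [← integral_const_mul]; congr 1; ext z; ring
  have e4 : ∀ z, -(g z * ∫ y, ck δ (z - y) * ck ε (x - y))
      = ∫ y, ck ε (x - y) * ck δ (y - z) * g z := fun z => by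
    rw [← integral_const_mul, ← integral_neg]; congr 1; ext y
    rw [← neg_sub z y, ck_neg]; ring
  simp only [e3, e4]
  exact (integral_integral_swap (f := fun y z => ck ε (x - y) * ck δ (y - z) * g z) hint).symm

theorem tendsto_pk {u : ℝ → ℝ} (hu : Continuous u) (hB : ∀ y, |u y| ≤ B) (x : ℝ) :
    Tendsto (fun ε => ∫ y, pk ε (x - y) * u y) (𝓝[>] 0) (𝓝 (Real.pi * u x)) := by
  have h1 := tendsto_integral_pk (u := fun y => u y - u x) (by fun_prop) (B := B + B) (x := x)
    (fun y => (abs_sub _ _).trans (add_le_add (hB y) (hB x))) (sub_self _)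
  have h2 := h1.add_const (Real.pi * u x)
  rw [zero_add] at h2
  refine h2.congr' ?_
  filter_upwards [self_mem_nhdsWithin] with ε hε
  have i1 := integrable_pk hε x
  have i2 : Integrable fun y => pk ε (x - y) * u y :=
    i1.mul_bdd (c := B) hu.aestronglyMeasurable (Eventually.of_forall hB)
  simp only [mul_sub]
  rw [integral_sub i2 (i1.mul_const _), integral_mul_const, integral_pk hε]
  ring

/-- `H² = -1`. -/
theorem hasPV_hilbert_hilbert (h : ModData ω Ω K) (hA : 0 ≤ A) (hg : HasMod ω B g)
    (hs : ∀ y, A < |y| → g y = 0) {S : ℝ → ℝ}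
    (hS : ∀ y, HasPV (fun z => g z / (y - z)) y (S y)) (hSm : HasMod ω C S)
    (hSd : HasDecay C S) (x : ℝ) :
    HasPV (fun y => S y / (x - y)) x (-Real.pi ^ 2 * g x) := by
  have hfar := hSd.lb_far x
  have hC : 0 ≤ C * 3 := mul_nonneg hSm.nonneg (by norm_num)
  obtain ⟨L, hL, -⟩ := hSm.exists_hasPV h hC hfar
  have h1 := (hSm.pvBound h hC hfar).tendsto_ck (hSm.continuous h).aestronglyMeasurable hL
  have h2 := ((tendsto_pk (hg.continuous h) hg.bdd x).const_mul Real.pi).neg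
  have h3 : L = -(Real.pi * (Real.pi * g x)) := by
    refine tendsto_nhds_unique h1 (h2.congr' ?_)
    filter_upwards [self_mem_nhdsWithin] with ε hε
    exact (integral_ck_hilbert h hA hg hs hS x hε).symm
  rwa [h3, show -(Real.pi * (Real.pi * g x)) = -Real.pi ^ 2 * g x by ring] at hL

/-! ### The Hilbert transform commutes with differentiation -/

/-- In the translated variable the kernel 1/t is fixed and only the numerator depends on x, so that
differentiation under the integral becomes possible. -/
theorem HasMod.eq_integral (hg : HasMod ω B g) (h : ModData ω Ω K) (hd : HasDecay C g) (x : ℝ) :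
    (Integrable fun t => (g (x - t) - if |t| ≤ 1 then g x else 0) / t) ∧
      ∀ L, HasPV (fun y => g y / (x - y)) x L →
        L = ∫ t, (g (x - t) - if |t| ≤ 1 then g x else 0) / t := by
  have hC : 0 ≤ C := (mul_nonneg (abs_nonneg _) (by positivity)).trans (hd 0)
  obtain ⟨h1, -, h2⟩ := integrable_sub_step (hg.lb_near h x le_rfl) (hd.lb_far x)
    (mul_nonneg hg.nonneg (by linarith [h.nonneg' 1])) (by positivity)
    (hg.continuous h).aestronglyMeasurable
  refine ⟨by simpa using h1.comp_sub_left x, fun L hL => ?_⟩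
  rw [h2 L hL, ← integral_sub_left_eq_self _ volume x]
  simp

/-- Differentiation under an absolutely convergent integral; the Dini property of the modulus of f'
gives domination at t = 0, and compact support gives it at infinity. -/
theorem hasDerivAt_hilbert (h : ModData ω Ω K) (hA : 0 ≤ A) {f : ℝ → ℝ}
    (hf : Differentiable ℝ f) (hfm : HasMod ω B f) (hf' : HasMod ω B (deriv f))
    (hs : ∀ y, A < |y| → f y = 0) {S S' : ℝ → ℝ}
    (hS : ∀ y, HasPV (fun z => f z / (y - z)) y (S y))
    (hS' : ∀ y, HasPV (fun z => deriv f z / (y - z)) y (S' y)) (x : ℝ) :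
    HasDerivAt S (S' x) x := by
  have hB := hf'.nonneg
  have hs' : ∀ y, A < |y| → deriv f y = 0 := fun y => deriv_eq_zero_of_support hs
  have hd := hasDecay_of_support hfm hA hs
  have hd' := hasDecay_of_support hf' hA hs'
  have e1 : S = fun x => ∫ t, (f (x - t) - if |t| ≤ 1 then f x else 0) / t :=
    funext fun y => (hfm.eq_integral h hd y).2 _ (hS y)
  have e2 := (hf'.eq_integral h hd' x).2 _ (hS' x)
  rw [e1, e2]
  -- The majorant must serve all y within distance 1 of x; for |t| > A + |x| + 1 the point y - t is
  -- then outside the support of f'.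
  set D : ℝ → ℝ := fun t => if |t| ≤ 1 then B * (ω |t| / |t|) else
    if |t| ≤ A + |x| + 1 then B else 0 with hD
  have hDi : Integrable D := by
    have hωm : Measurable fun t : ℝ => ω |t| / |t| :=
      (h.mono.measurable.comp measurable_abs).div measurable_abs
    have hDm : Measurable D := Measurable.ite (measurableSet_le measurable_abs measurable_const)
      (hωm.const_mul B) (Measurable.ite (measurableSet_le measurable_abs measurable_const)
        measurable_const measurable_const)
    refine LB.integrable (c := B * (2 * Ω 1) + ∫ t in near 0 (A + |x| + 1), B) ?_
      hDm.aestronglyMeasurable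
    refine LB.univ_of (x := 0) (r := 1) ?_ ?_ (mul_nonneg hB (by linarith [h.nonneg' 1]))
      (integral_nonneg fun _ => hB)
    · refine ((h.lb_near 0 le_rfl).const_mul hB).mono_fun (measurableSet_near _ _) fun t ht => ?_
      have h1 : |0 - t| ≤ 1 := ht
      rw [zero_sub, abs_neg] at h1 ⊢
      simp only [hD, if_pos h1]
      rw [abs_of_nonneg (mul_nonneg hB (div_nonneg (h.nonneg _) (abs_nonneg _)))]
    · have h1 : LB (near 0 (A + |x| + 1)) (fun _ => B) (∫ t in near 0 (A + |x| + 1), B) :=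
        lb_of_integrableOn (integrableOn_const (volume_near_lt_top _ _).ne) fun _ => hB
      unfold LB at h1 ⊢
      refine le_trans ?_ h1
      rw [← lintegral_indicator (measurableSet_far _ _),
        ← lintegral_indicator (measurableSet_near _ _)]
      refine lintegral_mono fun t => ?_
      by_cases ht : t ∈ far 0 1
      · have ht1 : ¬ |t| ≤ 1 := by
          have : 1 < |0 - t| := ht
          rw [zero_sub, abs_neg] at this
          exact not_le.mpr this
        rw [Set.indicator_of_mem ht]
        simp only [hD, if_neg ht1]
        by_cases ht2 : |t| ≤ A + |x| + 1
        · have : t ∈ near 0 (A + |x| + 1) := show |0 - t| ≤ _ by rwa [zero_sub, abs_neg]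
          rw [Set.indicator_of_mem this, if_pos ht2, abs_of_nonneg hB]
        · simp [if_neg ht2]
      · rw [Set.indicator_of_notMem ht]; exact bot_le
  refine (hasDerivAt_integral_of_dominated_loc_of_deriv_le (bound := D)
    (F' := fun x t => (deriv f (x - t) - if |t| ≤ 1 then deriv f x else 0) / t)
    (Metric.ball_mem_nhds x one_pos) ?_ (hfm.eq_integral h hd x).1
    (hf'.eq_integral h hd' x).1.aestronglyMeasurable ?_ hDi ?_).2
  · exact Eventually.of_forall fun y => (hfm.eq_integral h hd y).1.aestronglyMeasurable
  · refine Eventually.of_forall fun t y hy => ?_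
    have hy1 : |y - x| < 1 := by simpa [Real.dist_eq] using hy
    rw [Real.norm_eq_abs, abs_div]
    simp only [hD]
    by_cases h1 : |t| ≤ 1
    · rw [if_pos h1, if_pos h1, ← mul_div_assoc]
      refine div_le_div_of_nonneg_right ((hf'.diff _ _).trans (le_of_eq ?_)) (abs_nonneg _)
      rw [sub_sub_cancel_left, abs_neg]
    · rw [if_neg h1, if_neg h1, sub_zero]
      have h1' : 1 < |t| := not_le.mp h1
      by_cases h2 : |t| ≤ A + |x| + 1
      · rw [if_pos h2]
        exact (div_le_self (abs_nonneg _) h1'.le).trans (hf'.bdd _)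
      · rw [if_neg h2, hs' _ ?_, abs_zero, zero_div]
        have e3 : |t| ≤ |y - t| + |y| := by
          calc |t| = |y - (y - t)| := by congr 1; ring
            _ ≤ _ := by linarith [abs_sub y (y - t)]
        have e4 : |y| ≤ |x| + |y - x| := by
          calc |y| = |x + (y - x)| := by congr 1; ring
            _ ≤ _ := abs_add_le _ _
        linarith [not_le.mp h2]
  · refine Eventually.of_forall fun t y _ => ?_
    have e3 : HasDerivAt (fun y => f (y - t)) (deriv f (y - t)) y :=
      HasDerivAt.comp_sub_const y t (hf (y - t)).hasDerivAt
    split_ifs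
    · exact (e3.sub (hf y).hasDerivAt).div_const t
    · exact (e3.sub (hasDerivAt_const y 0)).div_const t

end

end CriticalHilbert

/-! ### Integration by parts for difference quotients -/

namespace CriticalHilbert

/-- The principal value of a derivative vanishes. -/
theorem HasPV.eq_zero_of_hasDerivAt {G u : ℝ → ℝ} {x L C : ℝ} (hL : HasPV u x L)
    (hd : ∀ y, y ≠ x → HasDerivAt G (u y) y) (hc : ContinuousAt G x)
    (hdec : ∀ y, |G y| * (1 + |x - y|) ≤ C) : L = 0 := by
  have hinf : ∀ s : ℝ, |s| = 1 → Tendsto (fun p : ℝ × ℝ => G (x + s * p.2)) pvFilter (𝓝 0) := by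
    intro s hs
    have h1 : Tendsto (fun R : ℝ => C / (1 + R)) atTop (𝓝 0) :=
      tendsto_const_nhds.div_atTop (tendsto_atTop_add_const_left _ _ tendsto_id)
    refine squeeze_zero_norm' ?_ (h1.comp tendsto_snd)
    filter_upwards [tendsto_snd.eventually (eventually_gt_atTop 0)] with p hp
    have := hdec (x + s * p.2)
    rw [sub_add_cancel_left, abs_neg, abs_mul, hs, one_mul, abs_of_pos hp] at this
    rw [Function.comp_apply, Real.norm_eq_abs, le_div_iff₀ (by linarith)]
    exact this
  have hzero : ∀ s : ℝ, Tendsto (fun p : ℝ × ℝ => G (x + s * p.1)) pvFilter (𝓝 (G x)) := by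
    intro s
    have h1 : Tendsto (fun t : ℝ => x + s * t) (𝓝[>] 0) (𝓝 x) := by
      have : Continuous fun t : ℝ => x + s * t := by fun_prop
      simpa using (this.tendsto 0).mono_left nhdsWithin_le_nhds
    exact hc.tendsto.comp (h1.comp tendsto_fst)
  -- The four boundary values are G(x-ε) - G(x-R) + G(x+R) - G(x+ε): the inner two cancel by
  -- continuity at x, the outer two vanish by decay.
  have h3 := ((hzero (-1)).sub (hinf (-1) (by simp))).add ((hinf 1 (by simp)).sub (hzero 1))
  rw [sub_zero, zero_sub, add_neg_cancel] at h3
  refine tendsto_nhds_unique hL.2 (h3.congr' ?_)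
  have hlt : ∀ᶠ p : ℝ × ℝ in pvFilter, p.1 < 1 :=
    tendsto_fst.eventually (eventually_nhdsWithin_of_eventually_nhds (eventually_lt_nhds one_pos))
  filter_upwards [eventually_pvFilter_pos, hlt, tendsto_snd.eventually (eventually_gt_atTop 1)]
    with p hp hp1 hp2
  have hset : annulus x p.1 p.2 = Set.Ioo (x - p.2) (x - p.1) ∪ Set.Ioo (x + p.1) (x + p.2) := by
    ext y
    simp only [annulus, Set.mem_ofPred_eq, Set.mem_union, Set.mem_Ioo, lt_abs, abs_lt]
    constructor
    · rintro ⟨h1 | h1, h2, h3⟩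
      · left; constructor <;> linarith
      · right; constructor <;> linarith
    · rintro (⟨h1, h2⟩ | ⟨h1, h2⟩)
      · exact ⟨Or.inl (by linarith), by linarith, by linarith⟩
      · exact ⟨Or.inr (by linarith), by linarith, by linarith⟩
  have hi := hL.1 p.1 p.2 hp
  rw [hset] at hi
  have hdisj : Disjoint (Set.Ioo (x - p.2) (x - p.1)) (Set.Ioo (x + p.1) (x + p.2)) :=
    Set.disjoint_left.mpr fun y h1 h2 => by linarith [h1.2, h2.1]
  have ftc : ∀ a b : ℝ, a < b → (∀ y ∈ Set.Icc a b, y ≠ x) → IntegrableOn u (Set.Ioo a b) →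
      ∫ y in Set.Ioo a b, u y = G b - G a := by
    intro a b hab hx hu
    rw [← integral_Ioc_eq_integral_Ioo, ← intervalIntegral.integral_of_le hab.le]
    refine intervalIntegral.integral_eq_sub_of_hasDerivAt (fun y hy => hd y (hx y ?_)) ?_
    · rwa [Set.uIcc_of_le hab.le] at hy
    · rw [intervalIntegrable_iff_integrableOn_Ioo_of_le hab.le]; exact hu
  rw [hset, setIntegral_union hdisj measurableSet_Ioo hi.left_of_union hi.right_of_union,
    ftc _ _ (by linarith) (fun y hy => by linarith [hy.2] |> ne_of_lt) hi.left_of_union,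
    ftc _ _ (by linarith) (fun y hy => by linarith [hy.1] |> ne_of_gt) hi.right_of_union]
  congr 2 <;> · congr 1; ring

theorem hasDerivAt_dq {g : ℝ → ℝ} (hg : Differentiable ℝ g) {x y : ℝ} (hxy : y ≠ x) :
    HasDerivAt (dq g x) ((dq g x y - deriv g y) / (x - y)) y := by
  have h0 : x - y ≠ 0 := sub_ne_zero.mpr hxy.symm
  have h1 : HasDerivAt (fun y => (g x - g y) / (x - y))
      ((-deriv g y * (x - y) - (g x - g y) * (-1)) / (x - y) ^ 2) y :=
    ((hg y).hasDerivAt.const_sub (g x)).div ((hasDerivAt_id y).const_sub x) h0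
  have h2 : dq g x =ᶠ[𝓝 y] fun y => (g x - g y) / (x - y) := by
    filter_upwards [isOpen_ne.mem_nhds hxy] with z hz
    exact dq_of_ne (Ne.symm hz)
  refine (h1.congr_of_eventuallyEq h2).congr_deriv ?_
  rw [dq_of_ne hxy.symm, diffQuot]
  field_simp
  ring

/-- Each quotient satisfies ∂_y Q = (Q - g'(y))/(x - y). The product rule therefore reproduces |n|
times the integrand of T_0 and removes one factor in the other terms. -/
theorem hasDerivAt_dqProd {l : ℕ} {f : Fin l → ℝ → ℝ} (hf : ∀ k, Differentiable ℝ (f k))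
    (n : Fin l → ℕ) {x y : ℝ} (hxy : y ≠ x) :
    HasDerivAt (dqProd f n x) ((∑ k, (n k : ℝ)) * (dqProd f n x y / (x - y)) -
      ∑ k, (n k : ℝ) * (deriv (f k) y * dqProd f (lower n k) x y / (x - y))) y := by
  have h1 := HasDerivAt.fun_finsetProd (u := Finset.univ) (f := fun k y => dq (f k) x y ^ n k)
    (x := y) fun k _ => (hasDerivAt_dq (hf k) hxy).fun_pow (n k)
  refine h1.congr_deriv ?_
  rw [Finset.sum_mul, ← Finset.sum_sub_distrib]
  refine Finset.sum_congr rfl fun k _ => ?_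
  rcases eq_or_ne (n k) 0 with hk | hk
  · simp [hk]
  · have e1 : (∏ j ∈ Finset.univ.erase k, dq (f j) x y ^ n j) * dq (f k) x y ^ (n k - 1)
        = dqProd f (lower n k) x y := by
      rw [dqProd, ← Finset.mul_prod_erase _ _ (Finset.mem_univ k), mul_comm]
      congr 1
      · simp [lower]
      · refine Finset.prod_congr rfl fun j hj => ?_
        rw [lower, Function.update_of_ne (Finset.ne_of_mem_erase hj)]
    rw [dqProd_lower f n k hk x y, smul_eq_mul, ← e1]
    ring

/-! ### Decaying functions and their Hilbert transforms -/

theorem PVExists.hasPV_hilbert {g : ℝ → ℝ} {x : ℝ} (h : PVExists (fun y => g y / (x - y)) x) :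
    HasPV (fun y => g y / (x - y)) x (Real.pi * hilbert g x) := by
  rw [hilbert, ← mul_assoc, mul_one_div_cancel Real.pi_ne_zero, one_mul]
  exact h.hasPV

theorem HasPV.hilbert_eq {g : ℝ → ℝ} {x L : ℝ} (h : HasPV (fun y => g y / (x - y)) x L) :
    Real.pi * hilbert g x = L :=
  (PVExists.hasPV_hilbert ⟨L, h⟩).unique h

/-- `g` has modulus of continuity `ω` and decays like `1 / |x|`. -/
def Decaying (ω : ℝ → ℝ) (g : ℝ → ℝ) : Prop := ∃ C, HasMod ω C g ∧ HasDecay C g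

section

variable {ω Ω : ℝ → ℝ} {K C C' A B : ℝ} {g k : ℝ → ℝ}

theorem HasDecay.mono (hg : HasDecay C g) (hC : C ≤ C') : HasDecay C' g :=
  fun x => (hg x).trans hC

theorem decaying_of (h : ModData ω Ω K) (hg : HasMod ω C g) (hg' : HasDecay C' g) :
    Decaying ω g :=
  ⟨max C C', hg.mono h (le_max_left _ _), hg'.mono (le_max_right _ _)⟩

theorem Decaying.mul (hg : Decaying ω g) (h : ModData ω Ω K) (hk : HasMod ω B k) :
    Decaying ω fun x => g x * k x := by
  obtain ⟨C, h1, h2⟩ := hg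
  refine decaying_of h (h1.mul hk) (C' := C * B) fun x => ?_
  rw [abs_mul, mul_right_comm]
  exact mul_le_mul (h2 x) (hk.bdd x) (abs_nonneg _) h1.nonneg

theorem Decaying.add (hg : Decaying ω g) (h : ModData ω Ω K) (hk : Decaying ω k) :
    Decaying ω fun x => g x + k x := by
  obtain ⟨C, h1, h2⟩ := hg
  obtain ⟨C', h3, h4⟩ := hk
  refine decaying_of h (h1.add h3) (C' := C + C') fun x => ?_
  refine (mul_le_mul_of_nonneg_right (abs_add_le _ _) (by positivity)).trans ?_
  rw [add_mul]
  exact add_le_add (h2 x) (h4 x)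

theorem Decaying.const_mul (hg : Decaying ω g) (h : ModData ω Ω K) (c : ℝ) :
    Decaying ω fun x => c * g x := by
  obtain ⟨C, h1, h2⟩ := hg
  refine decaying_of h (h1.const_mul c) (C' := |c| * C) fun x => ?_
  rw [abs_mul, mul_assoc]
  exact mul_le_mul_of_nonneg_left (h2 x) (abs_nonneg _)

theorem Decaying.hilbertExists (hg : Decaying ω g) (h : ModData ω Ω K) : HilbertExists g := by
  obtain ⟨C, h1, h2⟩ := hg
  intro x
  obtain ⟨L, hL, -⟩ := h1.exists_hasPV h (mul_nonneg h1.nonneg (by norm_num)) (h2.lb_far x)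
  exact ⟨L, hL⟩

/-- A product has a regular Hilbert transform if both factors do. -/
theorem Decaying.exists_hasMod_hilbert_mul (hg : Decaying ω g) (h : ModData ω Ω K)
    (hk : Decaying ω k) (hHg : ∃ C, HasMod ω C (hilbert g)) (hHk : ∃ C, HasMod ω C (hilbert k)) :
    ∃ C, HasMod ω C (hilbert fun y => g y * k y) := by
  have hgk := hg.hilbertExists h
  have hke := hk.hilbertExists h
  have hprod : HilbertExists fun y => g y * k y := by
    obtain ⟨C, h1, h2⟩ := hk
    exact (hg.mul h h1).hilbertExists h
  obtain ⟨C, h1, h2⟩ := hg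
  obtain ⟨C', h3, h4⟩ := hk
  obtain ⟨Cg, hHg⟩ := hHg
  obtain ⟨Ck, hHk⟩ := hHk
  obtain ⟨J, CJ, hJ, hJm⟩ := (bilData_mul h h1 h2 h3 h4).exists_hasMod h
  have hp := Real.pi_ne_zero
  -- Expanding (g(x)-g(y))(k(x)-k(y))/(x-y) expresses H[gk] through gH[k], kH[g] and a bilinear
  -- integral; the constant term has principal value zero.
  have key : ∀ x, hilbert (fun y => g y * k y) x =
      Real.pi⁻¹ * J x + (g x * hilbert k x + k x * hilbert g x) := by
    intro x
    have e1 := (((hprod x).hasPV_hilbert.sub ((hke x).hasPV_hilbert.const_mul (g x))).sub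
      ((hgk x).hasPV_hilbert.const_mul (k x))).add (hasPV_const_div x (g x * k x))
    have e2 := (hJ x).unique (e1.congr_ne x fun y _ => by ring)
    rw [e2]
    field_simp
    ring
  rw [show hilbert (fun y => g y * k y) = _ from funext key]
  exact ⟨_, (hJm.const_mul Real.pi⁻¹).add ((h1.mul hHk).add (h3.mul hHg))⟩

/-- Bounded functions with bounded derivative have modulus `ω`. -/
theorem exists_hasMod_of_deriv (h : ModData ω Ω K) {f : ℝ → ℝ} (hf : Differentiable ℝ f)
    (hb : ∀ x, |f x| ≤ B) (hf' : ∀ x, |deriv f x| ≤ C) : ∃ C', HasMod ω C' f := by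
  have hB : 0 ≤ B := (abs_nonneg _).trans (hb 0)
  have hC : 0 ≤ C := (abs_nonneg _).trans (hf' 0)
  have hK := h.K_pos
  have h1 := h.one_le
  have hCK := mul_nonneg hC hK.le
  have hBK := mul_nonneg hB hK.le
  refine ⟨C * K + 2 * B * K + B, ⟨fun x => (hb x).trans (by linarith), fun x y => ?_⟩⟩
  have hω := h.nonneg |x - y|
  rcases eq_or_ne x y with rfl | hxy
  · simpa using mul_nonneg (by positivity : 0 ≤ C * K + 2 * B * K + B) (h.nonneg 0)
  have hd : 0 < |x - y| := abs_pos.mpr (sub_ne_zero.mpr hxy)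
  rcases le_or_gt |x - y| 1 with h2 | h2
  · have h3 : |f x - f y| ≤ C * |x - y| := by
      have := Convex.norm_image_sub_le_of_norm_deriv_le (𝕜 := ℝ) (s := Set.univ) (f := f)
        (fun z _ => hf z) (fun z _ => hf' z) convex_univ (Set.mem_univ y) (Set.mem_univ x)
      simpa [Real.norm_eq_abs] using this
    have h4 : |x - y| ≤ K * ω |x - y| :=
      ((le_sqrt_self hd.le h2).trans (sqrt_le_sqrt_sqrt h2)).trans (h.pow _ hd h2)
    calc |f x - f y| ≤ C * (K * ω |x - y|) := h3.trans (mul_le_mul_of_nonneg_left h4 hC)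
      _ ≤ _ := by nlinarith [mul_nonneg hB hω, mul_nonneg (mul_nonneg hB hK.le) hω]
  · have h4 : 1 ≤ K * ω |x - y| := by
      have e1 := h.pow 1 one_pos le_rfl
      rw [Real.sqrt_one, Real.sqrt_one] at e1
      exact e1.trans (mul_le_mul_of_nonneg_left (h.mono h2.le) hK.le)
    have h3 : |f x - f y| ≤ 2 * B := (abs_sub _ _).trans (by linarith [hb x, hb y])
    calc |f x - f y| ≤ 2 * B * (K * ω |x - y|) :=
          h3.trans (le_mul_of_one_le_right (by positivity) h4)
      _ ≤ _ := by nlinarith [mul_nonneg hB hω, mul_nonneg (mul_nonneg hC hK.le) hω]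

end

end CriticalHilbert

namespace CriticalHilbert

/-! ### The operators `T_j` -/

/-- The standing assumptions on the components of `f`. -/
structure CurveData (ω : ℝ → ℝ) (A : ℝ) {l : ℕ} (f : Fin l → ℝ → ℝ) : Prop where
  diff : ∀ k, Differentiable ℝ (f k)
  bdd : ∀ k, ∃ B, ∀ x, |f k x| ≤ B
  mod : ∀ k, ∃ C, HasMod ω C (deriv (f k))
  supp : ∀ k x, A < |x| → f k x = 0
  hil : ∀ k, ∃ C, HasMod ω C (hilbert (deriv (f k)))

section

variable {ω Ω : ℝ → ℝ} {K A : ℝ} {l : ℕ} {f : Fin l → ℝ → ℝ}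

theorem CurveData.deriv_supp (D : CurveData ω A f) (j : Fin l) {x : ℝ} (hx : A < |x|) :
    deriv (f j) x = 0 := deriv_eq_zero_of_support (D.supp j) hx

theorem CurveData.preKernel (D : CurveData ω A f) (h : ModData ω Ω K) (n : Fin l → ℕ) :
    ∃ C, PreKernel ω C (dqProd f n) :=
  exists_preKernel_dqProd h D.diff D.mod n

theorem CurveData.symKernel (D : CurveData ω A f) (h : ModData ω Ω K) {n : Fin l → ℕ}
    (hn : n ≠ 0) : ∃ C, SymKernel ω A C (dqProd f n) :=
  exists_symKernel_dqProd h D.diff D.bdd D.mod D.supp n hn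

theorem CurveData.decaying_deriv (D : CurveData ω A f) (h : ModData ω Ω K) (hA : 0 ≤ A)
    (j : Fin l) : Decaying ω (deriv (f j)) := by
  obtain ⟨C, hC⟩ := D.mod j
  exact decaying_of h hC (hasDecay_of_support hC hA fun x hx => D.deriv_supp j hx)

theorem CurveData.opT_aux (D : CurveData ω A f) (h : ModData ω Ω K) (hA : 0 ≤ A) (j : Fin l)
    (n : Fin l → ℕ) : ∃ B, ∀ x,
      HasPV (fun y => deriv (f j) y * dqProd f n x y / (x - y)) x (opT f j n x) ∧
      PVExists (integrand f j n x) x ∧ |opT f j n x| ≤ B := by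
  obtain ⟨C, hF⟩ := D.preKernel h n
  obtain ⟨C', h1, h2⟩ := D.decaying_deriv h hA j
  refine ⟨2 * (2 * C' * C) * K + C' * C * 3, fun x => ?_⟩
  have h3 : ∀ y, |deriv (f j) y * dqProd f n x y| * (1 + |0 - y|) ≤ C' * C := fun y => by
    rw [abs_mul, mul_right_comm, zero_sub, abs_neg]
    exact mul_le_mul (h2 y) (hF.bdd x y) (abs_nonneg _) h1.nonneg
  obtain ⟨L, hL, hLb⟩ := (h1.mul (hF.hasMod_right x)).exists_hasPV h (x := x)
    (mul_nonneg (mul_nonneg h1.nonneg hF.nonneg) (by norm_num)) (lb_far_of_decay x h3)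
  have h4 : HasPV (integrand f j n x) x L := hL.congr_ne x fun y hy => by
    rw [integrand, dqProd_of_ne f n hy.symm]; ring
  have h5 : opT f j n x = L := h4.pv_eq
  rw [h5]
  exact ⟨hL, ⟨L, h4⟩, hLb⟩

theorem CurveData.hasPV_opT (D : CurveData ω A f) (h : ModData ω Ω K) (hA : 0 ≤ A) (j : Fin l)
    (n : Fin l → ℕ) (x : ℝ) :
    HasPV (fun y => deriv (f j) y * dqProd f n x y / (x - y)) x (opT f j n x) := by
  obtain ⟨B, hB⟩ := D.opT_aux h hA j n
  exact (hB x).1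

theorem CurveData.hasDecay_opT (D : CurveData ω A f) (h : ModData ω Ω K) (hA : 1 ≤ A)
    (j : Fin l) (n : Fin l → ℕ) : ∃ C, HasDecay C (opT f j n) := by
  have hA0 : 0 ≤ A := by linarith
  obtain ⟨B, hB⟩ := D.opT_aux h hA0 j n
  obtain ⟨C, hF⟩ := D.preKernel h n
  obtain ⟨C', h1⟩ := D.mod j
  exact exists_hasDecay hA (a := fun x y => deriv (f j) y * dqProd f n x y)
    (fun x => ((h1.mul (hF.hasMod_right x)).continuous h).aestronglyMeasurable)
    (fun x y => (h1.mul (hF.hasMod_right x)).bdd y)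
    (fun x y _ hy => by rw [D.deriv_supp j hy, zero_mul]) (fun x => (hB x).2.2)
    fun x => (hB x).1

theorem CurveData.hasPV_opT0 (D : CurveData ω A f) (h : ModData ω Ω K) {n : Fin l → ℕ}
    (hn : n ≠ 0) (x : ℝ) : HasPV (fun y => dqProd f n y x / (x - y)) x (opT0 f n x) ∧
      PVExists (integrand0 f n x) x := by
  obtain ⟨C, hF⟩ := D.symKernel h hn
  obtain ⟨L, hL, -⟩ := hF.exists_partial h x x
  have h1 : HasPV (integrand0 f n x) x L := hL.congr_ne x fun y hy => by
    rw [integrand0, hF.symm y x, dqProd_of_ne f n hy.symm]; ring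
  have h2 : opT0 f n x = L := h1.pv_eq
  exact ⟨h2 ▸ hL, L, h1⟩

theorem hasPV_integrand0_zero (f : Fin l → ℝ → ℝ) (x : ℝ) : HasPV (integrand0 f 0 x) x 0 :=
  (hasPV_const_div x 1).congr_ne x fun y _ => by simp [integrand0, prodQuot]

theorem hilbert_zero : hilbert (fun _ => 0) = fun _ => 0 := by
  refine funext fun x => ?_
  have := (hasPV_const_div x 0).hilbert_eq
  exact (mul_eq_zero.mp this).resolve_left Real.pi_ne_zero

theorem opT0_zero (f : Fin l → ℝ → ℝ) : opT0 f 0 = fun _ => 0 :=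
  funext fun x => (hasPV_integrand0_zero f x).pv_eq

theorem CurveData.hasPV_kerN (D : CurveData ω A f) (h : ModData ω Ω K) {n : Fin l → ℕ}
    (hn : n ≠ 0) (x z : ℝ) :
    HasPV (fun y => dqProd f n y z / (x - y)) x (Real.pi * kerN f n x z) ∧
      PVExists (fun y => prodQuot f n y z / (x - y)) x := by
  obtain ⟨C, hF⟩ := D.symKernel h hn
  obtain ⟨L, hL, -⟩ := hF.exists_partial h x z
  have h1 : HasPV (fun y => prodQuot f n y z / (x - y)) x L := hL.congr_ne z fun y hy => by
    rw [dqProd_of_ne f n hy]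
  have h2 : Real.pi * kerN f n x z = L := h1.hilbert_eq
  exact ⟨h2 ▸ hL, L, h1⟩

theorem CurveData.kerN_diag (D : CurveData ω A f) (h : ModData ω Ω K) {n : Fin l → ℕ}
    (hn : n ≠ 0) (x : ℝ) : Real.pi * kerN f n x x = opT0 f n x :=
  (D.hasPV_kerN h hn x x).1.unique (D.hasPV_opT0 h hn x).1

theorem CurveData.hasDecay_opT0 (D : CurveData ω A f) (h : ModData ω Ω K) (hA : 1 ≤ A)
    {n : Fin l → ℕ} (hn : n ≠ 0) : ∃ C, HasDecay C (opT0 f n) := by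
  obtain ⟨C, hF⟩ := D.symKernel h hn
  exact exists_hasDecay hA (a := fun x y => dqProd f n y x)
    (fun x => ((hF.hasMod_left x).continuous h).aestronglyMeasurable) (fun x y => hF.bdd y x)
    (fun x y hx hy => hF.supp y x hy hx)
    (fun x => (hF.pvBound h x x).abs_le ((hF.hasMod_left x).continuous h).aestronglyMeasurable
      (D.hasPV_opT0 h hn x).1) fun x => (D.hasPV_opT0 h hn x).1

/-- Integration by parts. -/
theorem CurveData.sum_mul_opT0 (D : CurveData ω A f) (h : ModData ω Ω K) (hA : 0 ≤ A)
    {n : Fin l → ℕ} (hn : n ≠ 0) (x : ℝ) :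
    (∑ k, (n k : ℝ)) * opT0 f n x = ∑ k, (n k : ℝ) * opT f k (lower n k) x := by
  obtain ⟨C, hF⟩ := D.symKernel h hn
  have h1 := ((D.hasPV_opT0 h hn x).1.const_mul (∑ k, (n k : ℝ))).sub
    (HasPV.sum Finset.univ (g := fun k y =>
      (n k : ℝ) * (deriv (f k) y * dqProd f (lower n k) x y / (x - y))) fun k _ =>
      (D.hasPV_opT h hA k (lower n k) x).const_mul (n k : ℝ))
  refine sub_eq_zero.mp (h1.eq_zero_of_hasDerivAt (G := dqProd f n x) (C := C) (fun y hy => ?_)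
    ((hF.hasMod_right x).continuous h).continuousAt fun y => hF.decay x y)
  rw [hF.symm y x]
  exact hasDerivAt_dqProd D.diff n hy

theorem sum_cast_pos {n : Fin l → ℕ} (hn : n ≠ 0) : 0 < ∑ k, (n k : ℝ) := by
  obtain ⟨k, hk⟩ := Function.ne_iff.mp hn
  exact Finset.sum_pos' (fun i _ => Nat.cast_nonneg _)
    ⟨k, Finset.mem_univ k, Nat.cast_pos.mpr (Nat.pos_of_ne_zero hk)⟩

theorem CurveData.opT0_eq (D : CurveData ω A f) (h : ModData ω Ω K) (hA : 0 ≤ A)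
    {n : Fin l → ℕ} (hn : n ≠ 0) (x : ℝ) :
    opT0 f n x = ∑ k, (n k : ℝ) / (∑ i, (n i : ℝ)) * opT f k (lower n k) x := by
  have h1 := D.sum_mul_opT0 h hA hn x
  have h2 := (sum_cast_pos hn).ne'
  have h3 : opT0 f n x = (∑ k, (n k : ℝ) * opT f k (lower n k) x) / ∑ i, (n i : ℝ) := by
    rw [← h1, mul_div_cancel_left₀ _ h2]
  rw [h3, Finset.sum_div]
  exact Finset.sum_congr rfl fun k _ => by ring

theorem CurveData.opT_zero (D : CurveData ω A f) (h : ModData ω Ω K) (hA : 0 ≤ A) (j : Fin l)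
    (x : ℝ) : opT f j 0 x = Real.pi * hilbert (deriv (f j)) x := by
  have h1 : HasPV (fun y => deriv (f j) y / (x - y)) x (opT f j 0 x) := by
    simpa [dqProd] using D.hasPV_opT h hA j 0 x
  exact h1.hilbert_eq.symm

/-- Regularity of `T_j` from that of `T_0`. -/
theorem CurveData.exists_hasMod_opT (D : CurveData ω A f) (h : ModData ω Ω K) (hA : 0 ≤ A)
    {n : Fin l → ℕ} (hn : n ≠ 0) (hT : ∃ C, HasMod ω C (opT0 f n)) (j : Fin l) :
    ∃ C, HasMod ω C (opT f j n) := by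
  obtain ⟨C, hF⟩ := D.symKernel h hn
  have hd := D.decaying_deriv h hA j
  have hdH := hd.hilbertExists h
  obtain ⟨C', h1, h2⟩ := hd
  obtain ⟨CT, hT⟩ := hT
  obtain ⟨CH, hH⟩ := D.hil j
  obtain ⟨J, CJ, hJ, hJm⟩ := (hF.bilData h h1 h2).exists_hasMod h
  -- Expansion of (f_j'(x)-f_j'(y))(F(x,x)-F(x,y))/(x-y): the four products are an odd term, T_0,
  -- H[f_j'] and T_j.
  have key : ∀ x, opT f j n x = J x + (deriv (f j) x * opT0 f n x +
      Real.pi * (dqProd f n x x * hilbert (deriv (f j)) x)) := by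
    intro x
    have e1 := (((hasPV_const_div x (deriv (f j) x * dqProd f n x x)).sub
      ((D.hasPV_opT0 h hn x).1.const_mul (deriv (f j) x))).sub
      ((hdH x).hasPV_hilbert.const_mul (dqProd f n x x))).add (D.hasPV_opT h hA j n x)
    have e2 := (hJ x).unique (e1.congr_ne x fun y _ => by rw [hF.symm y x]; ring)
    rw [e2]
    ring
  rw [show opT f j n = _ from funext key]
  exact ⟨_, hJm.add ((h1.mul hT).add ((hF.hasMod_diag.mul hH).const_mul Real.pi))⟩

theorem exists_hasMod_sum {ι : Type*} (s : Finset ι) {g : ι → ℝ → ℝ}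
    (hg : ∀ i ∈ s, ∃ C, HasMod ω C (g i)) : ∃ C, HasMod ω C fun x => ∑ i ∈ s, g i x := by
  choose! C hC using hg
  refine ⟨∑ i ∈ s, C i, fun x => ?_, fun x y => ?_⟩
  · exact (Finset.abs_sum_le_sum_abs _ _).trans (Finset.sum_le_sum fun i hi => (hC i hi).bdd x)
  · rw [← Finset.sum_sub_distrib, Finset.sum_mul]
    exact (Finset.abs_sum_le_sum_abs _ _).trans
      (Finset.sum_le_sum fun i hi => (hC i hi).diff x y)

theorem sum_lower_lt {n : Fin l → ℕ} {k : Fin l} (hk : n k ≠ 0) :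
    ∑ i, lower n k i < ∑ i, n i := by
  refine Finset.sum_lt_sum (fun i _ => ?_) ⟨k, Finset.mem_univ k, ?_⟩
  · rcases eq_or_ne i k with rfl | hi
    · simp [lower]
    · rw [lower, Function.update_of_ne hi]
  · simp only [lower, Function.update_self]
    omega

/-- A weighted sum over lowered multi-indices only sees the indices with `n k ≠ 0`. -/
theorem exists_hasMod_lower_sum {n : Fin l → ℕ} {g : Fin l → ℝ → ℝ}
    (hg : ∀ k, n k ≠ 0 → ∃ C, HasMod ω C (g k)) :
    ∃ C, HasMod ω C fun x => ∑ k, (n k : ℝ) / (∑ i, (n i : ℝ)) * g k x := by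
  refine exists_hasMod_sum Finset.univ fun k _ => ?_
  rcases eq_or_ne (n k) 0 with hk | hk
  · refine ⟨0, fun x => ?_, fun x y => ?_⟩ <;> simp [hk]
  · obtain ⟨C, hC⟩ := hg k hk
    exact ⟨_, hC.const_mul _⟩

/-- Strong induction on |n|: integration by parts reduces T_0 to lower order, and T_j of the same
order is then reduced to T_0. At n = 0 the claim is the regularity of H[f_j']. -/
theorem CurveData.hasMod_op (D : CurveData ω A f) (h : ModData ω Ω K) (hA : 0 ≤ A)
    (n : Fin l → ℕ) :
    (∃ C, HasMod ω C (opT0 f n)) ∧ ∀ j, ∃ C, HasMod ω C (opT f j n) := by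
  induction hm : ∑ i, n i using Nat.strong_induction_on generalizing n with
  | _ m ih =>
    rcases eq_or_ne n 0 with rfl | hn
    · refine ⟨⟨0, ?_⟩, fun j => ?_⟩
      · rw [opT0_zero]
        exact ⟨fun x => by simp, fun x y => by simp⟩
      · obtain ⟨C, hC⟩ := D.hil j
        rw [show opT f j 0 = _ from funext (D.opT_zero h hA j)]
        exact ⟨_, hC.const_mul Real.pi⟩
    · have h0 : ∃ C, HasMod ω C (opT0 f n) := by
        rw [show opT0 f n = _ from funext (D.opT0_eq h hA hn)]
        exact exists_hasMod_lower_sum fun k hk =>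
          (ih _ (hm ▸ sum_lower_lt hk) (lower n k) rfl).2 k
      exact ⟨h0, D.exists_hasMod_opT h hA hn h0⟩

theorem CurveData.decaying_opT (D : CurveData ω A f) (h : ModData ω Ω K) (hA : 1 ≤ A)
    (j : Fin l) (n : Fin l → ℕ) : Decaying ω (opT f j n) := by
  obtain ⟨C, hC⟩ := (D.hasMod_op h (by linarith) n).2 j
  obtain ⟨C', hC'⟩ := D.hasDecay_opT h hA j n
  exact decaying_of h hC hC'

theorem CurveData.decaying_opT0 (D : CurveData ω A f) (h : ModData ω Ω K) (hA : 1 ≤ A)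
    (n : Fin l → ℕ) : Decaying ω (opT0 f n) := by
  rcases eq_or_ne n 0 with rfl | hn
  · rw [opT0_zero]
    exact ⟨0, ⟨fun x => by simp, fun x y => by simp⟩, fun x => by simp⟩
  obtain ⟨C, hC⟩ := (D.hasMod_op h (by linarith) n).1
  obtain ⟨C', hC'⟩ := D.hasDecay_opT0 h hA hn
  exact decaying_of h hC hC'

/-! ### The Hilbert transforms of the operators -/

/-- Up to the factor π, the remainder is the bilinear integral with g = f_j' and M = πN, whose
diagonal T_0 is already known to be regular. -/
theorem CurveData.exists_rem (D : CurveData ω A f) (h : ModData ω Ω K) (hA : 1 ≤ A)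
    (j : Fin l) {n : Fin l → ℕ} (hn : n ≠ 0) :
    (∀ x, HasPV (integrandRem f j n x) x (Jrem f j n x)) ∧ ∃ C, HasMod ω C (Jrem f j n) := by
  obtain ⟨C, hF⟩ := D.symKernel h hn
  obtain ⟨C', h1, h2⟩ := D.decaying_deriv h (by linarith) j
  obtain ⟨CT, hT⟩ := (D.hasMod_op h (by linarith) n).1
  obtain ⟨C₁, hbil⟩ := hF.exists_bilData_partial h
    (P := fun x z => Real.pi * kerN f n x z) (fun x z => (D.hasPV_kerN h hn x z).1) h1 h2
    (B := CT) (by simpa only [D.kerN_diag h hn] using hT)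
  obtain ⟨J, CJ, hJ, hJm⟩ := hbil.exists_hasMod h
  have e1 : ∀ x, HasPV (integrandRem f j n x) x (Real.pi⁻¹ * J x) := fun x => by
    refine ((hJ x).const_mul Real.pi⁻¹).congr_ne x fun y _ => ?_
    rw [integrandRem]
    have := Real.pi_ne_zero
    field_simp
  have e2 : Jrem f j n = fun x => Real.pi⁻¹ * J x := funext fun x => (e1 x).pv_eq
  rw [e2]
  exact ⟨e1, _, hJm.const_mul _⟩

/-- The Hilbert transform at x of the operator symmetrised with g = f_j' - f_j'(x) is computed in
two ways: from its expression through T_j and T_0, and from the Poincaré–Bertrand identity, whose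
correction vanishes because g(x) = 0. -/
theorem CurveData.hilbert_opT (D : CurveData ω A f) (h : ModData ω Ω K) (hA : 1 ≤ A)
    (j : Fin l) {n : Fin l → ℕ} (hn : n ≠ 0) (x : ℝ) :
    hilbert (opT f j n) x = -hilbert (fun y => deriv (f j) y * opT0 f n y) x +
      2 * deriv (f j) x * hilbert (opT0 f n) x + hilbert (deriv (f j)) x * opT0 f n x +
      Jrem f j n x := by
  have hA0 : 0 ≤ A := by linarith
  obtain ⟨C, hF⟩ := D.symKernel h hn
  have hd := D.decaying_deriv h hA0 j
  have hdT := D.decaying_opT h hA j n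
  have hdT0 := D.decaying_opT0 h hA n
  obtain ⟨CT, hT⟩ := (D.hasMod_op h hA0 n).1
  have hdm := hd.mul h hT
  obtain ⟨C', h1, -⟩ := id hd
  set c := deriv (f j) x with hc
  -- The constant depends on the evaluation point x, which is harmless because the identity is
  -- proved one x at a time; it accounts for the term 2f_j'H[T_0].
  set g : ℝ → ℝ := fun y => deriv (f j) y - c with hg
  have hgm : HasMod ω (C' + C') g :=
    ⟨fun y => (abs_sub _ _).trans (add_le_add (h1.bdd y) (h1.bdd x)), fun y z => by
      have := h1.diff y z
      simp only [hg, sub_sub_sub_cancel_right]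
      exact this.trans (mul_le_mul_of_nonneg_right (by linarith [h1.nonneg]) (h.nonneg _))⟩
  have hSd : Decaying ω fun y => opT f j n y + deriv (f j) y * opT0 f n y +
      -(2 * c) * opT0 f n y := (hdT.add h hdm).add h (hdT0.const_mul h _)
  have hS : ∀ y, HasPV (fun z => dqProd f n y z * (g y + g z) / (y - z)) y
      (opT f j n y + deriv (f j) y * opT0 f n y + -(2 * c) * opT0 f n y) := by
    intro y
    have e0 := (D.hasPV_opT0 h hn y).1
    refine (((D.hasPV_opT h hA0 j n y).add (e0.const_mul (deriv (f j) y))).add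
      (e0.const_mul (-(2 * c)))).congr_ne y fun z _ => ?_
    rw [hF.symm z y]
    simp only [hg]
    ring
  obtain ⟨CS, hSm, hSd⟩ := hSd
  have hL := ((hdT.hilbertExists h x).hasPV_hilbert.add (hdm.hilbertExists h x).hasPV_hilbert).add
    ((hdT0.hilbertExists h x).hasPV_hilbert.const_mul (-(2 * c)))
  have hgH := (hd.hilbertExists h x).hasPV_hilbert.sub (hasPV_const_div x c)
  have hL' := (hgH.const_mul (opT0 f n x)).add
    (((D.exists_rem h hA j hn).1 x).const_mul Real.pi)
  -- On the right-hand side g(z)N(x,z) is split as g(z)N(x,x) plus the remainder integrand; the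
  -- first part gives T_0(x)H[f_j'](x).
  have key := hF.pv_eq h hA0 hgm (P := fun x z => Real.pi * kerN f n x z)
    (fun x z => (D.hasPV_kerN h hn x z).1) hS hSm hSd (x := x) (sub_self _)
    (hL.congr_ne x fun y _ => by ring) (hL'.congr_ne x fun z _ => by
      rw [← D.kerN_diag h hn, integrandRem, ← hc]
      simp only [hg]
      ring)
  have hp := Real.pi_ne_zero
  refine mul_left_cancel₀ hp ?_
  linear_combination key

theorem CurveData.hilbert_opT0 (D : CurveData ω A f) (h : ModData ω Ω K) (hA : 1 ≤ A)
    {n : Fin l → ℕ} (hn : n ≠ 0) (x : ℝ) : hilbert (opT0 f n) x =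
      ∑ k, (n k : ℝ) / (∑ i, (n i : ℝ)) * hilbert (opT f k (lower n k)) x := by
  have h1 := HasPV.sum Finset.univ (g := fun k y =>
    (n k : ℝ) / (∑ i, (n i : ℝ)) * (opT f k (lower n k) y / (x - y))) fun k _ =>
    ((D.decaying_opT h hA k (lower n k)).hilbertExists h x).hasPV_hilbert.const_mul _
  have h2 : HasPV (fun y => opT0 f n y / (x - y)) x _ := h1.congr_ne x fun y _ => by
    rw [D.opT0_eq h (by linarith) hn y, Finset.sum_div]
    exact Finset.sum_congr rfl fun k _ => by ring
  refine mul_left_cancel₀ Real.pi_ne_zero (h2.hilbert_eq.trans ?_)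
  rw [Finset.mul_sum]
  exact Finset.sum_congr rfl fun k _ => by ring

theorem CurveData.hilbert_deriv_mul_opT0 (D : CurveData ω A f) (h : ModData ω Ω K) (hA : 1 ≤ A)
    (j : Fin l) {n : Fin l → ℕ} (hn : n ≠ 0) (x : ℝ) :
    hilbert (fun y => deriv (f j) y * opT0 f n y) x = ∑ k, (n k : ℝ) / (∑ i, (n i : ℝ)) *
      hilbert (fun y => deriv (f j) y * opT f k (lower n k) y) x := by
  have h0 : ∀ k, HilbertExists fun y => deriv (f j) y * opT f k (lower n k) y := fun k => by
    obtain ⟨C, hC, -⟩ := D.decaying_opT h hA k (lower n k)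
    exact ((D.decaying_deriv h (by linarith) j).mul h hC).hilbertExists h
  have h1 := HasPV.sum Finset.univ (g := fun k y => (n k : ℝ) / (∑ i, (n i : ℝ)) *
    (deriv (f j) y * opT f k (lower n k) y / (x - y))) fun k _ =>
    (h0 k x).hasPV_hilbert.const_mul _
  have h2 : HasPV (fun y => deriv (f j) y * opT0 f n y / (x - y)) x _ :=
    h1.congr_ne x fun y _ => by
      rw [D.opT0_eq h (by linarith) hn y, Finset.mul_sum, Finset.sum_div]
      exact Finset.sum_congr rfl fun k _ => by ring
  refine mul_left_cancel₀ Real.pi_ne_zero (h2.hilbert_eq.trans ?_)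
  rw [Finset.mul_sum]
  exact Finset.sum_congr rfl fun k _ => by ring

theorem CurveData.hilbert_opT_zero (D : CurveData ω A f) (h : ModData ω Ω K) (hA : 1 ≤ A)
    (j : Fin l) (x : ℝ) : hilbert (opT f j 0) x = -Real.pi * deriv (f j) x := by
  have hA0 : 0 ≤ A := by linarith
  obtain ⟨C, hC⟩ := D.mod j
  obtain ⟨C', h1, h2⟩ := D.decaying_opT h hA j 0
  have h3 := hasPV_hilbert_hilbert h hA0 hC (fun y hy => D.deriv_supp j hy) (S := opT f j 0)
    (fun y => by simpa [dqProd] using D.hasPV_opT h hA0 j 0 y) h1 h2 x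
  refine mul_left_cancel₀ Real.pi_ne_zero (h3.hilbert_eq.trans ?_)
  ring

/-- The same induction on |n|, now for the Hilbert transforms. The term H[f_j' T_0] is controlled by
the product estimate once H[T_0] is regular, and the base case is H² = -1. -/
theorem CurveData.hasMod_hilbert_op (D : CurveData ω A f) (h : ModData ω Ω K) (hA : 1 ≤ A)
    (n : Fin l → ℕ) : (∃ C, HasMod ω C (hilbert (opT0 f n))) ∧
      ∀ j, ∃ C, HasMod ω C (hilbert (opT f j n)) := by
  induction hm : ∑ i, n i using Nat.strong_induction_on generalizing n with
  | _ m ih =>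
    rcases eq_or_ne n 0 with rfl | hn
    · refine ⟨⟨0, ?_⟩, fun j => ?_⟩
      · rw [opT0_zero, hilbert_zero]
        exact ⟨fun x => by simp, fun x y => by simp⟩
      · obtain ⟨C, hC⟩ := D.mod j
        rw [show hilbert (opT f j 0) = _ from funext (D.hilbert_opT_zero h hA j)]
        exact ⟨_, hC.const_mul _⟩
    · have h0 : ∃ C, HasMod ω C (hilbert (opT0 f n)) := by
        rw [show hilbert (opT0 f n) = _ from funext (D.hilbert_opT0 h hA hn)]
        exact exists_hasMod_lower_sum fun k hk =>
          (ih _ (hm ▸ sum_lower_lt hk) (lower n k) rfl).2 k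
      refine ⟨h0, fun j => ?_⟩
      have hd := D.decaying_deriv h (by linarith) j
      obtain ⟨C₁, h1⟩ := hd.exists_hasMod_hilbert_mul h (D.decaying_opT0 h hA n) (D.hil j) h0
      obtain ⟨C₂, h2⟩ := h0
      obtain ⟨C₃, h3⟩ := D.hil j
      obtain ⟨C₄, h4⟩ := D.mod j
      obtain ⟨C₅, h5⟩ := (D.hasMod_op h (by linarith) n).1
      obtain ⟨C₆, h6⟩ := (D.exists_rem h hA j hn).2
      have h7 := (((h1.const_mul (-1)).add ((h4.const_mul 2).mul h2)).add (h3.mul h5)).add h6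
      rw [show hilbert (opT f j n) = _ from funext (D.hilbert_opT h hA j hn)]
      exact ⟨_, by simpa only [neg_one_mul] using h7⟩

end

end CriticalHilbert

/-! ### From the hypotheses of the theorem to the standing assumptions -/

namespace CriticalHilbert

theorem exists_support_bound {l : ℕ} {f : Fin l → ℝ → ℝ} (hs : ∀ k, HasCompactSupport (f k)) :
    ∃ A : ℝ, 1 ≤ A ∧ ∀ k x, A < |x| → f k x = 0 := by
  have h1 : ∀ k, ∃ R : ℝ, ∀ x, R < |x| → f k x = 0 := fun k => by
    obtain ⟨R, hR⟩ := (hs k).isCompact.isBounded.subset_closedBall 0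
    refine ⟨R, fun x hx => ?_⟩
    by_contra hne
    have : x ∈ Metric.closedBall (0 : ℝ) R := hR (subset_tsupport _ hne)
    rw [mem_closedBall_zero_iff, Real.norm_eq_abs] at this
    linarith
  choose R hR using h1
  refine ⟨1 + ∑ k, |R k|, le_add_of_nonneg_right (Finset.sum_nonneg fun k _ => abs_nonneg _),
    fun k x hx => hR k x ?_⟩
  have h2 : |R k| ≤ ∑ k, |R k| :=
    Finset.single_le_sum (f := fun k => |R k|) (fun k _ => abs_nonneg _) (Finset.mem_univ k)
  linarith [le_abs_self (R k)]

/-- Regularity is assumed for the derivative of H[f], whereas the induction starts from H[f']; the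
two agree because H commutes with differentiation for compactly supported f. -/
theorem exists_curveData {φ : ℝ → ℝ} (hφ : IsModulus φ) {Ω : ℝ → ℝ} {K : ℝ}
    (h : ModData (clampMod φ) Ω K) {l : ℕ} {f : Fin l → ℝ → ℝ} (hf : ∀ k, MemC1 φ (f k))
    (hHf : ∀ k, MemC1 φ (hilbert (f k))) (hs : ∀ k, HasCompactSupport (f k)) :
    ∃ A : ℝ, 1 ≤ A ∧ CurveData (clampMod φ) A f := by
  obtain ⟨A, hA, hfA⟩ := exists_support_bound hs
  have hmod : ∀ k, ∃ C, HasMod (clampMod φ) C (deriv (f k)) := fun k =>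
    (memC_iff_hasMod hφ).mp (hf k).2.2
  refine ⟨A, hA, fun k => (hf k).1, fun k => (hf k).2.1, hmod, hfA, fun k => ?_⟩
  have hA0 : 0 ≤ A := by linarith
  obtain ⟨C, hC⟩ := hmod k
  obtain ⟨B, hB⟩ := (hf k).2.1
  obtain ⟨C', hC'⟩ := exists_hasMod_of_deriv h (hf k).1 hB hC.bdd
  have e1 := (decaying_of h hC' (hasDecay_of_support hC' hA0 (hfA k))).hilbertExists h
  have e2 := (decaying_of h hC (hasDecay_of_support hC hA0 fun y hy =>
    deriv_eq_zero_of_support (hfA k) hy)).hilbertExists h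
  have key : deriv (hilbert (f k)) = hilbert (deriv (f k)) := by
    funext x
    have h1 := (hasDerivAt_hilbert h hA0 (hf k).1 (hC'.mono h (le_max_right C C'))
      (hC.mono h (le_max_left C C')) (hfA k) (fun y => (e1 y).hasPV_hilbert)
      (fun y => (e2 y).hasPV_hilbert) x).const_mul Real.pi⁻¹
    simp only [inv_mul_cancel_left₀ Real.pi_ne_zero] at h1
    exact h1.deriv
  rw [← key]
  exact (memC_iff_hasMod hφ).mp (hHf k).2.2

end CriticalHilbert
theorem lemma3p2 (φ : ℝ → ℝ) (hφ : IsAdmissibleModulus φ) (l : ℕ) (f : Fin l → ℝ → ℝ)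
    (hf : ∀ k, MemC1 φ (f k)) (hHf : ∀ k, MemC1 φ (hilbert (f k)))
    (hsupp : ∀ k, HasCompactSupport (f k)) :
    -- the operators and their Hilbert transforms are well defined, and the latter lie in `C^φ`
    (∀ n : Fin l → ℕ,
      (∀ x, PVExists (integrand0 f n x) x) ∧ HilbertExists (opT0 f n) ∧
        MemC φ (hilbert (opT0 f n))) ∧
    (∀ (j : Fin l) (n : Fin l → ℕ),
      (∀ x, PVExists (integrand f j n x) x) ∧ HilbertExists (opT f j n) ∧
        MemC φ (hilbert (opT f j n))) ∧
    -- the formula for `j = 0`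
    (∀ n : Fin l → ℕ, (∀ k, 1 ≤ n k) → ∀ x,
      hilbert (opT0 f n) x =
        ∑ k, (n k : ℝ) / (∑ i, (n i : ℝ)) * hilbert (opT f k (lower n k)) x) ∧
    -- the formula for `j ∈ {1, …, l}`, all of whose terms are well defined
    (∀ (j : Fin l) (n : Fin l → ℕ), (∀ k, 1 ≤ n k) →
      HilbertExists (deriv (f j)) ∧
      (∀ k, HilbertExists (fun y => deriv (f j) y * opT f k (lower n k) y)) ∧
      (∀ z, HilbertExists (fun y => prodQuot f n y z)) ∧
      (∀ x, PVExists (integrandRem f j n x) x) ∧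
      ∀ x, hilbert (opT f j n) x =
        -(∑ k, (n k : ℝ) / (∑ i, (n i : ℝ)) *
            hilbert (fun y => deriv (f j) y * opT f k (lower n k) y) x)
        + 2 * deriv (f j) x *
            (∑ k, (n k : ℝ) / (∑ i, (n i : ℝ)) * hilbert (opT f k (lower n k)) x)
        + hilbert (deriv (f j)) x * opT0 f n x
        + Jrem f j n x) := by
  obtain ⟨K, h⟩ := hφ.exists_modData
  have hmem : ∀ {g : ℝ → ℝ}, (∃ C, HasMod (clampMod φ) C g) → MemC φ g :=
    (memC_iff_hasMod hφ.toIsModulus).mpr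
  obtain ⟨A, hA, D⟩ := exists_curveData hφ.toIsModulus h hf hHf hsupp
  have hA0 : 0 ≤ A := by linarith
  refine ⟨fun n => ⟨fun x => ?_, (D.decaying_opT0 h hA n).hilbertExists h,
    hmem (D.hasMod_hilbert_op h hA n).1⟩, fun j n => ⟨fun x => ?_,
    (D.decaying_opT h hA j n).hilbertExists h, hmem ((D.hasMod_hilbert_op h hA n).2 j)⟩,
    fun n hn x => ?_, fun j n hn => ?_⟩
  · rcases eq_or_ne n 0 with rfl | hn
    · exact ⟨0, hasPV_integrand0_zero f x⟩
    · exact (D.hasPV_opT0 h hn x).2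
  · obtain ⟨B, hB⟩ := D.opT_aux h hA0 j n
    exact (hB x).2.1
  -- With all exponents at least 1 this case occurs only for l = 0, where the sum is empty and T_0
  -- vanishes.
  · rcases eq_or_ne n 0 with rfl | hn0
    · rw [opT0_zero, hilbert_zero]
      simp
    · exact D.hilbert_opT0 h hA hn0 x
  · have hn0 : n ≠ 0 := fun h0 => by
      have := hn j
      rw [h0] at this
      exact absurd this (by simp)
    have hd := D.decaying_deriv h hA0 j
    refine ⟨hd.hilbertExists h, fun k => ?_, fun z x => (D.hasPV_kerN h hn0 x z).2,
      fun x => ⟨_, (D.exists_rem h hA j hn0).1 x⟩, fun x => ?_⟩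
    · obtain ⟨C, hC, -⟩ := D.decaying_opT h hA k (lower n k)
      exact (hd.mul h hC).hilbertExists h
    · rw [D.hilbert_opT h hA j hn0 x, D.hilbert_deriv_mul_opT0 h hA j hn0 x,
        D.hilbert_opT0 h hA hn0 x]
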